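/- Let $\mathbf k$ be an algebraically closed field of characteristic $0$ and let $U$ be an affine nonsingular surface over $\mathbf k$ with local coordinates $x_1,x_2$ (that is, $(x_1,x_2)\colon U\to\mathbb A^2$ is étale), small enough that $x_1,x_2$ have exactly one common zero $o\in U$ and that the ideals $(x_1),(x_2)$ of $\mathcal O(U)$ are prime; for example $U=\mathbb A^2$. **Monster tower.** $S(0)=U$, $\mathcal B(0)=TU$; $S(k+1)=\mathbb P\mathcal B(k)$ is the $\mathbb P^1$-bundle of lines in the rank 2 focal bundle $\mathcal B(k)\subset TS(k)$, and $\mathcal B(k+1)$ consists of the tangent vectors to $S(k+1)$ at a point $\ell$ whose image in $TS(k)$ lies on the line $\ell$. For each word $p_1\cdots p_k$ in the letters $1,2$ there is a chart $\mathcal C(p_1\cdots p_k)\cong U\times\mathbb A^k$ of $S(k)$ with two active coordinates $x_1(p_1\cdots p_k),x_2(p_1\cdots p_k)$: on $\mathcal C(\varnothing)=U$ they are $x_1,x_2$. With $\bar q$ the letter other than $q$, the chart $\mathcal C(p_1\cdots p_kq)$ consists of the lines on which $dx_q(p_1\cdots p_k)\ne0$; its new coordinate is $\mathbf n=x_{\bar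 q}(p_1\cdots p_kq)=dx_{\bar q}(p_1\cdots p_k)/dx_q(p_1\cdots p_k)$, its retained coordinate is $\mathbf r=x_q(p_1\cdots p_kq)=x_q(p_1\cdots p_k)$, and its deactivated coordinate is $\mathbf d=x_{\bar q}(p_1\cdots p_k)$. Its coordinate functions are $x_1,x_2$ and the coordinates introduced at levels $1,\dots,k+1$. Let $N(p_1\cdots p_k)$ be the origin of $\mathcal C(p_1\cdots p_k)$ (the point over $o$ at which all coordinates vanish). **Prolongation.** The prolongation of a reduced curve in $S(k)$ with focal tangent lines is the closure in $S(k+1)$ of the set of its tangent lines at nonsingular points. A vertical curve is a fibre of some $S(j)\to S(j-1)$. Let $T=\mathbb A^1$ with coordinate $t$. The family $\mathcal X(k)\subset S(k)\times T$ is the closure of the family over $T\setminus\{0\}$ whose member at $t$ is the $k$-th prolongation of the curve $x_1x_2=t$; let $X(k)_0$ be its scheme-theoretic fibre over $t=0$. **Node binomials.** $B(\varnothing)=x_1x_2$, $B(p_1)=\mathbf n\mathbf r+\mathbf d$, and, for $k\ge2$, if $B(p_1\cdots p_{k-1})$ has the form $\alpha\mathbf n\mathbf r+\beta\mathbf d$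 in the coordinates $\mathbf n,\mathbf r,\mathbf d$ of $\mathcal C(p_1\cdots p_{k-1})$, then, in the coordinates $\mathbf n,\mathbf r,\mathbf d$ of $\mathcal C(p_1\cdots p_k)$, $B(p_1\cdots p_k)$ is $\alpha\mathbf n\mathbf r+(\alpha+\beta)\mathbf d$ if $p_k=p_{k-1}$ and $(\alpha+\beta)\mathbf n\mathbf r+\alpha\mathbf d$ if $p_k\ne p_{k-1}$. **Theorem.** Let $k\ge0$. The family $\mathcal X(k)$ is flat over $T$, and its central member $X(k)_0$ is a chain of $2^k+1$ irreducible curves meeting at ordinary nodes. More precisely, $X(k)_0$ has exactly $2^k+1$ irreducible components (twigs) $T_0,\dots,T_{2^k}$, with the following properties. 1. If $w_0<w_1<\dots<w_{2^k-1}$ are the words of length $k$ in lexicographic order, then $T_i\cap T_{i+1}=\{N(w_i)\}$ for $0\le i<2^k$, and $T_i\cap T_j=\varnothing$ if $|i-j|\ge2$. 2. The end twigs $T_0$ and $T_{2^k}$ are the $k$-th prolongations of the curves $x_2=0$ and $x_1=0$. 3. Each interior twig $T_i$, $0<i<2^k$, taken with its reduced structure, is a vertical curve or is obtained from a vertical curve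 at a lower level by repeated prolongation, and it is isomorphic to $\mathbb P^1$. The chart $\mathcal C(w_i)$ meets exactly two twigs, $T_i$ and $T_{i+1}$, and they are the axes of its active coordinates $x_1(w_i)$ and $x_2(w_i)$: with reduced structure, the ideal of $T_i$ (resp. $T_{i+1}$) in $\mathcal C(w_i)$ is generated by all coordinate functions except $x_1(w_i)$ (resp. $x_2(w_i)$), and the ideal of their union, which is $X(k)_0$ with reduced structure, is generated by $x_1(w_i)x_2(w_i)$ and the coordinate functions that are not active. 4. In the chart $\mathcal C(p_1\cdots p_k)$ the ideal of the scheme $X(k)_0$ is generated by $B(\varnothing),B(p_1),B(p_1p_2),\dots,B(p_1\cdots p_k)$. -/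

import Mathlib

namespace Monster

universe u v w

/-- A string `p₁ p₂ ⋯ pₖ` in the two-letter alphabet; the letters `1, 2` are `0, 1 : Fin 2`,
and `p₁` is the entry with index `0`. -/
abbrev Word (k : ℕ) := Fin k → Fin 2

/-- The string with its last letter removed. -/
def Word.trunc {k : ℕ} (p : Word (k + 1)) : Word k := fun j => p j.castSucc

/-- The last letter. -/
def Word.final {k : ℕ} (p : Word (k + 1)) : Fin 2 := p (Fin.last k)

/-- The coordinate ring of a chart `U × 𝔸ᵏ` at level `k`, where `A` is the coordinate ring of `U`.
The variable `X j` is the affine coordinate introduced at level `j + 1`. -/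
abbrev ChartRing (A : Type v) [CommRing A] (k : ℕ) := MvPolynomial (Fin k) A

section Charts

variable {A : Type v} [CommRing A]

/-- Pullback of functions along the projection from a chart at level `k + 1` to the chart
below it. -/
noncomputable def pull (k : ℕ) : ChartRing A k →ₐ[A] ChartRing A (k + 1) :=
  MvPolynomial.rename Fin.castSucc

/-- The two active coordinates `x₁(p₁⋯pₖ)`, `x₂(p₁⋯pₖ)` of the chart `C(p₁⋯pₖ)`.
Passing from `p₁⋯pₖ` to `p₁⋯pₖq`, the coordinate with index `q` is retained, and the one with the
other index is replaced by the new coordinate. -/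
noncomputable def active (x : Fin 2 → A) : (k : ℕ) → Word k → Fin 2 → ChartRing A k
  | 0, _, i => MvPolynomial.C (x i)
  | k + 1, p, i =>
      if i = p.final then pull k (active x k p.trunc i) else MvPolynomial.X (Fin.last k)

/-- The `k + 2` coordinate functions of a chart at level `k`. -/
def coords (x : Fin 2 → A) (k : ℕ) : Set (ChartRing A k) :=
  Set.range (fun i : Fin 2 => MvPolynomial.C (x i)) ∪ Set.range (fun j : Fin k => MvPolynomial.X j)

/-- The pair `(α, β)` of coefficients of the node binomial `B(p₁⋯pₖ) = α n r + β d`.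
The choice at the last step is regular if the last two letters agree, critical otherwise. -/
def nodeCoeff : (k : ℕ) → Word k → ℕ × ℕ
  | 0, _ => (1, 0)
  | 1, _ => (1, 1)
  | k + 2, p =>
      let c := nodeCoeff (k + 1) p.trunc
      if p.final = p.trunc.final then (c.1, c.1 + c.2) else (c.1 + c.2, c.1)

/-- The node binomial `B(p₁⋯pₖ) = α n r + β d` (the monomial `x₁ x₂` for `k = 0`).
Here the new coordinate `n` represents `d(d)/d(r)`: the retained coordinate `r` is the active
coordinate one level below with index `pₖ`, and the deactivated coordinate `d` the other one. -/
noncomputable def nodeBinomial (x : Fin 2 → A) : (k : ℕ) → Word k → ChartRing A k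
  | 0, _ => MvPolynomial.C (x 0 * x 1)
  | k + 1, p =>
      ((nodeCoeff (k + 1) p).1 : ChartRing A (k + 1)) *
          (MvPolynomial.X (Fin.last k) * pull k (active x k p.trunc p.final)) +
        ((nodeCoeff (k + 1) p).2 : ChartRing A (k + 1)) *
          pull k (active x k p.trunc (Fin.rev p.final))

/-- The set `B(∅), B(p₁), …, B(p₁⋯pₖ)` of functions on the chart `C(p₁⋯pₖ)`. -/
def nodeBinomials (x : Fin 2 → A) : (k : ℕ) → Word k → Set (ChartRing A k)
  | 0, p => {nodeBinomial x 0 p}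
  | k + 1, p => insert (nodeBinomial x (k + 1) p) (pull k '' nodeBinomials x k p.trunc)

end Charts

section Tower

variable (𝕜 : Type u) [Field 𝕜] {A : Type v} [CommRing A] [Algebra 𝕜 A]

/-- The `R`-valued points of a chart `U × 𝔸ᵏ`. For `R = 𝕜` these are its ordinary points. An
`R[ε]`-valued point is a tangent vector at the `R`-valued point obtained by setting `ε = 0`. -/
abbrev ChartPt (A : Type v) [CommRing A] [Algebra 𝕜 A] (k : ℕ) (R : Type w) [CommRing R]
    [Algebra 𝕜 R] := ChartRing A k →ₐ[𝕜] R

variable {𝕜}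

/-- The projection `πₖ₊₁` in charts; on `R[ε]`-valued points this is its derivative. -/
noncomputable def ChartPt.proj {k : ℕ} {R : Type w} [CommRing R] [Algebra 𝕜 R]
    (q : ChartPt 𝕜 A (k + 1) R) : ChartPt 𝕜 A k R :=
  q.comp ((pull k).restrictScalars 𝕜)

/-- The point at which a tangent vector is attached. -/
noncomputable def ChartPt.foot {k : ℕ} {R : Type w} [CommRing R] [Algebra 𝕜 R]
    (τ : ChartPt 𝕜 A k (DualNumber R)) : ChartPt 𝕜 A k R :=
  (TrivSqZeroExt.fstHom 𝕜 R R).comp τ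

/-- `τ.diff f` is `df(τ)`. -/
noncomputable def ChartPt.diff {k : ℕ} {R : Type w} [CommRing R] [Algebra 𝕜 R]
    (τ : ChartPt 𝕜 A k (DualNumber R)) (f : ChartRing A k) : R :=
  TrivSqZeroExt.snd (τ f)

/-- `IsFocal x k p τ`: the tangent vector `τ` to the chart `C(p₁⋯pₖ)` lies in the focal bundle. At
level `0` the focal bundle is the whole tangent bundle. A tangent vector at a point `q` of level
`k + 1` is focal if its image one level below is focal and lies on the line represented by `q`; by
the meaning of the new coordinate `X (last k) = d(d)/d(r)` this line is given inside the focal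
bundle of level `k` by the equation `d(d) = X (last k) d(r)`. -/
def IsFocal (x : Fin 2 → A) : (k : ℕ) → Word k → {R : Type w} → [CommRing R] → [Algebra 𝕜 R] →
    ChartPt 𝕜 A k (DualNumber R) → Prop
  | 0, _, _, _, _, _ => True
  | k + 1, p, _, _, _, τ =>
      IsFocal x k p.trunc τ.proj ∧
        τ.proj.diff (active x k p.trunc (Fin.rev p.final)) =
          τ.foot (MvPolynomial.X (Fin.last k)) * τ.proj.diff (active x k p.trunc p.final)

/-- The line of focal tangent vectors at the point `q.proj` of `C(p₁⋯pₖ)` that is represented by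
the point `q` of `C(p₁⋯pₖ₊₁)`. -/
def line (x : Fin 2 → A) {k : ℕ} (p : Word (k + 1)) {R : Type w} [CommRing R] [Algebra 𝕜 R]
    (q : ChartPt 𝕜 A (k + 1) R) : Set (ChartPt 𝕜 A k (DualNumber R)) :=
  {τ | τ.foot = q.proj ∧ IsFocal x k p.trunc τ ∧
    τ.diff (active x k p.trunc (Fin.rev p.final)) =
      q (MvPolynomial.X (Fin.last k)) * τ.diff (active x k p.trunc p.final)}

/-- `SamePoint x k R p q p' q'`: the `R`-valued point `q` of the chart `C(p)` and the `R`-valued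
point `q'` of the chart `C(p')` are the same point of the `k`-th monster space (`R` a local ring).
Since `S(k + 1)` is the projectivization of the focal bundle of `S(k)`, two points of level `k + 1`
agree if and only if they lie over the same point of `S(k)` and represent the same line in the
focal bundle there, that is, a generator of one line is also a generator of the other. Equality of
tangent vectors to `S(k)` is equality of `R[ε]`-valued points of `S(k)`. -/
def SamePoint (x : Fin 2 → A) : (k : ℕ) → (R : Type w) → [CommRing R] → [Algebra 𝕜 R] →
    Word k → ChartPt 𝕜 A k R → Word k → ChartPt 𝕜 A k R → Prop
  | 0, _, _, _, _, q, _, q' => q = q'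
  | k + 1, R, _, _, p, q, p', q' =>
      SamePoint x k R p.trunc q.proj p'.trunc q'.proj ∧
        ∃ τ ∈ line x p q, ∃ τ' ∈ line x p' q',
          IsUnit (τ.diff (active x k p.trunc p.final)) ∧
          IsUnit (τ'.diff (active x k p'.trunc p'.final)) ∧
          SamePoint x k (DualNumber R) p.trunc τ p'.trunc τ'

variable (𝕜)

/-- The monster space `S(k)` over `U`: the charts `C(p) = U × 𝔸ᵏ`, glued along their common
points. -/
def Space (x : Fin 2 → A) (k : ℕ) : Type (max u v) :=
  Quot fun a b : Word k × ChartPt 𝕜 A k 𝕜 => SamePoint x k 𝕜 a.1 a.2 b.1 b.2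

variable {𝕜}

/-- The inclusion of the chart `C(p)` into `S(k)`. -/
def Space.mk (x : Fin 2 → A) {k : ℕ} (p : Word k) (q : ChartPt 𝕜 A k 𝕜) : Space 𝕜 x k :=
  Quot.mk _ (p, q)

/-- The projection `πₖ₊₁ : S(k + 1) → S(k)`. -/
noncomputable def Space.proj {x : Fin 2 → A} {k : ℕ} : Space 𝕜 x (k + 1) → Space 𝕜 x k :=
  Quot.lift (fun a => Space.mk x a.1.trunc a.2.proj) fun _ _ h => Quot.sound h.1

/-- The Zariski topology on the points of a chart. -/
noncomputable abbrev chartZariski (𝕜 : Type u) [Field 𝕜] (A : Type v) [CommRing A] [Algebra 𝕜 A] (k : ℕ) :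
    TopologicalSpace (ChartPt 𝕜 A k 𝕜) :=
  TopologicalSpace.induced
    (fun q => (⟨RingHom.ker q, RingHom.ker_isPrime q⟩ : PrimeSpectrum (ChartRing A k)))
    inferInstance

/-- The Zariski topology on `S(k)`: a set is closed if and only if its part in every chart is. -/
noncomputable instance Space.zariski (x : Fin 2 → A) (k : ℕ) : TopologicalSpace (Space 𝕜 x k) :=
  ⨆ p : Word k, TopologicalSpace.coinduced (Space.mk x p) (chartZariski 𝕜 A k)

/-- The part in the chart `C(p)` of a set of points of `S(k)`. -/
def inChart {x : Fin 2 → A} {k : ℕ} (p : Word k) (Z : Set (Space 𝕜 x k)) :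
    Set (ChartPt 𝕜 A k 𝕜) :=
  {q | Space.mk x p q ∈ Z}

/-- The ideal of all functions on the chart `C(p)` that vanish on `Z`. -/
noncomputable def idealOf {x : Fin 2 → A} {k : ℕ} (p : Word k) (Z : Set (Space 𝕜 x k)) :
    Ideal (ChartRing A k) :=
  ⨅ q ∈ inChart p Z, RingHom.ker q

/-- The Zariski tangent space, in the chart `C(p)`, of the reduced closed subscheme `Z` at `q`. -/
def tangentSpace {x : Fin 2 → A} {k : ℕ} (p : Word k) (Z : Set (Space 𝕜 x k))
    (q : ChartPt 𝕜 A k 𝕜) : Set (ChartPt 𝕜 A k (DualNumber 𝕜)) :=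
  {τ | τ.foot = q ∧ ∀ f ∈ idealOf p Z, τ f = 0}

/-- The prolongation of a curve `Z` in `S(k)` whose tangent lines are focal: the closure of the
set of the tangent lines of `Z` at its nonsingular points (the points at which the Zariski tangent
space is a line), regarded as points of `S(k + 1)`. -/
def prolong {x : Fin 2 → A} {k : ℕ} (Z : Set (Space 𝕜 x k)) : Set (Space 𝕜 x (k + 1)) :=
  closure {P | ∃ (p : Word (k + 1)) (q : ChartPt 𝕜 A (k + 1) 𝕜), P = Space.mk x p q ∧
    Space.mk x p.trunc q.proj ∈ Z ∧ tangentSpace p.trunc Z q.proj = line x p q}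

/-- The curve `f = 0` in `U = S(0)`. -/
def zeroLocus (x : Fin 2 → A) (f : A) : Set (Space 𝕜 x 0) :=
  {P | ∃ q : ChartPt 𝕜 A 0 𝕜, P = Space.mk x ![] q ∧ q (MvPolynomial.C f) = 0}

/-- The `k`-th prolongation of a curve in `U`. -/
def iterProlong {x : Fin 2 → A} (Z : Set (Space 𝕜 x 0)) : (k : ℕ) → Set (Space 𝕜 x k)
  | 0 => Z
  | k + 1 => prolong (iterProlong Z k)

/-- `IsProlongedVertical Z`: the set `Z` in `S(k)` is a vertical curve, i.e. a fibre of
`S(k) → S(k - 1)`, or is obtained from a vertical curve at a lower level by prolonging it one or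
several times. -/
inductive IsProlongedVertical {x : Fin 2 → A} : {k : ℕ} → Set (Space 𝕜 x k) → Prop
  | vertical {k : ℕ} (Q : Space 𝕜 x k) :
      IsProlongedVertical {P : Space 𝕜 x (k + 1) | P.proj = Q}
  | lift {k : ℕ} {Z : Set (Space 𝕜 x k)} :
      IsProlongedVertical Z → IsProlongedVertical (prolong Z)

/-- The origin of the chart `C(p₁⋯pₖ)`, where `o` is the point `x₁ = x₂ = 0` of `U`: this is the
node `N(p₁⋯pₖ)`. -/
noncomputable def node (x : Fin 2 → A) (o : A →ₐ[𝕜] 𝕜) {k : ℕ} (p : Word k) : Space 𝕜 x k :=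
  Space.mk x p (MvPolynomial.aevalTower o 0)

/-- The ideal of the family `𝒳(k)` of `k`-th prolongations of the curves `x₁ x₂ = t` in the
coordinate ring `𝒪(C(p))[t]` of `C(p) × T`, where `T` is the affine line. The family `𝒳(k)` is the
closure in `S(k) × T` of the family of the `k`-th prolongations of the members with `t ≠ 0`. This
is the only extension of the latter to a flat family over `T`. -/
noncomputable def familyIdeal (𝕜 : Type u) [Field 𝕜] {A : Type v} [CommRing A] [Algebra 𝕜 A]
    (x : Fin 2 → A) {k : ℕ} (p : Word k) : Ideal (Polynomial (ChartRing A k)) :=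
  ⨅ (t : 𝕜) (_ : t ≠ 0)
    (q : ChartPt 𝕜 A k 𝕜)
    (_ : q ∈ inChart p (iterProlong (zeroLocus x (x 0 * x 1 - algebraMap 𝕜 A t)) k)),
    RingHom.ker (Polynomial.eval₂RingHom q.toRingHom t)

/-- The map from `𝕜[t]` to the coordinate ring of the part of `𝒳(k)` in `C(p) × T`. -/
noncomputable def familyMap (𝕜 : Type u) [Field 𝕜] {A : Type v} [CommRing A] [Algebra 𝕜 A]
    (x : Fin 2 → A) {k : ℕ} (p : Word k) :
    Polynomial 𝕜 →+* Polynomial (ChartRing A k) ⧸ familyIdeal 𝕜 x p :=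
  (Ideal.Quotient.mk (familyIdeal 𝕜 x p)).comp
    (Polynomial.mapRingHom (algebraMap 𝕜 (ChartRing A k)))

/-- The ideal in the chart `C(p)` of the scheme `X(k)₀`, the member over `t = 0` of the
family `𝒳(k)`. -/
noncomputable def centralIdeal (𝕜 : Type u) [Field 𝕜] {A : Type v} [CommRing A] [Algebra 𝕜 A]
    (x : Fin 2 → A) {k : ℕ} (p : Word k) : Ideal (ChartRing A k) :=
  (familyIdeal 𝕜 x p).map (Polynomial.evalRingHom 0)

/-- The set of points of `X(k)₀`. -/
def centralFiber (𝕜 : Type u) [Field 𝕜] {A : Type v} [CommRing A] [Algebra 𝕜 A]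
    (x : Fin 2 → A) (k : ℕ) : Set (Space 𝕜 x k) :=
  {P | ∃ (p : Word k) (q : ChartPt 𝕜 A k 𝕜), P = Space.mk x p q ∧
    ∀ f ∈ centralIdeal 𝕜 x p, q f = 0}

/-- The restriction of `f` to the reduced closed subscheme `Z` of `S(k)` is a regular function
near the point `P`: in a chart around `P` it is a quotient of two functions from the coordinate
ring. -/
def IsRegularAt {x : Fin 2 → A} {k : ℕ} (Z : Set (Space 𝕜 x k)) (f : Space 𝕜 x k → 𝕜)
    (P : Space 𝕜 x k) : Prop :=
  ∃ (p : Word k) (q : ChartPt 𝕜 A k 𝕜) (g h : ChartRing A k), P = Space.mk x p q ∧ q h ≠ 0 ∧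
    ∀ q' ∈ inChart p Z, q' h ≠ 0 → f (Space.mk x p q') = q' g / q' h

/-- The function `f` on the projective line is regular near the point `P`: it is a quotient of
two forms of the same degree. -/
def IsRegularAtP1 (f : Projectivization 𝕜 (Fin 2 → 𝕜) → 𝕜)
    (P : Projectivization 𝕜 (Fin 2 → 𝕜)) : Prop :=
  ∃ (d : ℕ) (g h : MvPolynomial (Fin 2) 𝕜), g.IsHomogeneous d ∧ h.IsHomogeneous d ∧
    MvPolynomial.eval P.rep h ≠ 0 ∧
    ∀ P', MvPolynomial.eval P'.rep h ≠ 0 →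
      f P' = MvPolynomial.eval P'.rep g / MvPolynomial.eval P'.rep h

/-- The reduced closed subscheme `Z` of `S(k)` is isomorphic to the projective line: there is a
bijection that identifies the germs of regular functions at corresponding points (it is then a
homeomorphism: a set is a neighbourhood of a point in it if and only if its indicator function is
regular there). -/
def IsCopyOfP1 {x : Fin 2 → A} {k : ℕ} (Z : Set (Space 𝕜 x k)) : Prop :=
  ∃ φ : Projectivization 𝕜 (Fin 2 → 𝕜) → Space 𝕜 x k, Function.Injective φ ∧ Set.range φ = Z ∧
    ∀ (f : Space 𝕜 x k → 𝕜) (P : Projectivization 𝕜 (Fin 2 → 𝕜)),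
      IsRegularAt Z f (φ P) ↔ IsRegularAtP1 (f ∘ φ) P

end Tower

end Monster

/-!
The torus `(x₁, x₂) ↦ (c x₁, c⁻¹ x₂)` preserves each hyperbola `x₁ x₂ = t` and acts with weights on
all coordinates of the charts of the tower. The logarithmic derivatives of the two active
coordinates along a prolonged hyperbola are therefore integers up to a common factor, and the
relation between the deactivated coordinate, the retained coordinate and the new one is a node
binomial, whose coefficients `α` and `β` are the absolute values of these weights. So over `t ≠ 0`
the node binomials of positive level and `x₁ x₂ - t` cut out the prolonged hyperbola. The quotient
by the node binomials of positive level has no `t`-torsion, by induction on the level: each binomial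
is linear in the new coordinate, and its two coefficients, which are multiples of the active
coordinates of the level below, form a regular sequence modulo the previous binomials. Hence the
same equations describe the closure of the family, which is flat, and `t = 0` gives the ideal of the
central member.

Since `α` and `β` are invertible, a common zero of the node binomials lies on one of the two axes of
the active coordinates. Passing to the next level, an axis of either active coordinate persists in
the chart where this coordinate is retained, which is its prolongation, and each origin gives rise
to a new axis, the fibre over it. In binary notation the twig `j` of level `k` becomes
the twig `2 j`, and the fibre over the `j`-th node becomes the twig `2 j + 1`; the `n`-th chart in
lexicographic order contains the twigs `n` and `n + 1`. An interior twig meets exactly two charts,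
and there its two active coordinates are inverse to each other, so that it is a projective line.
-/

namespace Monster

open MvPolynomial (X C aeval)
open TrivSqZeroExt (inl inr fstHom)

universe w'

/-! ### Dual numbers and points of the charts -/

section DualNumbers

variable {K : Type*} [CommRing K] {B P R R' : Type*} [CommRing B] [CommRing P] [CommRing R]
  [CommRing R'] [Algebra K B] [Algebra K P] [Algebra K R] [Algebra K R']

/-- The map `a + b ε ↦ φ a + c (φ b) ε` of dual numbers: a change of rings `φ` combined with the
scaling of tangent vectors by `c`. -/
noncomputable def dualMap (φ : R →ₐ[K] R') (c : R') : DualNumber R →ₐ[K] DualNumber R' :=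
  DualNumber.lift ⟨((TrivSqZeroExt.inlAlgHom K R' R').comp φ, inr c),
    by simp, fun a => Commute.all _ _⟩

@[simp] lemma fst_dualMap (φ : R →ₐ[K] R') (c : R') (a : DualNumber R) :
    (dualMap φ c a).fst = φ a.fst := by
  simp [dualMap, DualNumber.lift_apply_apply]

@[simp] lemma snd_dualMap (φ : R →ₐ[K] R') (c : R') (a : DualNumber R) :
    (dualMap φ c a).snd = c * φ a.snd := by
  simp [dualMap, DualNumber.lift_apply_apply, mul_comm]

lemma isNilpotent_ker_fstHom : IsNilpotent (RingHom.ker (fstHom K R R)) :=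
  ⟨2, TrivSqZeroExt.kerIdeal_sq R R⟩

lemma exists_dualNumber_lift {f : P →ₐ[K] B} (hf : f.toRingHom.FormallySmooth) (b : B →ₐ[K] R)
    (g : P →ₐ[K] DualNumber R) (hg : (fstHom K R R).comp g = b.comp f) :
    ∃ v : B →ₐ[K] DualNumber R, (fstHom K R R).comp v = b ∧ v.comp f = g := by
  algebraize [f.toRingHom, g.toRingHom, (b.comp f).toRingHom]
  let b' : B →ₐ[P] R := { b with commutes' := fun _ => rfl }
  let π : DualNumber R →ₐ[P] R := { fstHom K R R with commutes' := AlgHom.congr_fun hg }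
  have hπ : Function.Surjective π := fun r => ⟨inl r, rfl⟩
  let v := Algebra.FormallySmooth.liftOfSurjective b' π hπ (isNilpotent_ker_fstHom (K := K))
  have hvf (a : P) : v (f a) = g a := v.commutes a
  refine ⟨{ v.toRingHom with commutes' := fun r => ?_ }, AlgHom.ext fun a => ?_, AlgHom.ext hvf⟩
  · simp
  · exact Algebra.FormallySmooth.liftOfSurjective_apply b' π hπ _ a

lemma dualNumber_lift_unique {f : P →ₐ[K] B} (hf : f.toRingHom.FormallyUnramified)
    {v v' : B →ₐ[K] DualNumber R} (hfst : (fstHom K R R).comp v = (fstHom K R R).comp v')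
    (hvf : v.comp f = v'.comp f) : v = v' := by
  algebraize [f.toRingHom, (v.comp f).toRingHom]
  let w : B →ₐ[P] DualNumber R := { v with commutes' := fun _ => rfl }
  let w' : B →ₐ[P] DualNumber R := { v' with commutes' := (AlgHom.congr_fun hvf.symm ·) }
  have h := Algebra.FormallyUnramified.ext' (fstHom K R R).toRingHom isNilpotent_ker_fstHom w w'
    (AlgHom.congr_fun hfst)
  exact AlgHom.ext fun a => AlgHom.congr_fun h a

end DualNumbers

section Tangents

/-- The functions `x 0 = x₁` and `x 1 = x₂` are local coordinates on `U = Spec A`: the morphism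
`(x₁, x₂) : U → 𝔸²` is étale. -/
abbrev IsEtaleCoords (𝕜 : Type u) [Field 𝕜] {A : Type v} [CommRing A] [Algebra 𝕜 A]
    (x : Fin 2 → A) : Prop :=
  (aeval x : MvPolynomial (Fin 2) 𝕜 →ₐ[𝕜] A).toRingHom.Etale

variable {𝕜 : Type u} [Field 𝕜] {A : Type v} [CommRing A] [Algebra 𝕜 A]
  {R : Type w} [CommRing R] [Algebra 𝕜 R] {x : Fin 2 → A}

lemma IsEtaleCoords.exists_tangent (hx : IsEtaleCoords 𝕜 x) (b : A →ₐ[𝕜] R) (c : Fin 2 → R) :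
    ∃ v : A →ₐ[𝕜] DualNumber R, (fstHom 𝕜 R R).comp v = b ∧ ∀ i, (v (x i)).snd = c i := by
  have hsmooth := ((RingHom.etale_iff_formallyUnramified_and_smooth _).1 hx).2.formallySmooth
  obtain ⟨v, hvb, hv⟩ := exists_dualNumber_lift hsmooth b (aeval fun i => inl (b (x i)) + inr (c i))
    (by ext i; simp)
  refine ⟨v, hvb, fun i => ?_⟩
  have hvi := AlgHom.congr_fun hv (X i)
  simp only [AlgHom.comp_apply, MvPolynomial.aeval_X] at hvi
  simp [hvi]

lemma IsEtaleCoords.tangent_unique (hx : IsEtaleCoords 𝕜 x) {v v' : A →ₐ[𝕜] DualNumber R}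
    (hfst : (fstHom 𝕜 R R).comp v = (fstHom 𝕜 R R).comp v')
    (hsnd : ∀ i, (v (x i)).snd = (v' (x i)).snd) : v = v' := by
  refine dualNumber_lift_unique (RingHom.Etale.formallyUnramified _ hx) hfst
    (MvPolynomial.algHom_ext fun i => ?_)
  simpa using TrivSqZeroExt.ext (AlgHom.congr_fun hfst (x i)) (hsnd i)

end Tangents

section Letters

lemma rev_ne (s : Fin 2) : Fin.rev s ≠ s := by
  revert s; decide

lemma eq_or_eq_rev (i s : Fin 2) : i = s ∨ i = Fin.rev s := by
  revert i s; decide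

lemma forall_iff_and_rev {P : Fin 2 → Prop} (s : Fin 2) : (∀ i, P i) ↔ P s ∧ P (Fin.rev s) :=
  ⟨fun h => ⟨h _, h _⟩, fun h i => by rcases eq_or_eq_rev i s with rfl | rfl; exacts [h.1, h.2]⟩

lemma exists_iff_or_rev {P : Fin 2 → Prop} (s : Fin 2) : (∃ i, P i) ↔ P s ∨ P (Fin.rev s) := by
  simpa [not_and_or, -not_and] using not_congr (forall_iff_and_rev (P := fun i => ¬P i) s)

end Letters

section ChartPoints

variable {𝕜 : Type u} [Field 𝕜] {A : Type v} [CommRing A] [Algebra 𝕜 A]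
  {R : Type w} [CommRing R] [Algebra 𝕜 R] {R' : Type w'} [CommRing R'] [Algebra 𝕜 R']
  {k : ℕ} {x : Fin 2 → A}

@[simp] lemma pull_C (a : A) : pull k (C a) = C a := by simp [pull]

@[simp] lemma pull_X (j : Fin k) : pull (A := A) k (X j) = X j.castSucc := by simp [pull]

lemma pull_injective : Function.Injective (pull (A := A) k) :=
  MvPolynomial.rename_injective _ (Fin.castSucc_injective k)

lemma active_final (x : Fin 2 → A) (p : Word (k + 1)) :
    active x (k + 1) p p.final = pull k (active x k p.trunc p.final) := by simp [active]

lemma active_rev_final (x : Fin 2 → A) (p : Word (k + 1)) :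
    active x (k + 1) p (Fin.rev p.final) = X (Fin.last k) := by
  simp [active, rev_ne]

namespace ChartPt

lemma proj_apply (q : ChartPt 𝕜 A (k + 1) R) (f : ChartRing A k) : q.proj f = q (pull k f) := rfl

lemma foot_apply (τ : ChartPt 𝕜 A k (DualNumber R)) (f : ChartRing A k) :
    τ.foot f = (τ f).fst := rfl

lemma diff_def (τ : ChartPt 𝕜 A k (DualNumber R)) (f : ChartRing A k) : τ.diff f = (τ f).snd := rfl

lemma diff_proj (τ : ChartPt 𝕜 A (k + 1) (DualNumber R)) (f : ChartRing A k) :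
    τ.proj.diff f = τ.diff (pull k f) := rfl

lemma foot_proj (τ : ChartPt 𝕜 A (k + 1) (DualNumber R)) : τ.proj.foot = τ.foot.proj := rfl

lemma comp_proj (φ : R →ₐ[𝕜] R') (q : ChartPt 𝕜 A (k + 1) R) :
    ChartPt.proj (φ.comp q) = φ.comp q.proj := rfl

lemma ext_coords {q q' : ChartPt 𝕜 A k R} (hC : ∀ a, q (C a) = q' (C a))
    (hX : ∀ j, q (X j) = q' (X j)) : q = q' := by
  refine AlgHom.ext fun f => ?_
  induction f using MvPolynomial.induction_on with
  | C a => exact hC a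
  | add f g hf hg => simp only [map_add, hf, hg]
  | mul_X f i hf => simp only [map_mul, hf, hX]

lemma ext_succ {q q' : ChartPt 𝕜 A (k + 1) R} (hproj : q.proj = q'.proj)
    (hlast : q (X (Fin.last k)) = q' (X (Fin.last k))) : q = q' := by
  refine ext_coords (fun a => ?_) (Fin.lastCases hlast fun j => ?_)
  · simpa [proj_apply] using AlgHom.congr_fun hproj (C a)
  · simpa [proj_apply] using AlgHom.congr_fun hproj (X j)

/-- The image in `U` of a point of a chart. -/
noncomputable def base (q : ChartPt 𝕜 A k R) : A →ₐ[𝕜] R :=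
  q.comp (IsScalarTower.toAlgHom 𝕜 A (ChartRing A k))

@[simp] lemma base_apply (q : ChartPt 𝕜 A k R) (a : A) : q.base a = q (C a) := rfl

/-- The point of a chart at level `k + 1` over a given point with a given new coordinate. -/
noncomputable def extend (z : ChartPt 𝕜 A k R) (n : R) : ChartPt 𝕜 A (k + 1) R :=
  MvPolynomial.aevalTower z.base (Fin.snoc (α := fun _ => R) (fun j => z (X j)) n)

@[simp] lemma extend_last (z : ChartPt 𝕜 A k R) (n : R) : z.extend n (X (Fin.last k)) = n := by
  simp [extend]

@[simp] lemma proj_extend (z : ChartPt 𝕜 A k R) (n : R) : (z.extend n).proj = z :=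
  ext_coords (fun a => by simp [proj_apply, extend]) fun j => by simp [proj_apply, extend]

@[simp] lemma extend_pull (z : ChartPt 𝕜 A k R) (n : R) (f : ChartRing A k) :
    z.extend n (pull k f) = z f :=
  AlgHom.congr_fun (z.proj_extend n) f

lemma foot_extend (σ : ChartPt 𝕜 A k (DualNumber R)) (n : DualNumber R) :
    (σ.extend n).foot = σ.foot.extend n.fst := by
  refine ext_succ ?_ (by simp [foot_apply])
  rw [← foot_proj, proj_extend, proj_extend]

lemma extend_proj_last (q : ChartPt 𝕜 A (k + 1) R) : q.proj.extend (q (X (Fin.last k))) = q :=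
  ext_succ (proj_extend _ _) (extend_last _ _)

/-- A point of `U` as a point of the chart at level `0`. -/
noncomputable def ofBase (b : A →ₐ[𝕜] R) : ChartPt 𝕜 A 0 R :=
  MvPolynomial.aevalTower b Fin.elim0

@[simp] lemma ofBase_C (b : A →ₐ[𝕜] R) (a : A) : ofBase b (C a) = b a := by simp [ofBase]

lemma ext_zero {q q' : ChartPt 𝕜 A 0 R} (h : q.base = q'.base) : q = q' :=
  ext_coords (AlgHom.congr_fun h) fun j => j.elim0

/-- The image of a tangent vector under a change of the base ring combined with a scaling. -/
noncomputable def tmap (τ : ChartPt 𝕜 A k (DualNumber R)) (φ : R →ₐ[𝕜] R') (c : R') :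
    ChartPt 𝕜 A k (DualNumber R') :=
  (dualMap φ c).comp τ

@[simp] lemma foot_tmap (τ : ChartPt 𝕜 A k (DualNumber R)) (φ : R →ₐ[𝕜] R') (c : R') :
    (τ.tmap φ c).foot = φ.comp τ.foot :=
  AlgHom.ext fun f => by simp [foot_apply, tmap]

@[simp] lemma diff_tmap (τ : ChartPt 𝕜 A k (DualNumber R)) (φ : R →ₐ[𝕜] R') (c : R')
    (f : ChartRing A k) : (τ.tmap φ c).diff f = c * φ (τ.diff f) := by
  simp [diff_def, tmap]

lemma proj_tmap (τ : ChartPt 𝕜 A (k + 1) (DualNumber R)) (φ : R →ₐ[𝕜] R') (c : R') :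
    (τ.tmap φ c).proj = τ.proj.tmap φ c := rfl

end ChartPt

lemma isFocal_zero (x : Fin 2 → A) (p : Word 0) (τ : ChartPt 𝕜 A 0 (DualNumber R)) :
    IsFocal x 0 p τ := by simp only [IsFocal]

lemma isFocal_succ {p : Word (k + 1)} {τ : ChartPt 𝕜 A (k + 1) (DualNumber R)} :
    IsFocal x (k + 1) p τ ↔ IsFocal x k p.trunc τ.proj ∧
      τ.proj.diff (active x k p.trunc (Fin.rev p.final)) =
        τ.foot (X (Fin.last k)) * τ.proj.diff (active x k p.trunc p.final) := by
  rw [IsFocal]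

lemma IsFocal.tmap {p : Word k} {τ : ChartPt 𝕜 A k (DualNumber R)} (h : IsFocal x k p τ)
    (φ : R →ₐ[𝕜] R') (c : R') : IsFocal x k p (τ.tmap φ c) := by
  induction k with
  | zero => exact isFocal_zero x p _
  | succ k ih =>
    rw [isFocal_succ] at h ⊢
    rw [ChartPt.proj_tmap, ChartPt.diff_tmap, ChartPt.diff_tmap, h.2, ChartPt.foot_tmap, map_mul,
      AlgHom.comp_apply]
    exact ⟨ih h.1, mul_left_comm _ _ _⟩

lemma exists_isFocal (hx : IsEtaleCoords 𝕜 x) (p : Word k) (z : ChartPt 𝕜 A k R)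
    (c : Fin 2 → R) :
    ∃ τ : ChartPt 𝕜 A k (DualNumber R), τ.foot = z ∧ IsFocal x k p τ ∧
      ∀ i, τ.diff (active x k p i) = c i := by
  induction k generalizing c with
  | zero =>
    obtain ⟨v, hv, hc⟩ := hx.exists_tangent z.base c
    refine ⟨ChartPt.ofBase v, ChartPt.ext_zero (AlgHom.ext fun a => ?_), isFocal_zero _ _ _,
      fun i => ?_⟩
    · simpa [ChartPt.foot_apply] using AlgHom.congr_fun hv a
    · simpa [ChartPt.diff_def, active] using hc i
  | succ k ih =>
    set m := z (X (Fin.last k))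
    obtain ⟨σ, hσ, hfocal, hdiff⟩ :=
      ih p.trunc z.proj fun i => if i = p.final then c p.final else m * c p.final
    have hfoot : (σ.extend (inl m + inr (c (Fin.rev p.final)))).foot = z := by
      rw [ChartPt.foot_extend, hσ, TrivSqZeroExt.fst_add, TrivSqZeroExt.fst_inl,
        TrivSqZeroExt.fst_inr, add_zero, ChartPt.extend_proj_last]
    refine ⟨σ.extend (inl m + inr (c (Fin.rev p.final))), hfoot, ?_, ?_⟩
    · rw [isFocal_succ, ChartPt.proj_extend, hfoot, hdiff, hdiff, if_pos rfl, if_neg (rev_ne _)]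
      exact ⟨hfocal, rfl⟩
    · rw [forall_iff_and_rev p.final, active_final, active_rev_final, ← ChartPt.diff_proj,
        ChartPt.proj_extend, hdiff, if_pos rfl]
      simp [ChartPt.diff_def]

lemma IsFocal.unique (hx : IsEtaleCoords 𝕜 x) {p : Word k} {τ τ' : ChartPt 𝕜 A k (DualNumber R)}
    (hτ : IsFocal x k p τ) (hτ' : IsFocal x k p τ') (hfoot : τ.foot = τ'.foot)
    (hdiff : ∀ i, τ.diff (active x k p i) = τ'.diff (active x k p i)) : τ = τ' := by
  induction k with
  | zero =>
    refine ChartPt.ext_zero (hx.tangent_unique (AlgHom.ext fun a => ?_) fun i => ?_)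
    · exact AlgHom.congr_fun hfoot (C a)
    · simpa [ChartPt.diff_def, active] using hdiff i
  | succ k ih =>
    rw [isFocal_succ] at hτ hτ'
    rw [forall_iff_and_rev p.final, active_final, active_rev_final, ← ChartPt.diff_proj,
      ← ChartPt.diff_proj] at hdiff
    refine ChartPt.ext_succ (ih hτ.1 hτ'.1 ?_ ?_) ?_
    · rw [ChartPt.foot_proj, ChartPt.foot_proj, hfoot]
    · rw [forall_iff_and_rev p.final, hτ.2, hτ'.2, hfoot, hdiff.1]
      exact ⟨rfl, rfl⟩
    · exact TrivSqZeroExt.ext (AlgHom.congr_fun hfoot _) hdiff.2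

end ChartPoints

/-! ### Gluing of the charts -/

section SamePoint

variable {𝕜 : Type u} [Field 𝕜] {A : Type v} [CommRing A] [Algebra 𝕜 A] {R : Type w} [CommRing R]
  [Algebra 𝕜 R] {k : ℕ} {x : Fin 2 → A}

lemma mem_line {p : Word (k + 1)} {q : ChartPt 𝕜 A (k + 1) R} {τ : ChartPt 𝕜 A k (DualNumber R)} :
    τ ∈ line x p q ↔ τ.foot = q.proj ∧ IsFocal x k p.trunc τ ∧
      τ.diff (active x k p.trunc (Fin.rev p.final)) =
        q (X (Fin.last k)) * τ.diff (active x k p.trunc p.final) := Iff.rfl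

lemma tmap_mem_line {R' : Type w'} [CommRing R'] [Algebra 𝕜 R'] {p : Word (k + 1)}
    {q : ChartPt 𝕜 A (k + 1) R} {τ : ChartPt 𝕜 A k (DualNumber R)} (h : τ ∈ line x p q)
    (φ : R →ₐ[𝕜] R') (c : R') : τ.tmap φ c ∈ line x p (φ.comp q) := by
  obtain ⟨hfoot, hfocal, hdiff⟩ := h
  refine mem_line.2 ⟨?_, hfocal.tmap φ c, ?_⟩
  · rw [ChartPt.foot_tmap, hfoot, ChartPt.comp_proj]
  · rw [ChartPt.diff_tmap, ChartPt.diff_tmap, hdiff, map_mul, AlgHom.comp_apply]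
    exact mul_left_comm _ _ _

lemma smul_mem_line {p : Word (k + 1)} {q : ChartPt 𝕜 A (k + 1) R}
    {τ : ChartPt 𝕜 A k (DualNumber R)} (h : τ ∈ line x p q) (c : R) :
    τ.tmap (AlgHom.id 𝕜 R) c ∈ line x p q := by
  simpa only [AlgHom.id_comp] using tmap_mem_line h (AlgHom.id 𝕜 R) c

lemma exists_generator (hx : IsEtaleCoords 𝕜 x) (p : Word (k + 1)) (q : ChartPt 𝕜 A (k + 1) R) :
    ∃ τ ∈ line x p q, τ.diff (active x k p.trunc p.final) = 1 := by
  obtain ⟨τ, hfoot, hfocal, hdiff⟩ := exists_isFocal hx p.trunc q.proj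
    fun i => if i = p.final then 1 else q (X (Fin.last k))
  have hfinal : τ.diff (active x k p.trunc p.final) = 1 := by rw [hdiff, if_pos rfl]
  exact ⟨τ, ⟨hfoot, hfocal, by rw [hdiff, if_neg (rev_ne _), hfinal, mul_one]⟩, hfinal⟩

lemma line_unique (hx : IsEtaleCoords 𝕜 x) {p : Word (k + 1)} {q : ChartPt 𝕜 A (k + 1) R}
    {τ τ' : ChartPt 𝕜 A k (DualNumber R)} (hτ : τ ∈ line x p q) (hτ' : τ' ∈ line x p q)
    (h : τ.diff (active x k p.trunc p.final) = τ'.diff (active x k p.trunc p.final)) : τ = τ' := by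
  refine hτ.2.1.unique hx hτ'.2.1 (hτ.1.trans hτ'.1.symm) ((forall_iff_and_rev p.final).2 ⟨h, ?_⟩)
  rw [hτ.2.2, hτ'.2.2, h]

lemma exists_eq_smul_of_mem_line (hx : IsEtaleCoords 𝕜 x) {p : Word (k + 1)}
    {q : ChartPt 𝕜 A (k + 1) R} {τ τ' : ChartPt 𝕜 A k (DualNumber R)} (hτ : τ ∈ line x p q)
    (hτ' : τ' ∈ line x p q) (h : IsUnit (τ.diff (active x k p.trunc p.final))) :
    ∃ c, τ' = τ.tmap (AlgHom.id 𝕜 R) c := by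
  obtain ⟨u, hu⟩ := h
  refine ⟨τ'.diff (active x k p.trunc p.final) * ↑u⁻¹,
    line_unique hx hτ' (smul_mem_line hτ _) ?_⟩
  simp [← hu]

lemma line_injective (hx : IsEtaleCoords 𝕜 x) {p : Word (k + 1)} {q q' : ChartPt 𝕜 A (k + 1) R}
    (h : line x p q = line x p q') : q = q' := by
  obtain ⟨τ, hτ, h1⟩ := exists_generator hx p q
  have hτ' : τ ∈ line x p q' := h ▸ hτ
  refine ChartPt.ext_succ (hτ.1.symm.trans hτ'.1) ?_
  simpa only [h1, mul_one] using hτ.2.2.symm.trans hτ'.2.2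

lemma samePoint_zero {p p' : Word 0} {q q' : ChartPt 𝕜 A 0 R} :
    SamePoint x 0 R p q p' q' ↔ q = q' := by rw [SamePoint]

lemma samePoint_succ {p p' : Word (k + 1)} {q q' : ChartPt 𝕜 A (k + 1) R} :
    SamePoint x (k + 1) R p q p' q' ↔
      SamePoint x k R p.trunc q.proj p'.trunc q'.proj ∧
        ∃ τ ∈ line x p q, ∃ τ' ∈ line x p' q',
          IsUnit (τ.diff (active x k p.trunc p.final)) ∧
          IsUnit (τ'.diff (active x k p'.trunc p'.final)) ∧
          SamePoint x k (DualNumber R) p.trunc τ p'.trunc τ' := by rw [SamePoint]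

namespace SamePoint

lemma map {R' : Type w} [CommRing R'] [Algebra 𝕜 R'] {p p' : Word k} {q q' : ChartPt 𝕜 A k R}
    (h : SamePoint x k R p q p' q') (φ : R →ₐ[𝕜] R') :
    SamePoint x k R' p (φ.comp q) p' (φ.comp q') := by
  induction k generalizing R R' with
  | zero => rw [samePoint_zero] at h ⊢; rw [h]
  | succ k ih =>
    rw [samePoint_succ] at h ⊢
    obtain ⟨hproj, τ, hτ, τ', hτ', hu, hu', hsame⟩ := h
    refine ⟨ih hproj φ, _, tmap_mem_line hτ φ 1, _, tmap_mem_line hτ' φ 1, ?_, ?_, ih hsame _⟩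
    · rw [ChartPt.diff_tmap, one_mul]; exact hu.map φ
    · rw [ChartPt.diff_tmap, one_mul]; exact hu'.map φ

protected lemma refl (hx : IsEtaleCoords 𝕜 x) (p : Word k) (q : ChartPt 𝕜 A k R) :
    SamePoint x k R p q p q := by
  induction k generalizing R with
  | zero => rw [samePoint_zero]
  | succ k ih =>
    obtain ⟨τ, hτ, h⟩ := exists_generator hx p q
    have hu : IsUnit (τ.diff (active x k p.trunc p.final)) := h ▸ isUnit_one
    exact samePoint_succ.2 ⟨ih _ _, τ, hτ, τ, hτ, hu, hu, ih _ _⟩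

protected lemma symm {p p' : Word k} {q q' : ChartPt 𝕜 A k R} (h : SamePoint x k R p q p' q') :
    SamePoint x k R p' q' p q := by
  induction k generalizing R with
  | zero => rw [samePoint_zero] at h ⊢; exact h.symm
  | succ k ih =>
    rw [samePoint_succ] at h ⊢
    obtain ⟨hproj, τ, hτ, τ', hτ', hu, hu', hsame⟩ := h
    exact ⟨ih hproj, τ', hτ', τ, hτ, hu', hu, ih hsame⟩

protected lemma trans (hx : IsEtaleCoords 𝕜 x) {p p' p'' : Word k} {q q' q'' : ChartPt 𝕜 A k R}
    (h : SamePoint x k R p q p' q') (h' : SamePoint x k R p' q' p'' q'') :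
    SamePoint x k R p q p'' q'' := by
  induction k generalizing R with
  | zero => rw [samePoint_zero] at *; exact h.trans h'
  | succ k ih =>
    rw [samePoint_succ] at h h' ⊢
    obtain ⟨hproj, τ, hτ, τ', hτ', hu, hu', hsame⟩ := h
    obtain ⟨hproj', σ, hσ, σ', hσ', hv, hv', hsame'⟩ := h'
    obtain ⟨c, rfl⟩ := exists_eq_smul_of_mem_line hx hτ' hσ hu'
    rw [ChartPt.diff_tmap] at hv
    refine ⟨ih hproj hproj', τ.tmap (AlgHom.id 𝕜 R) c, smul_mem_line hτ c, σ', hσ', ?_, hv',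
      ih (hsame.map _) hsame'⟩
    rw [ChartPt.diff_tmap]
    exact (isUnit_of_mul_isUnit_left hv).mul hu

lemma eq {p : Word k} {q q' : ChartPt 𝕜 A k R} (h : SamePoint x k R p q p q') : q = q' := by
  induction k generalizing R with
  | zero => rwa [samePoint_zero] at h
  | succ k ih =>
    obtain ⟨hproj, τ, hτ, τ', hτ', hu, -, hsame⟩ := samePoint_succ.1 h
    obtain rfl := ih hsame
    exact ChartPt.ext_succ (ih hproj) (hu.mul_left_injective (hτ.2.2.symm.trans hτ'.2.2))

end SamePoint

lemma Space.exists_mk (P : Space 𝕜 x k) : ∃ p q, P = Space.mk x p q := by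
  obtain ⟨⟨p, q⟩, rfl⟩ := Quot.exists_rep P
  exact ⟨p, q, rfl⟩

lemma Space.proj_mk (p : Word (k + 1)) (q : ChartPt 𝕜 A (k + 1) 𝕜) :
    (Space.mk x p q).proj = Space.mk x p.trunc q.proj := rfl

lemma Space.mk_eq_mk (hx : IsEtaleCoords 𝕜 x) {p p' : Word k} {q q' : ChartPt 𝕜 A k 𝕜} :
    Space.mk x p q = Space.mk x p' q' ↔ SamePoint x k 𝕜 p q p' q' :=
  ⟨fun h => (Equivalence.eqvGen_iff
    ⟨fun _ => .refl hx _ _, fun h => h.symm, fun h h' => h.trans hx h'⟩).1 (Quot.eqvGen_exact h),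
    fun h => Quot.sound h⟩

lemma Space.mk_injective (hx : IsEtaleCoords 𝕜 x) (p : Word k) :
    Function.Injective (Space.mk (𝕜 := 𝕜) x p) :=
  fun _ _ h => ((Space.mk_eq_mk hx).1 h).eq

end SamePoint

section Topology

variable {𝕜 : Type u} [Field 𝕜] {A : Type v} [CommRing A] [Algebra 𝕜 A] {k : ℕ} {x : Fin 2 → A}

lemma mem_inChart {p : Word k} {Z : Set (Space 𝕜 x k)} {q : ChartPt 𝕜 A k 𝕜} :
    q ∈ inChart p Z ↔ Space.mk x p q ∈ Z := Iff.rfl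

lemma mem_idealOf {p : Word k} {Z : Set (Space 𝕜 x k)} {f : ChartRing A k} :
    f ∈ idealOf p Z ↔ ∀ q ∈ inChart p Z, q f = 0 := by
  simp [idealOf]

lemma mem_tangentSpace {p : Word k} {Z : Set (Space 𝕜 x k)} {q : ChartPt 𝕜 A k 𝕜}
    {τ : ChartPt 𝕜 A k (DualNumber 𝕜)} :
    τ ∈ tangentSpace p Z q ↔ τ.foot = q ∧ ∀ f ∈ idealOf p Z, τ f = 0 := Iff.rfl

lemma isClosed_of_forall_inChart {Z : Set (Space 𝕜 x k)}
    (h : ∀ p, ∃ s : Set (ChartRing A k), inChart p Z = {q | ∀ f ∈ s, q f = 0}) : IsClosed Z := by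
  refine isClosed_iSup_iff.2 fun p => isClosed_coinduced.2 ?_
  obtain ⟨s, hs⟩ := h p
  refine isClosed_induced_iff.2 ⟨PrimeSpectrum.zeroLocus s, PrimeSpectrum.isClosed_zeroLocus s, ?_⟩
  exact hs.symm

lemma exists_basicOpen_subset_inChart {W : Set (Space 𝕜 x k)} (hW : IsOpen W) {p : Word k}
    {q : ChartPt 𝕜 A k 𝕜} (hq : q ∈ inChart p W) :
    ∃ f : ChartRing A k, q f ≠ 0 ∧ ∀ q' : ChartPt 𝕜 A k 𝕜, q' f ≠ 0 → q' ∈ inChart p W := by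
  obtain ⟨V, hV, hVW⟩ := isOpen_induced_iff.1 (isOpen_coinduced.1 (isOpen_iSup_iff.1 hW p))
  have hmem (q : ChartPt 𝕜 A k 𝕜) :
      (⟨RingHom.ker q, RingHom.ker_isPrime q⟩ : PrimeSpectrum (ChartRing A k)) ∈ V ↔
        q ∈ inChart p W := Set.ext_iff.1 hVW q
  obtain ⟨_, ⟨f, rfl⟩, hf, hfV⟩ :=
    PrimeSpectrum.isTopologicalBasis_basic_opens.exists_subset_of_mem_open ((hmem q).2 hq) hV
  exact ⟨f, hf, fun q' hq' => (hmem q').1 (hfV hq')⟩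

end Topology

/-! ### Reducedness and node binomials -/

section Reducedness

open scoped TensorProduct

lemma isReduced_of_etale (D B : Type*) [CommRing D] [IsDomain D] [CommRing B] [Algebra D B]
    [Algebra.Etale D B] : IsReduced B := by
  have : IsReduced (FractionRing D ⊗[D] B) :=
    Algebra.FormallyUnramified.isReduced_of_field (FractionRing D) _
  exact isReduced_of_injective (Algebra.TensorProduct.includeRight : B →ₐ[D] FractionRing D ⊗[D] B)
    (Algebra.TensorProduct.includeRight_injective (IsFractionRing.injective D (FractionRing D)))

lemma isRadical_map_of_etale {D : Type*} (B : Type*) [CommRing D] [CommRing B] [Algebra D B]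
    [Algebra.Etale D B] (I : Ideal D) [I.IsPrime] : (I.map (algebraMap D B)).IsRadical := by
  have : IsReduced ((D ⧸ I) ⊗[D] B) := isReduced_of_etale (D ⧸ I) _
  exact (Ideal.isRadical_iff_quotient_reduced _).2 <|
    isReduced_of_injective _ (Algebra.TensorProduct.quotIdealMapEquivQuotTensor B I).injective

variable {𝕜 : Type u} [Field 𝕜] {A : Type v} [CommRing A] [Algebra 𝕜 A]

lemma exists_point_of_notMem [IsAlgClosed 𝕜] [Algebra.FiniteType 𝕜 A] {I : Ideal A}
    (hI : I.IsRadical) {f : A} (hf : f ∉ I) :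
    ∃ q : A →ₐ[𝕜] 𝕜, (∀ g ∈ I, q g = 0) ∧ q f ≠ 0 := by
  have : IsJacobsonRing A := isJacobsonRing_of_finiteType (A := 𝕜)
  rw [← IsJacobsonRing.out this hI, Ideal.jacobson, Submodule.mem_sInf] at hf
  push Not at hf
  obtain ⟨m, ⟨hIm, hm⟩, hfm⟩ := hf
  let : Field (A ⧸ m) := Ideal.Quotient.field m
  have : Module.Finite 𝕜 (A ⧸ m) := finite_of_finite_type_of_isJacobsonRing 𝕜 (A ⧸ m)
  let e := AlgEquiv.ofBijective (Algebra.ofId 𝕜 (A ⧸ m))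
    IsAlgClosed.algebraMap_bijective_of_isIntegral
  have hq (g : A) : e.symm (Ideal.Quotient.mk m g) = 0 ↔ g ∈ m := by
    rw [map_eq_zero_iff _ e.symm.injective, Ideal.Quotient.eq_zero_iff_mem]
  exact ⟨e.symm.toAlgHom.comp (Ideal.Quotient.mkₐ 𝕜 m), fun g hg => (hq g).2 (hIm hg),
    fun h => hfm ((hq f).1 h)⟩

lemma mem_of_forall_point [IsAlgClosed 𝕜] [Algebra.FiniteType 𝕜 A] {I : Ideal A}
    (hI : I.IsRadical) {f : A} (hf : ∀ q : A →ₐ[𝕜] 𝕜, (∀ g ∈ I, q g = 0) → q f = 0) : f ∈ I := by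
  by_contra h
  obtain ⟨q, hq, hqf⟩ := exists_point_of_notMem (𝕜 := 𝕜) hI h
  exact hqf (hf q hq)

lemma eq_zero_of_forall_point [IsAlgClosed 𝕜] [Algebra.FiniteType 𝕜 A] [IsReduced A] {f : A}
    (hf : ∀ q : A →ₐ[𝕜] 𝕜, q f = 0) : f = 0 :=
  Ideal.mem_bot.1 <| mem_of_forall_point (𝕜 := 𝕜) Ideal.isRadical_bot fun q _ => hf q

variable {x : Fin 2 → A}

namespace IsEtaleCoords

lemma finiteType (hx : IsEtaleCoords 𝕜 x) : Algebra.FiniteType 𝕜 A := by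
  algebraize [(aeval x : MvPolynomial (Fin 2) 𝕜 →ₐ[𝕜] A).toRingHom]
  have : Algebra.Etale (MvPolynomial (Fin 2) 𝕜) A := hx
  have : IsScalarTower 𝕜 (MvPolynomial (Fin 2) 𝕜) A :=
    IsScalarTower.of_algebraMap_eq fun r => ((aeval x).commutes r).symm
  exact Algebra.FiniteType.trans (S := MvPolynomial (Fin 2) 𝕜) inferInstance inferInstance

lemma isRadical_map (hx : IsEtaleCoords 𝕜 x) (I : Ideal (MvPolynomial (Fin 2) 𝕜)) [I.IsPrime] :
    (I.map (aeval x : MvPolynomial (Fin 2) 𝕜 →ₐ[𝕜] A)).IsRadical := by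
  algebraize [(aeval x : MvPolynomial (Fin 2) 𝕜 →ₐ[𝕜] A).toRingHom]
  have : Algebra.Etale (MvPolynomial (Fin 2) 𝕜) A := hx
  exact isRadical_map_of_etale A I

lemma isReduced (hx : IsEtaleCoords 𝕜 x) : IsReduced A := by
  rw [← Ideal.isRadical_bot_iff, ← Ideal.map_bot (f := (aeval x : MvPolynomial (Fin 2) 𝕜 →ₐ[𝕜] A))]
  exact hx.isRadical_map ⊥

end IsEtaleCoords

lemma isPrime_span_mul_sub {t : 𝕜} (ht : t ≠ 0) :
    (Ideal.span {X 0 * X 1 - C t} : Ideal (MvPolynomial (Fin 2) 𝕜)).IsPrime := by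
  have hirr : Irreducible (X 0 * X 1 + C (-t) : MvPolynomial (Fin 2) 𝕜) :=
    MvPolynomial.irreducible_mul_X_add _ _ 1 (MvPolynomial.X_ne_zero 0) (by simp) (by simp)
      fun d _ hd => isUnit_of_dvd_unit hd ((isUnit_iff_ne_zero.2 (neg_ne_zero.2 ht)).map C)
  rw [sub_eq_add_neg, ← map_neg C, Ideal.span_singleton_prime hirr.ne_zero]
  exact hirr.prime

lemma ker_constantCoeff (σ R : Type*) [CommRing R] :
    RingHom.ker (MvPolynomial.constantCoeff : MvPolynomial σ R →+* R) =
      MvPolynomial.idealOfVars σ R := by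
  ext f
  rw [← pow_one (MvPolynomial.idealOfVars _ _), MvPolynomial.mem_pow_idealOfVars_iff']
  simp [MvPolynomial.constantCoeff, Finsupp.degree_eq_zero_iff]

namespace IsEtaleCoords

lemma isRadical_span_mul_sub (hx : IsEtaleCoords 𝕜 x) {t : 𝕜} (ht : t ≠ 0) :
    (Ideal.span {x 0 * x 1 - algebraMap 𝕜 A t}).IsRadical := by
  have := isPrime_span_mul_sub ht
  have h := hx.isRadical_map (Ideal.span {X 0 * X 1 - C t})
  rwa [Ideal.map_span, Set.image_singleton, map_sub, map_mul, MvPolynomial.aeval_X,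
    MvPolynomial.aeval_X, MvPolynomial.aeval_C] at h

lemma isRadical_span_range (hx : IsEtaleCoords 𝕜 x) : (Ideal.span (Set.range x)).IsRadical := by
  have : (MvPolynomial.idealOfVars (Fin 2) 𝕜).IsPrime :=
    ker_constantCoeff (Fin 2) 𝕜 ▸ RingHom.ker_isPrime _
  have h := hx.isRadical_map (MvPolynomial.idealOfVars (Fin 2) 𝕜)
  have hX : aeval x ∘ X = x := funext fun i => MvPolynomial.aeval_X (R := 𝕜) x i
  rwa [MvPolynomial.idealOfVars, Ideal.map_span, ← Set.range_comp, hX] at h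

lemma ker_eq_span_range [IsAlgClosed 𝕜] (hx : IsEtaleCoords 𝕜 x) {o : A →ₐ[𝕜] 𝕜}
    (ho : ∀ b : A →ₐ[𝕜] 𝕜, (∀ i, b (x i) = 0) ↔ b = o) :
    RingHom.ker o = Ideal.span (Set.range x) := by
  have := hx.finiteType
  refine le_antisymm (fun a ha => ?_) (Ideal.span_le.2 ?_)
  · refine mem_of_forall_point (𝕜 := 𝕜) hx.isRadical_span_range fun q hq => ?_
    rw [(ho q).1 fun i => hq _ (Ideal.subset_span ⟨i, rfl⟩)]
    exact ha
  · rintro _ ⟨i, rfl⟩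
    exact (ho o).2 rfl i

lemma notMem_span_singleton (hx : IsEtaleCoords 𝕜 x) {o : A →ₐ[𝕜] 𝕜} (ho : ∀ i, o (x i) = 0)
    {i j : Fin 2} (hij : i ≠ j) : x i ∉ Ideal.span {x j} := by
  intro h
  obtain ⟨a, ha⟩ := Ideal.mem_span_singleton'.1 h
  obtain ⟨v, hv, hdiff⟩ := hx.exists_tangent o fun l => if l = i then 1 else 0
  have hfst : (v (x j)).fst = o (x j) := AlgHom.congr_fun hv (x j)
  have hsnd := congrArg TrivSqZeroExt.snd (congrArg v ha)
  rw [map_mul, TrivSqZeroExt.snd_mul, hdiff, hdiff, hfst, ho] at hsnd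
  simp [hij.symm] at hsnd

lemma injective [Nontrivial A] (hx : IsEtaleCoords 𝕜 x) : Function.Injective x := by
  intro i j hij
  by_contra hne
  obtain ⟨v, -, hdiff⟩ := hx.exists_tangent (AlgHom.id 𝕜 A) fun l => if l = i then 1 else 0
  have h := hdiff j
  rw [← hij, hdiff i, if_pos rfl, if_neg (Ne.symm hne)] at h
  exact one_ne_zero h

end IsEtaleCoords

end Reducedness

section Weights

/-- The absolute values of the weights of the active coordinates under the torus action
`(x₁, x₂) ↦ (c x₁, c⁻¹ x₂)`. -/
def weight : (k : ℕ) → Word k → Fin 2 → ℕ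
  | 0, _, _ => 1
  | k + 1, p, i =>
      if i = p.final then weight k p.trunc i else weight k p.trunc 0 + weight k p.trunc 1

lemma weight_pos {k : ℕ} (p : Word k) (i : Fin 2) : 0 < weight k p i := by
  induction k generalizing i with
  | zero => simp [weight]
  | succ k ih =>
    rw [weight]
    split_ifs
    · exact ih _ _
    · exact Nat.add_pos_left (ih _ _) _

lemma weight_final {k : ℕ} (p : Word (k + 1)) :
    weight (k + 1) p p.final = weight k p.trunc p.final := by simp [weight]

lemma weight_rev_final {k : ℕ} (p : Word (k + 1)) :
    weight (k + 1) p (Fin.rev p.final) =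
      weight k p.trunc p.final + weight k p.trunc (Fin.rev p.final) := by
  rw [weight, if_neg (rev_ne _)]
  generalize p.final = s
  fin_cases s
  exacts [rfl, add_comm _ _]

lemma nodeCoeff_succ {k : ℕ} (p : Word (k + 1)) :
    nodeCoeff (k + 1) p = (weight k p.trunc p.final, weight k p.trunc (Fin.rev p.final)) := by
  induction k with
  | zero => simp [nodeCoeff, weight]
  | succ k ih =>
    rw [nodeCoeff, ih]
    rcases eq_or_eq_rev p.final p.trunc.final with h | h
    · simp only [h, if_true, weight_final, weight_rev_final]
    · simp only [h, if_neg (rev_ne _), Fin.rev_rev, weight_final, weight_rev_final]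

lemma isUnit_weight (𝕜 : Type*) [Field 𝕜] [CharZero 𝕜] (R : Type*) [CommRing R] [Algebra 𝕜 R]
    {k : ℕ} (p : Word k) (i : Fin 2) : IsUnit (weight k p i : R) := by
  have : IsUnit (weight k p i : 𝕜) :=
    isUnit_iff_ne_zero.2 (Nat.cast_ne_zero.2 (weight_pos p i).ne')
  simpa using this.map (algebraMap 𝕜 R)

end Weights

section NodeBinomials

variable {A : Type v} [CommRing A] {k : ℕ}

lemma nodeBinomial_succ (x : Fin 2 → A) (p : Word (k + 1)) :
    nodeBinomial x (k + 1) p =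
      (weight k p.trunc p.final : ChartRing A (k + 1)) *
        (X (Fin.last k) * pull k (active x k p.trunc p.final)) +
      (weight k p.trunc (Fin.rev p.final) : ChartRing A (k + 1)) *
        pull k (active x k p.trunc (Fin.rev p.final)) := by
  rw [nodeBinomial, nodeCoeff_succ]

/-- The node binomials `B(p₁), …, B(p₁⋯pₖ)` of positive level; these are homogeneous for the
torus action on the family of hyperbolas `x₁ x₂ = t` and vanish on the prolongation of each of
them. -/
def posBinomials (x : Fin 2 → A) : (k : ℕ) → Word k → Set (ChartRing A k)
  | 0, _ => ∅
  | k + 1, p => insert (nodeBinomial x (k + 1) p) (pull k '' posBinomials x k p.trunc)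

lemma nodeBinomials_eq_insert (x : Fin 2 → A) (p : Word k) :
    nodeBinomials x k p = insert (C (x 0 * x 1)) (posBinomials x k p) := by
  induction k with
  | zero => simp [nodeBinomials, nodeBinomial, posBinomials]
  | succ k ih =>
    rw [nodeBinomials, posBinomials, ih, Set.image_insert_eq, pull_C, Set.insert_comm]

end NodeBinomials

/-! ### Prolonged hyperbolas -/

section Hyperbola

variable {𝕜 : Type u} [Field 𝕜] {A : Type v} [CommRing A] [Algebra 𝕜 A] {k : ℕ}
  {R : Type w} [CommRing R] [Algebra 𝕜 R] {R' : Type w'} [CommRing R'] [Algebra 𝕜 R']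
  {x : Fin 2 → A}

/-- The point `q` lies on the prolongation of a hyperbola `x₁ x₂ = t` with `t` invertible. -/
def OnHyperbola (x : Fin 2 → A) (p : Word k) (q : ChartPt 𝕜 A k R) : Prop :=
  IsUnit (q (C (x 0 * x 1))) ∧ ∀ f ∈ posBinomials x k p, q f = 0

/-- The signs of the weights of `x₁` and `x₂` under the torus action
`(x₁, x₂) ↦ (c x₁, c⁻¹ x₂)`. -/
def sgn (i : Fin 2) : ℤ := if i = 0 then 1 else -1

lemma sgn_rev (i : Fin 2) : sgn (Fin.rev i) = -sgn i := by revert i; decide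

lemma isUnit_sgn (R : Type*) [CommRing R] (i : Fin 2) : IsUnit (sgn i : R) := by
  rw [sgn]; split_ifs <;> simp

lemma onHyperbola_zero {p : Word 0} {q : ChartPt 𝕜 A 0 R} :
    OnHyperbola x p q ↔ IsUnit (q (C (x 0 * x 1))) := by simp [OnHyperbola, posBinomials]

lemma onHyperbola_succ {p : Word (k + 1)} {q : ChartPt 𝕜 A (k + 1) R} :
    OnHyperbola x p q ↔ OnHyperbola x p.trunc q.proj ∧
      (weight k p.trunc p.final : R) *
        (q (X (Fin.last k)) * q.proj (active x k p.trunc p.final)) +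
      (weight k p.trunc (Fin.rev p.final) : R) *
        q.proj (active x k p.trunc (Fin.rev p.final)) = 0 := by
  rw [OnHyperbola, OnHyperbola, posBinomials, Set.forall_mem_insert, Set.forall_mem_image,
    nodeBinomial_succ]
  simp only [ChartPt.proj_apply, pull_C, map_add, map_mul, map_natCast]
  tauto

namespace OnHyperbola

lemma map {p : Word k} {q : ChartPt 𝕜 A k R} (h : OnHyperbola x p q) (φ : R →ₐ[𝕜] R') :
    OnHyperbola x p (φ.comp q) :=
  ⟨h.1.map φ, fun f hf => by rw [AlgHom.comp_apply, h.2 f hf, map_zero]⟩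

lemma proj {p : Word (k + 1)} {q : ChartPt 𝕜 A (k + 1) R} (h : OnHyperbola x p q) :
    OnHyperbola x p.trunc q.proj :=
  (onHyperbola_succ.1 h).1

lemma isUnit_active [CharZero 𝕜] {p : Word k} {q : ChartPt 𝕜 A k R} (h : OnHyperbola x p q)
    (i : Fin 2) : IsUnit (q (active x k p i)) := by
  induction k generalizing i with
  | zero =>
    have h01 := h.1
    rw [C.map_mul, map_mul, IsUnit.mul_iff] at h01
    revert i
    exact Fin.forall_fin_two.2 h01
  | succ k ih =>
    rw [onHyperbola_succ] at h
    have hu : IsUnit (-((weight k p.trunc (Fin.rev p.final) : R) *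
        q.proj (active x k p.trunc (Fin.rev p.final)))) :=
      ((isUnit_weight 𝕜 R _ _).mul (ih h.1 _)).neg
    rw [← eq_neg_of_add_eq_zero_left h.2] at hu
    revert i
    rw [forall_iff_and_rev p.final, active_final, active_rev_final]
    exact ⟨ih h.1 _, isUnit_of_mul_isUnit_left (isUnit_of_mul_isUnit_right hu)⟩

lemma unique [CharZero 𝕜] {p : Word k} {q q' : ChartPt 𝕜 A k R} (h : OnHyperbola x p q)
    (h' : OnHyperbola x p q') (hbase : q.base = q'.base) : q = q' := by
  induction k with
  | zero => exact ChartPt.ext_zero hbase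
  | succ k ih =>
    rw [onHyperbola_succ] at h h'
    have hproj : q.proj = q'.proj := by
      refine ih h.1 h'.1 (AlgHom.ext fun a => ?_)
      simpa [ChartPt.proj_apply] using AlgHom.congr_fun hbase a
    have hu := (isUnit_weight 𝕜 R p.trunc p.final).mul (h'.1.isUnit_active p.final)
    refine ChartPt.ext_succ hproj (hu.mul_left_injective ?_)
    have hlast := h.2
    rw [hproj] at hlast
    change q _ * _ = q' _ * _
    linear_combination hlast - h'.2

end OnHyperbola

lemma exists_onHyperbola [CharZero 𝕜] (p : Word k) (b : A →ₐ[𝕜] R) (hb : IsUnit (b (x 0 * x 1))) :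
    ∃ q : ChartPt 𝕜 A k R, q.base = b ∧ OnHyperbola x p q := by
  induction k with
  | zero =>
    refine ⟨ChartPt.ofBase b, AlgHom.ext fun a => by simp, onHyperbola_zero.2 ?_⟩
    rwa [ChartPt.ofBase_C]
  | succ k ih =>
    obtain ⟨z, hzb, hz⟩ := ih p.trunc
    obtain ⟨c, hc⟩ := (isUnit_weight 𝕜 R p.trunc p.final).mul (hz.isUnit_active p.final)
    set d := (weight k p.trunc (Fin.rev p.final) : R) * z (active x k p.trunc (Fin.rev p.final))
    refine ⟨z.extend (-(↑c⁻¹ * d)), ?_, ?_⟩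
    · rw [← hzb]
      refine AlgHom.ext fun a => ?_
      rw [ChartPt.base_apply, ChartPt.base_apply, ← pull_C, ChartPt.extend_pull]
    · rw [onHyperbola_succ, ChartPt.proj_extend, ChartPt.extend_last]
      refine ⟨hz, ?_⟩
      linear_combination (↑c⁻¹ * d) * hc - d * c.inv_mul

end Hyperbola

section LogarithmicTangents

variable {𝕜 : Type u} [Field 𝕜] {A : Type v} [CommRing A] [Algebra 𝕜 A] {k : ℕ}
  {R : Type w} [CommRing R] [Algebra 𝕜 R] {x : Fin 2 → A}

lemma exists_snd_eq_mul_sgn {v : A →ₐ[𝕜] DualNumber R} (hu : IsUnit (v (x 0 * x 1)))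
    (h : (v (x 0 * x 1)).snd = 0) :
    ∃ c : R, ∀ i, (v (x i)).snd = c * (sgn i * (v (x i)).fst) := by
  rw [TrivSqZeroExt.isUnit_iff_isUnit_fst, map_mul, TrivSqZeroExt.fst_mul, IsUnit.mul_iff] at hu
  obtain ⟨u, hu0⟩ := hu.1
  rw [map_mul, TrivSqZeroExt.snd_mul, ← hu0] at h
  simp only [smul_eq_mul, MulOpposite.smul_eq_mul_unop, MulOpposite.unop_op] at h
  refine ⟨↑u⁻¹ * (v (x 0)).snd, Fin.forall_fin_two.2 ⟨?_, u.isUnit.mul_right_injective ?_⟩⟩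
  · simp only [sgn, if_true, Int.cast_one, one_mul, ← hu0]
    linear_combination -(v (x 0)).snd * u.inv_mul
  · simp only [sgn, one_ne_zero, if_false, Int.cast_neg, Int.cast_one]
    linear_combination h + (v (x 0)).snd * (v (x 1)).fst * u.mul_inv

lemma exists_log_tangent (hx : IsEtaleCoords 𝕜 x) (b : A →ₐ[𝕜] R) :
    ∃ v : A →ₐ[𝕜] DualNumber R, (fstHom 𝕜 R R).comp v = b ∧
      (∀ i, (v (x i)).snd = sgn i * b (x i)) ∧ v (x 0 * x 1) = inl (b (x 0 * x 1)) := by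
  obtain ⟨v, hv, hdiff⟩ := hx.exists_tangent b fun i => sgn i * b (x i)
  have hfst (a : A) : (v a).fst = b a := AlgHom.congr_fun hv a
  refine ⟨v, hv, hdiff, TrivSqZeroExt.ext (hfst _) ?_⟩
  rw [map_mul, TrivSqZeroExt.snd_mul, hdiff, hdiff, hfst, hfst]
  simp [sgn]

namespace OnHyperbola

/-- The torus acts on the prolonged hyperbolas, and the active coordinates are homogeneous for this
action. -/
lemma isFocal_and_diff_active [CharZero 𝕜] {p : Word k} {τ : ChartPt 𝕜 A k (DualNumber R)}
    (h : OnHyperbola x p τ) {c : R}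
    (hτ : ∀ i, (τ (C (x i))).snd = c * (sgn i * (τ (C (x i))).fst)) :
    IsFocal x k p τ ∧ ∀ i, τ.diff (active x k p i) =
      c * (sgn i * weight k p i * τ.foot (active x k p i)) := by
  induction k with
  | zero => exact ⟨isFocal_zero _ _ _, fun i => by
      simpa [weight, active, ChartPt.diff_def, ChartPt.foot_apply] using hτ i⟩
  | succ k ih =>
    rw [onHyperbola_succ] at h
    obtain ⟨hfocal, hdiff⟩ := ih h.1 (by simpa [ChartPt.proj_apply] using hτ)
    have hu : IsUnit (weight k p.trunc p.final * τ.proj.foot (active x k p.trunc p.final)) :=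
      (isUnit_weight 𝕜 R p.trunc p.final).mul ((h.1.isUnit_active p.final).map (fstHom 𝕜 R R))
    have hfst := congrArg TrivSqZeroExt.fst h.2
    have hsnd := congrArg TrivSqZeroExt.snd h.2
    simp only [TrivSqZeroExt.fst_add, TrivSqZeroExt.fst_mul, TrivSqZeroExt.fst_natCast,
      TrivSqZeroExt.fst_zero, TrivSqZeroExt.snd_add, TrivSqZeroExt.snd_mul,
      TrivSqZeroExt.snd_natCast, TrivSqZeroExt.snd_zero, smul_zero, add_zero,
      smul_eq_mul, MulOpposite.smul_eq_mul_unop, MulOpposite.unop_op,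
      ← ChartPt.foot_apply, ← ChartPt.diff_def, hdiff, sgn_rev, Int.cast_neg] at hfst hsnd
    refine ⟨isFocal_succ.2 ⟨hfocal, ?_⟩, ?_⟩
    · rw [hdiff, hdiff, sgn_rev]
      push_cast
      linear_combination (-(c * sgn p.final : R)) * hfst
    · rw [forall_iff_and_rev p.final, active_final, active_rev_final, weight_final,
        weight_rev_final, sgn_rev]
      refine ⟨hdiff p.final, hu.mul_left_injective ?_⟩
      push_cast
      linear_combination hsnd + c * (sgn p.final : R) * weight k p.trunc (Fin.rev p.final) * hfst

lemma mem_line [CharZero 𝕜] {p : Word (k + 1)} {q : ChartPt 𝕜 A (k + 1) R}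
    (h : OnHyperbola x p q) {τ : ChartPt 𝕜 A k (DualNumber R)} (hτ : OnHyperbola x p.trunc τ)
    (hfoot : τ.foot = q.proj) {c : R}
    (hc : ∀ i, (τ (C (x i))).snd = c * (sgn i * (τ (C (x i))).fst)) : τ ∈ line x p q := by
  obtain ⟨hfocal, hdiff⟩ := hτ.isFocal_and_diff_active hc
  refine ⟨hfoot, hfocal, ?_⟩
  have hlast := (onHyperbola_succ.1 h).2
  rw [hdiff, hdiff, hfoot, sgn_rev]
  push_cast
  linear_combination (-(c * sgn p.final : R)) * hlast

lemma exists_log_generator [CharZero 𝕜] {p : Word (k + 1)} {q : ChartPt 𝕜 A (k + 1) R}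
    (h : OnHyperbola x p q) {v : A →ₐ[𝕜] DualNumber R} (hv : (fstHom 𝕜 R R).comp v = q.proj.base)
    (hlog : ∀ i, (v (x i)).snd = sgn i * q.proj.base (x i)) :
    ∃ τ ∈ line x p q, τ.base = v ∧ OnHyperbola x p.trunc τ ∧
      IsUnit (τ.diff (active x k p.trunc p.final)) := by
  have hfst (a : A) : (v a).fst = q.proj.base a := AlgHom.congr_fun hv a
  obtain ⟨τ, rfl, hτ⟩ := exists_onHyperbola (x := x) p.trunc v
    (by rw [TrivSqZeroExt.isUnit_iff_isUnit_fst, hfst]; exact h.proj.1)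
  have hfoot : τ.foot = q.proj := (hτ.map (fstHom 𝕜 R R)).unique h.proj hv
  have hlog' (i : Fin 2) : (τ (C (x i))).snd = 1 * (sgn i * (τ (C (x i))).fst) := by
    rw [one_mul, ← ChartPt.base_apply, hlog, hfst]
  refine ⟨τ, h.mem_line hτ hfoot hlog', rfl, hτ, ?_⟩
  rw [(hτ.isFocal_and_diff_active hlog').2, hfoot, one_mul]
  exact ((isUnit_sgn R _).mul (isUnit_weight 𝕜 R _ _)).mul (h.proj.isUnit_active _)

lemma samePoint [CharZero 𝕜] (hx : IsEtaleCoords 𝕜 x) {p p' : Word k} {q q' : ChartPt 𝕜 A k R}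
    (h : OnHyperbola x p q) (h' : OnHyperbola x p' q') (hbase : q.base = q'.base) :
    SamePoint x k R p q p' q' := by
  induction k generalizing R with
  | zero => exact samePoint_zero.2 (ChartPt.ext_zero hbase)
  | succ k ih =>
    have hbase' : q.proj.base = q'.proj.base := AlgHom.ext fun a => by
      simpa [ChartPt.proj_apply] using AlgHom.congr_fun hbase a
    obtain ⟨v, hv, hlog, -⟩ := exists_log_tangent hx q.proj.base
    obtain ⟨τ, hτ, hτb, hτh, hu⟩ := h.exists_log_generator hv hlog
    obtain ⟨τ', hτ', hτb', hτh', hu'⟩ :=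
      h'.exists_log_generator (by rwa [← hbase']) (by rwa [← hbase'])
    exact samePoint_succ.2 ⟨ih h.proj h'.proj hbase', τ, hτ, τ', hτ', hu, hu',
      ih hτh hτh' (hτb.trans hτb'.symm)⟩

end OnHyperbola

end LogarithmicTangents

section HyperbolaProlongation

variable {𝕜 : Type u} [Field 𝕜] [CharZero 𝕜] {A : Type v} [CommRing A] [Algebra 𝕜 A]
  {x : Fin 2 → A} {k : ℕ} {t : 𝕜}

lemma samePoint_onHyperbola (hx : IsEtaleCoords 𝕜 x) {p p' : Word k} {q q' : ChartPt 𝕜 A k 𝕜}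
    (hs : SamePoint x k 𝕜 p q p' q') (h : OnHyperbola x p' q') :
    OnHyperbola x p q ∧ q.base = q'.base := by
  obtain ⟨q'', hbase, h''⟩ := exists_onHyperbola p q'.base h.1
  obtain rfl := (hs.trans hx (h.samePoint hx h'' hbase.symm)).eq
  exact ⟨h'', hbase⟩

/-- The prolongation to level `k` of the hyperbola `x₁ x₂ = t`, for `t ≠ 0`. -/
def hyperbola {𝕜 : Type u} [Field 𝕜] {A : Type v} [CommRing A] [Algebra 𝕜 A]
    (x : Fin 2 → A) (k : ℕ) (t : 𝕜) : Set (Space 𝕜 x k) :=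
  {P | ∃ p q, P = Space.mk x p q ∧ OnHyperbola x p q ∧ q (C (x 0 * x 1)) = t}

lemma mem_inChart_hyperbola (hx : IsEtaleCoords 𝕜 x) {p : Word k} {q : ChartPt 𝕜 A k 𝕜} :
    q ∈ inChart p (hyperbola x k t) ↔ OnHyperbola x p q ∧ q (C (x 0 * x 1)) = t := by
  refine ⟨?_, fun h => ⟨p, q, rfl, h⟩⟩
  rintro ⟨p', q', hP, h', ht⟩
  obtain ⟨h, hbase⟩ := samePoint_onHyperbola hx ((Space.mk_eq_mk hx).1 hP) h'
  exact ⟨h, (AlgHom.congr_fun hbase _).trans ht⟩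

omit [CharZero 𝕜] in
lemma apply_C_sub_algebraMap_eq_zero {R : Type w} [CommRing R] [Algebra 𝕜 R]
    {q : ChartPt 𝕜 A k R} {a : A} :
    q (C (a - algebraMap 𝕜 A t)) = 0 ↔ q (C a) = algebraMap 𝕜 R t := by
  have hC : q (C (algebraMap 𝕜 A t)) = algebraMap 𝕜 R t := q.commutes t
  rw [map_sub, map_sub, hC, sub_eq_zero]

lemma isClosed_hyperbola (hx : IsEtaleCoords 𝕜 x) (ht : t ≠ 0) : IsClosed (hyperbola x k t) := by
  refine isClosed_of_forall_inChart fun p =>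
    ⟨insert (C (x 0 * x 1 - algebraMap 𝕜 A t)) (posBinomials x k p), Set.ext fun q => ?_⟩
  rw [mem_inChart_hyperbola hx, OnHyperbola, Set.mem_ofPred_eq, Set.forall_mem_insert,
    apply_C_sub_algebraMap_eq_zero]
  constructor
  · rintro ⟨⟨-, hpos⟩, hqt⟩
    exact ⟨hqt, hpos⟩
  · rintro ⟨hqt, hpos⟩
    exact ⟨⟨hqt ▸ isUnit_iff_ne_zero.2 ht, hpos⟩, hqt⟩

variable [IsAlgClosed 𝕜]

/-- The point `τ` factors through the generic point of the hyperbola, whose coordinate ring is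
reduced. -/
lemma OnHyperbola.eq_zero_of_mem_idealOf (hx : IsEtaleCoords 𝕜 x) (ht : t ≠ 0) {p : Word k}
    {R : Type w} [CommRing R] [Algebra 𝕜 R] {τ : ChartPt 𝕜 A k R} (hτ : OnHyperbola x p τ)
    (hτt : τ (C (x 0 * x 1)) = algebraMap 𝕜 R t) {f : ChartRing A k}
    (hf : f ∈ idealOf p (hyperbola x k t)) : τ f = 0 := by
  let I := Ideal.span {x 0 * x 1 - algebraMap 𝕜 A t}
  have := hx.finiteType
  have : IsReduced (A ⧸ I) :=
    (Ideal.isRadical_iff_quotient_reduced _).1 (hx.isRadical_span_mul_sub ht)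
  have hI : Ideal.Quotient.mkₐ 𝕜 I (x 0 * x 1) = algebraMap 𝕜 (A ⧸ I) t :=
    Ideal.Quotient.eq.2 (Ideal.subset_span rfl)
  obtain ⟨g, hgb, hg⟩ := exists_onHyperbola p (Ideal.Quotient.mkₐ 𝕜 I) (x := x)
    (hI ▸ (isUnit_iff_ne_zero.2 ht).map (algebraMap 𝕜 (A ⧸ I)))
  have hgt : g (C (x 0 * x 1)) = algebraMap 𝕜 (A ⧸ I) t := (AlgHom.congr_fun hgb _).trans hI
  have hgf : g f = 0 := eq_zero_of_forall_point (𝕜 := 𝕜) fun r =>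
    mem_idealOf.1 hf (r.comp g) ((mem_inChart_hyperbola hx).2
      ⟨hg.map r, by rw [AlgHom.comp_apply, hgt, AlgHom.commutes, Algebra.algebraMap_self_apply]⟩)
  have hker : I ≤ RingHom.ker τ.base :=
    (Ideal.span_singleton_le_iff_mem _).2 (apply_C_sub_algebraMap_eq_zero.2 hτt)
  have hτg : (Ideal.Quotient.liftₐ I τ.base fun a ha => hker ha).comp g = τ := by
    refine (hg.map _).unique hτ (AlgHom.ext fun a => ?_)
    rw [ChartPt.base_apply, AlgHom.comp_apply, ← ChartPt.base_apply, hgb]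
    rfl
  rw [← hτg, AlgHom.comp_apply, hgf, map_zero]

lemma mem_tangentSpace_hyperbola (hx : IsEtaleCoords 𝕜 x) (ht : t ≠ 0) {p : Word k}
    {q : ChartPt 𝕜 A k 𝕜} {τ : ChartPt 𝕜 A k (DualNumber 𝕜)} :
    τ ∈ tangentSpace p (hyperbola x k t) q ↔
      τ.foot = q ∧ OnHyperbola x p τ ∧ τ (C (x 0 * x 1)) = algebraMap 𝕜 _ t := by
  rw [mem_tangentSpace]
  refine and_congr_right fun _ => ⟨fun hτ => ?_, fun ⟨hτ, hτt⟩ f hf =>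
    hτ.eq_zero_of_mem_idealOf hx ht hτt hf⟩
  have hτt : τ (C (x 0 * x 1)) = algebraMap 𝕜 _ t :=
    apply_C_sub_algebraMap_eq_zero.1 <| hτ _ <| mem_idealOf.2 fun r hr =>
      apply_C_sub_algebraMap_eq_zero.2 ((mem_inChart_hyperbola hx).1 hr).2
  exact ⟨⟨hτt ▸ (isUnit_iff_ne_zero.2 ht).map _, fun f hf => hτ f <| mem_idealOf.2 fun r hr =>
    ((mem_inChart_hyperbola hx).1 hr).1.2 f hf⟩, hτt⟩

lemma tangentSpace_hyperbola (hx : IsEtaleCoords 𝕜 x) (ht : t ≠ 0) {p : Word (k + 1)}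
    {q : ChartPt 𝕜 A (k + 1) 𝕜} (hq : OnHyperbola x p q) (hqt : q (C (x 0 * x 1)) = t) :
    tangentSpace p.trunc (hyperbola x k t) q.proj = line x p q := by
  refine Set.ext fun τ => (mem_tangentSpace_hyperbola hx ht).trans ⟨?_, fun hτ => ⟨hτ.1, ?_⟩⟩
  · rintro ⟨hfoot, hτ, hτt⟩
    obtain ⟨c, hc⟩ := exists_snd_eq_mul_sgn (v := τ.base) hτ.1 (congrArg TrivSqZeroExt.snd hτt)
    exact hq.mem_line hτ hfoot hc
  · obtain ⟨v, hv, hlog, hv01⟩ := exists_log_tangent hx q.proj.base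
    obtain ⟨σ, hσ, hσb, hσh, hu⟩ := hq.exists_log_generator hv hlog
    obtain ⟨c, rfl⟩ := exists_eq_smul_of_mem_line hx hσ hτ hu
    have hσt : σ (C (x 0 * x 1)) = algebraMap 𝕜 (DualNumber 𝕜) t := by
      rw [← ChartPt.base_apply, hσb, hv01, ChartPt.base_apply, ChartPt.proj_apply, pull_C, hqt]
      rfl
    exact ⟨hσh.map _, by rw [ChartPt.tmap, AlgHom.comp_apply, hσt, AlgHom.commutes]⟩

lemma prolong_hyperbola (hx : IsEtaleCoords 𝕜 x) (ht : t ≠ 0) :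
    prolong (hyperbola x k t) = hyperbola x (k + 1) t := by
  rw [prolong]
  convert! (isClosed_hyperbola hx ht).closure_eq using 2
  ext P
  constructor
  · rintro ⟨p, q, rfl, hZ, hT⟩
    obtain ⟨hz, hzt⟩ := (mem_inChart_hyperbola hx).1 hZ
    obtain ⟨q', hbase, hq'⟩ := exists_onHyperbola p q.proj.base hz.1
    have hproj : q'.proj = q.proj := hq'.proj.unique hz <| AlgHom.ext fun a => by
      rw [← hbase, ChartPt.base_apply, ChartPt.base_apply, ChartPt.proj_apply, pull_C]
    have hqt : q' (C (x 0 * x 1)) = t := (AlgHom.congr_fun hbase _).trans hzt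
    obtain rfl : q' = q :=
      line_injective hx ((tangentSpace_hyperbola hx ht hq' hqt).symm.trans (hproj ▸ hT))
    exact ⟨p, q', rfl, hq', hqt⟩
  · rintro ⟨p, q, rfl, hq, hqt⟩
    exact ⟨p, q, rfl, ⟨p.trunc, q.proj, rfl, hq.proj, by rwa [ChartPt.proj_apply, pull_C]⟩,
      tangentSpace_hyperbola hx ht hq hqt⟩

omit [CharZero 𝕜] [IsAlgClosed 𝕜] in
lemma zeroLocus_eq_hyperbola (ht : t ≠ 0) :
    zeroLocus x (x 0 * x 1 - algebraMap 𝕜 A t) = hyperbola x 0 t := by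
  ext P
  constructor
  · rintro ⟨q, rfl, hq⟩
    have hqt : q (C (x 0 * x 1)) = t := apply_C_sub_algebraMap_eq_zero.1 hq
    exact ⟨_, q, rfl, onHyperbola_zero.2 (hqt ▸ isUnit_iff_ne_zero.2 ht), hqt⟩
  · rintro ⟨p, q, rfl, -, hqt⟩
    exact ⟨q, by rw [Subsingleton.elim p ![]], apply_C_sub_algebraMap_eq_zero.2 hqt⟩

lemma iterProlong_hyperbola (hx : IsEtaleCoords 𝕜 x) (ht : t ≠ 0) (k : ℕ) :
    iterProlong (zeroLocus x (x 0 * x 1 - algebraMap 𝕜 A t)) k = hyperbola x k t := by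
  induction k with
  | zero => exact zeroLocus_eq_hyperbola ht
  | succ k ih => rw [iterProlong, ih, prolong_hyperbola hx ht]

lemma mem_familyIdeal (hx : IsEtaleCoords 𝕜 x) {p : Word k} {F : Polynomial (ChartRing A k)} :
    F ∈ familyIdeal 𝕜 x p ↔
      ∀ q : ChartPt 𝕜 A k 𝕜, OnHyperbola x p q → q (F.eval (C (x 0 * x 1))) = 0 := by
  have heval (q : ChartPt 𝕜 A k 𝕜) :
      F.eval₂ q.toRingHom (q (C (x 0 * x 1))) = q (F.eval (C (x 0 * x 1))) :=
    Polynomial.eval₂_at_apply q.toRingHom _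
  simp only [familyIdeal, Ideal.mem_iInf, RingHom.mem_ker, Polynomial.coe_eval₂RingHom]
  constructor
  · intro h q hq
    have ht : q (C (x 0 * x 1)) ≠ 0 := hq.1.ne_zero
    rw [← heval]
    refine h _ ht q ?_
    rw [iterProlong_hyperbola hx ht, mem_inChart_hyperbola hx]
    exact ⟨hq, rfl⟩
  · intro h t ht q hq
    rw [iterProlong_hyperbola hx ht, mem_inChart_hyperbola hx] at hq
    rw [← hq.2, heval, h q hq.1]

end HyperbolaProlongation

/-! ### The family and its central ideal -/

section EvaluationKernel

variable {B : Type*} [CommRing B] {R : Type*} [CommRing R] {φ : B →+* R} {n : R} {r d : B}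

lemma exists_pow_mul_eval₂_eq (h : φ r * n + φ d = 0) (m : ℕ) {F : Polynomial B}
    (hF : F.natDegree ≤ m) :
    ∃ g, φ r ^ m * F.eval₂ φ n = φ (r * g + (-d) ^ m * F.coeff m) := by
  induction m generalizing F with
  | zero =>
    rw [Polynomial.eq_C_of_natDegree_le_zero hF]
    exact ⟨0, by simp⟩
  | succ m ih =>
    obtain ⟨g, hg⟩ := ih (F := F.divX) <| by
      rw [Polynomial.natDegree_divX_eq_natDegree_tsub_one]
      omega
    refine ⟨r ^ m * F.coeff 0 - d * g, ?_⟩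
    have hdiv : F.eval₂ φ n = F.divX.eval₂ φ n * n + φ (F.coeff 0) := by
      conv_lhs => rw [← F.divX_mul_X_add]
      simp
    rw [Polynomial.coeff_divX] at hg
    simp only [map_add, map_sub, map_mul, map_pow, map_neg] at hg ⊢
    rw [hdiv]
    linear_combination (φ r * n) * hg +
      ((-φ d) ^ m * φ (F.coeff (m + 1)) + φ r * φ g) * h

/-- `F(-d/r) = 0` forces `r` to divide the leading coefficient modulo `ker φ`, so the degree of `F`
can be lowered by a multiple of `r X + d`. -/
lemma mem_of_eval₂_eq_zero (h : φ r * n + φ d = 0)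
    (hreg : ∀ f, d * f ∈ Ideal.span {r} ⊔ RingHom.ker φ → f ∈ Ideal.span {r} ⊔ RingHom.ker φ)
    (m : ℕ) {F : Polynomial B} (hF : F.natDegree ≤ m) (h0 : F.eval₂ φ n = 0) :
    F ∈ Ideal.span {Polynomial.C r * Polynomial.X + Polynomial.C d} ⊔
      (RingHom.ker φ).map Polynomial.C := by
  induction m generalizing F with
  | zero =>
    rw [Polynomial.eq_C_of_natDegree_le_zero hF, Polynomial.eval₂_C] at *
    exact Ideal.mem_sup_right (Ideal.mem_map_of_mem _ h0)
  | succ m ih =>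
    have hlead : F.coeff (m + 1) ∈ Ideal.span {r} ⊔ RingHom.ker φ := by
      obtain ⟨g, hg⟩ := exists_pow_mul_eval₂_eq h (m + 1) hF
      rw [h0, mul_zero] at hg
      have hpow (j : ℕ) (c : B) (hc : (-d) ^ j * c ∈ Ideal.span {r} ⊔ RingHom.ker φ) :
          c ∈ Ideal.span {r} ⊔ RingHom.ker φ := by
        induction j with
        | zero => simpa using hc
        | succ j ihj =>
          rw [pow_succ', mul_assoc, neg_mul, neg_mem_iff] at hc
          exact ihj (hreg _ hc)
      exact hpow (m + 1) _ (Ideal.mem_span_singleton_sup.2 ⟨-g, _, hg.symm, by ring⟩)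
    obtain ⟨g, κ, hκ, hgκ⟩ := Ideal.mem_span_singleton_sup.1 hlead
    obtain ⟨G, hG⟩ : ∃ G, G = Polynomial.C κ * Polynomial.X ^ (m + 1) +
        Polynomial.C g * Polynomial.X ^ m *
          (Polynomial.C r * Polynomial.X + Polynomial.C d) := ⟨_, rfl⟩
    have hGmem : G ∈ Ideal.span {Polynomial.C r * Polynomial.X + Polynomial.C d} ⊔
        (RingHom.ker φ).map Polynomial.C := by
      rw [hG]
      exact add_mem (Ideal.mem_sup_right (Ideal.mul_mem_right _ _ (Ideal.mem_map_of_mem _ hκ)))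
        (Ideal.mem_sup_left (Ideal.mul_mem_left _ _ (Ideal.mem_span_singleton_self _)))
    have hGdeg : G.natDegree ≤ m + 1 := by rw [hG]; compute_degree
    have hGcoeff : (F - G).coeff (m + 1) = 0 := by
      rw [Polynomial.coeff_sub, ← hgκ, hG]
      simp [mul_add, mul_assoc, Polynomial.coeff_X_pow_mul', Polynomial.coeff_C, add_comm]
    have hG0 : G.eval₂ φ n = 0 := by
      rw [RingHom.mem_ker] at hκ
      simp [hG, hκ, h]
    have hsub : (F - G).eval₂ φ n = 0 := by rw [Polynomial.eval₂_sub, h0, hG0, sub_zero]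
    simpa using add_mem (ih (Polynomial.natDegree_le_pred
      ((Polynomial.natDegree_sub_le_of_le hF hGdeg).trans (max_self _).le) hGcoeff) hsub) hGmem

lemma ker_eval₂RingHom_eq (h : φ r * n + φ d = 0)
    (hreg : ∀ f, d * f ∈ Ideal.span {r} ⊔ RingHom.ker φ → f ∈ Ideal.span {r} ⊔ RingHom.ker φ) :
    RingHom.ker (Polynomial.eval₂RingHom φ n) =
      Ideal.span {Polynomial.C r * Polynomial.X + Polynomial.C d} ⊔
        (RingHom.ker φ).map Polynomial.C := by
  refine le_antisymm (fun F hF => mem_of_eval₂_eq_zero h hreg _ le_rfl hF) (sup_le ?_ ?_)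
  · rw [Ideal.span_singleton_le_iff_mem, RingHom.mem_ker]
    simpa using h
  · rw [Ideal.map_le_iff_le_comap]
    intro b hb
    simpa using hb

end EvaluationKernel

section LastCoordinate

variable {A : Type v} [CommRing A] {k : ℕ}

/-- Functions on a chart at level `k + 1` as polynomials in the last coordinate over the functions
on the chart below it. -/
noncomputable def lastEquiv (A : Type v) [CommRing A] (k : ℕ) :
    ChartRing A (k + 1) ≃ₐ[A] Polynomial (ChartRing A k) :=
  (MvPolynomial.renameEquiv A finSuccEquivLast).trans (MvPolynomial.optionEquivLeft A (Fin k))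

@[simp]
lemma lastEquiv_last : lastEquiv A k (X (Fin.last k)) = Polynomial.X := by simp [lastEquiv]

lemma lastEquiv_comp_pull (A : Type v) [CommRing A] (k : ℕ) :
    (lastEquiv A k).toAlgHom.comp (pull k) = Polynomial.CAlgHom := by
  ext j
  simp [lastEquiv]

@[simp]
lemma lastEquiv_pull (f : ChartRing A k) : lastEquiv A k (pull k f) = Polynomial.C f :=
  AlgHom.congr_fun (lastEquiv_comp_pull A k) f

lemma apply_eq_eval₂_lastEquiv {𝕜 : Type u} [Field 𝕜] [Algebra 𝕜 A] {R : Type w} [CommRing R]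
    [Algebra 𝕜 R] (q : ChartPt 𝕜 A (k + 1) R) (f : ChartRing A (k + 1)) :
    q f = (lastEquiv A k f).eval₂ q.proj.toRingHom (q (X (Fin.last k))) := by
  have h : (q : ChartRing A (k + 1) →+* R) =
      (Polynomial.eval₂RingHom q.proj.toRingHom (q (X (Fin.last k)))).comp
        (lastEquiv A k).toRingEquiv.toRingHom := by
    refine MvPolynomial.ringHom_ext (fun a => ?_) (Fin.lastCases ?_ fun j => ?_)
    · change q (C a) = (lastEquiv A k (C a)).eval₂ _ _
      rw [← pull_C, lastEquiv_pull, Polynomial.eval₂_C]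
      rfl
    · simp
    · rw [← pull_X]
      simp [-pull_X, ChartPt.proj_apply]
  exact RingHom.congr_fun h f

lemma mem_iff_lastEquiv_mem_map {I : Ideal (ChartRing A (k + 1))} {f : ChartRing A (k + 1)} :
    f ∈ I ↔ lastEquiv A k f ∈ I.map (lastEquiv A k).toAlgHom := by
  refine ⟨Ideal.mem_map_of_mem (lastEquiv A k).toAlgHom, fun h => ?_⟩
  obtain ⟨g, hg, hgf⟩ := (Ideal.mem_map_of_equiv (lastEquiv A k) _).1 h
  rwa [← (lastEquiv A k).injective hgf]

lemma map_lastEquiv_map_pull (I : Ideal (ChartRing A k)) :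
    (I.map (pull k)).map (lastEquiv A k).toAlgHom = I.map Polynomial.C := by
  rw [Ideal.map_mapₐ, lastEquiv_comp_pull]
  rfl

lemma map_pull_span_singleton (f : ChartRing A k) :
    (Ideal.span {f}).map (pull k) = Ideal.span {pull k f} := by
  rw [Ideal.map_span, Set.image_singleton]

lemma mem_map_pull_iff {I : Ideal (ChartRing A k)} {f : ChartRing A (k + 1)} :
    f ∈ I.map (pull k) ↔ lastEquiv A k f ∈ I.map Polynomial.C := by
  rw [mem_iff_lastEquiv_mem_map, map_lastEquiv_map_pull]

lemma mem_span_last_sup_map_pull_iff {I : Ideal (ChartRing A k)} {f : ChartRing A (k + 1)} :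
    f ∈ Ideal.span {X (Fin.last k)} ⊔ I.map (pull k) ↔ (lastEquiv A k f).coeff 0 ∈ I := by
  rw [mem_iff_lastEquiv_mem_map, Ideal.map_sup, map_lastEquiv_map_pull, Ideal.map_span,
    Set.image_singleton]
  change _ ∈ Ideal.span {lastEquiv A k (X (Fin.last k))} ⊔ _ ↔ _
  rw [lastEquiv_last, Ideal.mem_span_singleton_sup]
  constructor
  · rintro ⟨G, F, hF, h⟩
    rw [← h]
    simpa using Ideal.mem_map_C_iff.1 hF 0
  · exact fun h => ⟨_, _, Ideal.mem_map_of_mem _ h, Polynomial.divX_mul_X_add _⟩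

end LastCoordinate

section Regularity

variable {A : Type v} [CommRing A] {k : ℕ} {x : Fin 2 → A}

lemma span_posBinomials_succ (x : Fin 2 → A) (p : Word (k + 1)) :
    Ideal.span (posBinomials x (k + 1) p) =
      Ideal.span {nodeBinomial x (k + 1) p} ⊔
        (Ideal.span (posBinomials x k p.trunc)).map (pull k) := by
  rw [posBinomials, Ideal.span_insert, Ideal.map_span]

lemma C_mem_map_C_iff {σ : Type*} {I : Ideal A} {a : A} :
    (C a : MvPolynomial σ A) ∈ I.map C ↔ a ∈ I :=
  ⟨fun h => by simpa using MvPolynomial.mem_map_C_iff.1 h 0, Ideal.mem_map_of_mem C⟩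

lemma span_singleton_sup_span_mul_add {B : Type*} [CommRing B] {a b u v : B} (hb : IsUnit b) :
    Ideal.span {u} ⊔ Ideal.span {a * u + b * v} = Ideal.span {u} ⊔ Ideal.span {v} := by
  rw [← Ideal.span_insert, add_comm, Ideal.span_pair_add_mul_left, Ideal.span_insert,
    Ideal.span_singleton_mul_left_unit hb]

lemma lastEquiv_nodeBinomial (x : Fin 2 → A) (p : Word (k + 1)) :
    lastEquiv A k (nodeBinomial x (k + 1) p) =
      Polynomial.C (weight k p.trunc p.final * active x k p.trunc p.final) * Polynomial.X +
        Polynomial.C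
          (weight k p.trunc (Fin.rev p.final) * active x k p.trunc (Fin.rev p.final)) := by
  rw [nodeBinomial_succ]
  simp [mul_assoc, mul_comm Polynomial.X]

section NodeIdeal

variable (𝕜 : Type u) [Field 𝕜] [CharZero 𝕜] [Algebra 𝕜 A]
include 𝕜

lemma span_active_final_sup (x : Fin 2 → A) (p : Word (k + 1)) :
    Ideal.span {active x (k + 1) p p.final} ⊔ Ideal.span (posBinomials x (k + 1) p) =
      (Ideal.span {active x k p.trunc p.final} ⊔
        (Ideal.span {active x k p.trunc (Fin.rev p.final)} ⊔
          Ideal.span (posBinomials x k p.trunc))).map (pull k) := by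
  rw [span_posBinomials_succ, active_final, nodeBinomial_succ, ← mul_assoc, ← sup_assoc,
    span_singleton_sup_span_mul_add (isUnit_weight 𝕜 _ _ _), Ideal.map_sup, Ideal.map_sup,
    map_pull_span_singleton, map_pull_span_singleton, sup_assoc]

lemma span_active_rev_final_sup (x : Fin 2 → A) (p : Word (k + 1)) :
    Ideal.span {active x (k + 1) p (Fin.rev p.final)} ⊔ Ideal.span (posBinomials x (k + 1) p) =
      Ideal.span {X (Fin.last k)} ⊔
        (Ideal.span {active x k p.trunc (Fin.rev p.final)} ⊔
          Ideal.span (posBinomials x k p.trunc)).map (pull k) := by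
  rw [span_posBinomials_succ, active_rev_final, nodeBinomial_succ, mul_left_comm,
    mul_comm (X (Fin.last k)), ← sup_assoc,
    span_singleton_sup_span_mul_add (isUnit_weight 𝕜 _ _ _), Ideal.map_sup,
    map_pull_span_singleton, sup_assoc]

lemma mem_of_active_mul_mem (hirr : ∀ i, (Ideal.span {x i}).IsPrime)
    (hmem : ∀ i, x (Fin.rev i) ∉ Ideal.span {x i}) (p : Word k) (i : Fin 2) {f : ChartRing A k}
    (hf : active x k p (Fin.rev i) * f ∈
      Ideal.span {active x k p i} ⊔ Ideal.span (posBinomials x k p)) :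
    f ∈ Ideal.span {active x k p i} ⊔ Ideal.span (posBinomials x k p) := by
  induction k generalizing i with
  | zero =>
    obtain ⟨a, rfl⟩ := MvPolynomial.C_surjective (Fin 0) f
    simp only [posBinomials, active, Ideal.span_empty, sup_bot_eq] at hf ⊢
    rw [← C.map_mul, ← Set.image_singleton, ← Ideal.map_span, C_mem_map_C_iff] at hf
    rw [← Set.image_singleton, ← Ideal.map_span, C_mem_map_C_iff]
    exact ((hirr i).mem_or_mem hf).resolve_left (hmem i)
  | succ k ih =>
    rcases eq_or_eq_rev i p.final with rfl | rfl
    · rw [span_active_final_sup 𝕜, mem_map_pull_iff] at hf ⊢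
      rw [active_rev_final, map_mul, lastEquiv_last, Ideal.mem_map_C_iff] at hf
      exact Ideal.mem_map_C_iff.2 fun n => by simpa [Polynomial.coeff_X_mul] using hf (n + 1)
    · rw [span_active_rev_final_sup 𝕜, mem_span_last_sup_map_pull_iff] at hf ⊢
      rw [Fin.rev_rev, active_final, map_mul, lastEquiv_pull, Polynomial.coeff_C_mul] at hf
      exact ih p.trunc _ (by rwa [Fin.rev_rev])

end NodeIdeal

end Regularity

section Kernel

variable {𝕜 : Type u} [Field 𝕜] [CharZero 𝕜] {A : Type v} [CommRing A] [Algebra 𝕜 A] {k : ℕ}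
  {x : Fin 2 → A}

lemma OnHyperbola.ker_eq (hirr : ∀ i, (Ideal.span {x i}).IsPrime)
    (hmem : ∀ i, x (Fin.rev i) ∉ Ideal.span {x i}) {R : Type w} [CommRing R] [Algebra 𝕜 R]
    {p : Word k} {q : ChartPt 𝕜 A k R} (hq : OnHyperbola x p q)
    (hb : Function.Injective q.base) : RingHom.ker q = Ideal.span (posBinomials x k p) := by
  induction k with
  | zero =>
    refine le_antisymm (fun f hf => ?_) (Ideal.span_le.2 hq.2)
    obtain ⟨a, rfl⟩ := MvPolynomial.C_surjective (Fin 0) f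
    rw [RingHom.mem_ker, ← ChartPt.base_apply, map_eq_zero_iff _ hb] at hf
    simp [hf]
  | succ k ih =>
    obtain ⟨hproj, hlast⟩ := onHyperbola_succ.1 hq
    have hbase : Function.Injective q.proj.base := by
      rwa [show q.proj.base = q.base from AlgHom.ext fun a => by
        simp [ChartPt.base_apply, ChartPt.proj_apply]]
    have hker := ih hproj hbase
    have hu (i : Fin 2) := isUnit_weight 𝕜 (ChartRing A k) p.trunc i
    have heval := ker_eval₂RingHom_eq (φ := q.proj.toRingHom) (n := q (X (Fin.last k)))
      (r := weight k p.trunc p.final * active x k p.trunc p.final)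
      (d := weight k p.trunc (Fin.rev p.final) * active x k p.trunc (Fin.rev p.final))
      (by simpa [mul_assoc, mul_comm (q (X (Fin.last k)))] using hlast) fun f hf => by
        change _ ∈ _ ⊔ RingHom.ker q.proj at hf
        change _ ∈ _ ⊔ RingHom.ker q.proj
        rw [hker, Ideal.span_singleton_mul_left_unit (hu _)] at hf ⊢
        rw [mul_assoc, Ideal.unit_mul_mem_iff_mem _ (hu _)] at hf
        exact mem_of_active_mul_mem 𝕜 hirr hmem p.trunc _ hf
    ext f
    rw [RingHom.mem_ker, apply_eq_eval₂_lastEquiv, ← Polynomial.coe_eval₂RingHom,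
      ← RingHom.mem_ker, heval, mem_iff_lastEquiv_mem_map, span_posBinomials_succ, Ideal.map_sup,
      map_lastEquiv_map_pull, Ideal.map_span, Set.image_singleton, ← hker]
    change _ ↔ _ ∈ Ideal.span {lastEquiv A k (nodeBinomial x (k + 1) p)} ⊔ _
    rw [lastEquiv_nodeBinomial]
    rfl

end Kernel

section Family

variable {𝕜 : Type u} [Field 𝕜] {A : Type v} [CommRing A] [Algebra 𝕜 A] {k : ℕ} {x : Fin 2 → A}

lemma IsEtaleCoords.aeval_mem_nonZeroDivisors (hx : IsEtaleCoords 𝕜 x)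
    {g : MvPolynomial (Fin 2) 𝕜} (hg : g ≠ 0) : aeval x g ∈ nonZeroDivisors A := by
  algebraize [(aeval x : MvPolynomial (Fin 2) 𝕜 →ₐ[𝕜] A).toRingHom]
  have : Algebra.Etale (MvPolynomial (Fin 2) 𝕜) A := hx
  exact mem_nonZeroDivisors_iff_left.2 fun a ha =>
    (smul_eq_zero_iff_right hg).1 (show g • a = 0 from ha)

lemma IsEtaleCoords.aeval_mul_mem_nonZeroDivisors (hx : IsEtaleCoords 𝕜 x)
    {g : Polynomial 𝕜} (hg : g ≠ 0) : Polynomial.aeval (x 0 * x 1) g ∈ nonZeroDivisors A := by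
  have hcomp : (aeval (R := 𝕜) ![Polynomial.X, 1]) (Polynomial.aeval (X 0 * X 1) g) = g := by
    simp [← Polynomial.aeval_algHom_apply]
  have hne : Polynomial.aeval (X 0 * X 1 : MvPolynomial (Fin 2) 𝕜) g ≠ 0 := fun h0 =>
    hg (by rw [← hcomp, h0, map_zero])
  simpa [← Polynomial.aeval_algHom_apply] using hx.aeval_mem_nonZeroDivisors hne

variable [CharZero 𝕜]

lemma IsEtaleCoords.exists_generic (hx : IsEtaleCoords 𝕜 x) (p : Word k) :
    ∃ q : ChartPt 𝕜 A k (Localization.Away (x 0 * x 1)),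
      OnHyperbola x p q ∧ q.base = IsScalarTower.toAlgHom 𝕜 A _ ∧ Function.Injective q.base := by
  obtain ⟨q, hb, hq⟩ := exists_onHyperbola (x := x) p
    (IsScalarTower.toAlgHom 𝕜 A (Localization.Away (x 0 * x 1)))
    (IsLocalization.Away.algebraMap_isUnit (S := Localization.Away (x 0 * x 1)) (x 0 * x 1))
  refine ⟨q, hq, hb, ?_⟩
  rw [hb]
  refine IsLocalization.injective (M := .powers (x 0 * x 1)) _ (Submonoid.powers_le.2 ?_)
  simpa using hx.aeval_mul_mem_nonZeroDivisors Polynomial.X_ne_zero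

variable [IsAlgClosed 𝕜]

lemma mem_familyIdeal_iff (hx : IsEtaleCoords 𝕜 x) {o : A →ₐ[𝕜] 𝕜} (ho : ∀ i, o (x i) = 0)
    (hirr : ∀ i, (Ideal.span {x i}).IsPrime) {p : Word k} {F : Polynomial (ChartRing A k)} :
    F ∈ familyIdeal 𝕜 x p ↔ F.eval (C (x 0 * x 1)) ∈ Ideal.span (posBinomials x k p) := by
  rw [mem_familyIdeal hx]
  refine ⟨fun h => ?_, fun h q hq => (Ideal.span_le (I := RingHom.ker q)).2 hq.2 h⟩
  have := hx.finiteType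
  have := hx.isReduced
  have : IsReduced (Localization.Away (x 0 * x 1)) :=
    inferInstanceAs (IsReduced (Localization (Submonoid.powers (x 0 * x 1))))
  have : Algebra.FiniteType A (Localization.Away (x 0 * x 1)) :=
    IsLocalization.finiteType_of_monoid_fg (Submonoid.powers (x 0 * x 1)) _
  have : Algebra.FiniteType 𝕜 (Localization.Away (x 0 * x 1)) :=
    Algebra.FiniteType.trans (S := A) inferInstance inferInstance
  obtain ⟨q, hq, -, hb⟩ := hx.exists_generic p
  rw [← hq.ker_eq hirr (fun i => hx.notMem_span_singleton ho (rev_ne i)) hb]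
  exact eq_zero_of_forall_point (𝕜 := 𝕜) fun r => h (r.comp q) (hq.map r)

lemma centralIdeal_eq (hx : IsEtaleCoords 𝕜 x) {o : A →ₐ[𝕜] 𝕜} (ho : ∀ i, o (x i) = 0)
    (hirr : ∀ i, (Ideal.span {x i}).IsPrime) (p : Word k) :
    centralIdeal 𝕜 x p = Ideal.span (nodeBinomials x k p) := by
  rw [nodeBinomials_eq_insert, centralIdeal]
  refine le_antisymm (Ideal.map_le_iff_le_comap.2 fun F hF => ?_)
    (Ideal.span_le.2 (Set.insert_subset ?_ fun g hg => ?_))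
  · rw [mem_familyIdeal_iff hx ho hirr] at hF
    obtain ⟨c, hc⟩ := Polynomial.sub_dvd_eval_sub (C (x 0 * x 1)) 0 F
    rw [Ideal.mem_comap, Polynomial.coe_evalRingHom, Ideal.mem_span_insert]
    exact ⟨-c, _, hF, by linear_combination -hc⟩
  · have h : Polynomial.C (C (x 0 * x 1)) - Polynomial.X ∈ familyIdeal 𝕜 x p := by
      rw [mem_familyIdeal_iff hx ho hirr]
      simp
    simpa using Ideal.mem_map_of_mem (Polynomial.evalRingHom 0) h
  · have h : Polynomial.C g ∈ familyIdeal 𝕜 x p := by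
      rw [mem_familyIdeal_iff hx ho hirr, Polynomial.eval_C]
      exact Ideal.subset_span hg
    simpa using Ideal.mem_map_of_mem (Polynomial.evalRingHom 0) h

lemma flat_of_forall_mul_eq_zero {R S : Type*} [CommRing R] [IsDedekindDomain R]
    [CommRing S] (f : R →+* S) (h : ∀ r s, r ≠ 0 → f r * s = 0 → s = 0) : f.Flat := by
  let : Algebra R S := f.toAlgebra
  change Module.Flat R S
  rw [IsDedekindDomain.flat_iff_torsion_eq_bot, eq_bot_iff]
  rintro s ⟨⟨r, hr⟩, hrs⟩
  exact h r s (nonZeroDivisors.ne_zero hr) hrs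

lemma mem_familyIdeal_of_map_mul_mem (hx : IsEtaleCoords 𝕜 x) {o : A →ₐ[𝕜] 𝕜}
    (ho : ∀ i, o (x i) = 0) (hirr : ∀ i, (Ideal.span {x i}).IsPrime) {p : Word k}
    {g : Polynomial 𝕜} (hg : g ≠ 0) {F : Polynomial (ChartRing A k)}
    (h : g.map (algebraMap 𝕜 (ChartRing A k)) * F ∈ familyIdeal 𝕜 x p) :
    F ∈ familyIdeal 𝕜 x p := by
  obtain ⟨q, hq, hbase, hb⟩ := hx.exists_generic p
  have hker := hq.ker_eq hirr (fun i => hx.notMem_span_singleton ho (rev_ne i)) hb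
  have heval : (g.map (algebraMap 𝕜 (ChartRing A k))).eval (C (x 0 * x 1)) =
      C (Polynomial.aeval (x 0 * x 1) g) := by
    rw [Polynomial.eval_map, ← Polynomial.aeval_def, ← MvPolynomial.algebraMap_eq,
      Polynomial.aeval_algebraMap_apply]
  rw [mem_familyIdeal_iff hx ho hirr, ← hker, RingHom.mem_ker] at h ⊢
  rw [Polynomial.eval_mul, heval, map_mul, ← ChartPt.base_apply, hbase] at h
  have hreg : algebraMap A (Localization.Away (x 0 * x 1)) (Polynomial.aeval (x 0 * x 1) g) ∈
      nonZeroDivisors (Localization.Away (x 0 * x 1)) :=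
    IsLocalization.map_nonZeroDivisors_le (Submonoid.powers (x 0 * x 1)) _
      (Submonoid.mem_map_of_mem _ (hx.aeval_mul_mem_nonZeroDivisors hg))
  exact mem_nonZeroDivisors_iff_left.1 hreg _ h

lemma flat_familyMap (hx : IsEtaleCoords 𝕜 x) {o : A →ₐ[𝕜] 𝕜} (ho : ∀ i, o (x i) = 0)
    (hirr : ∀ i, (Ideal.span {x i}).IsPrime) (p : Word k) :
    RingHom.Flat (R := Polynomial 𝕜) (S := Polynomial (ChartRing A k) ⧸ familyIdeal 𝕜 x p)
      (familyMap 𝕜 x p) := by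
  refine flat_of_forall_mul_eq_zero (R := Polynomial 𝕜)
    (S := Polynomial (ChartRing A k) ⧸ familyIdeal 𝕜 x p) (familyMap 𝕜 x p) fun g F hg h => ?_
  obtain ⟨F, rfl⟩ := Ideal.Quotient.mk_surjective F
  refine Ideal.Quotient.eq_zero_iff_mem.2 (mem_familyIdeal_of_map_mul_mem hx ho hirr hg ?_)
  rw [← Ideal.Quotient.eq_zero_iff_mem, map_mul]
  exact h

end Family

/-! ### Axes of the charts -/

section Coordinates

variable {A : Type v} [CommRing A] {k : ℕ} {x : Fin 2 → A}

lemma pull_ne_last [Nontrivial A] (f : ChartRing A k) : pull k f ≠ X (Fin.last k) := fun h =>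
  Polynomial.X_ne_C f <| by rw [← lastEquiv_last, ← h, lastEquiv_pull]

lemma coords_zero (x : Fin 2 → A) : coords x 0 = C '' Set.range x := by
  simp [coords, ← Set.range_comp, Function.comp_def]

lemma coords_succ (x : Fin 2 → A) (k : ℕ) :
    coords x (k + 1) = insert (X (Fin.last k)) (pull k '' coords x k) := by
  ext f
  simp only [coords, Set.mem_union, Set.mem_range, Set.mem_insert_iff, Set.mem_image,
    Fin.exists_fin_succ']
  aesop

lemma active_mem_coords (p : Word k) (i : Fin 2) : active x k p i ∈ coords x k := by
  induction k generalizing i with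
  | zero => exact Or.inl ⟨i, rfl⟩
  | succ k ih =>
    rw [coords_succ]
    revert i
    rw [forall_iff_and_rev p.final, active_final, active_rev_final]
    exact ⟨Or.inr ⟨_, ih _ _, rfl⟩, Or.inl rfl⟩

lemma active_injective [Nontrivial A] (hinj : Function.Injective x) (p : Word k) :
    Function.Injective (active x k p) := by
  suffices h : ∀ i, active x k p (Fin.rev i) ≠ active x k p i from fun i j hij =>
    (eq_or_eq_rev i j).resolve_right fun hj => h j (hj ▸ hij)
  cases k with
  | zero => exact fun i h => hinj.ne (rev_ne i) (MvPolynomial.C_injective _ _ h)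
  | succ k =>
    rw [forall_iff_and_rev p.final, Fin.rev_rev, active_final, active_rev_final]
    exact ⟨(pull_ne_last _).symm, pull_ne_last _⟩

lemma coords_diff_zero (hinj : Function.Injective x) (p : Word 0) (i : Fin 2) :
    coords x 0 \ {active x 0 p i} = {C (x (Fin.rev i))} := by
  have hrange : Set.range x = {x i, x (Fin.rev i)} := by
    rw [← Set.image_pair, ← Set.image_univ]
    congr 1
    ext j
    simpa using eq_or_eq_rev j i
  rw [coords_zero, hrange, Set.image_pair]
  refine Set.insert_sdiff_self_of_notMem fun h => ?_
  exact hinj.ne (rev_ne i) (MvPolynomial.C_injective _ _ (Set.mem_singleton_iff.1 h).symm)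

lemma coords_diff_final [Nontrivial A] (p : Word (k + 1)) :
    coords x (k + 1) \ {active x (k + 1) p p.final} =
      insert (X (Fin.last k)) (pull k '' (coords x k \ {active x k p.trunc p.final})) := by
  rw [active_final, coords_succ, Set.insert_sdiff_of_notMem _ (fun h => pull_ne_last _ h.symm),
    Set.image_sdiff pull_injective, Set.image_singleton]

lemma coords_diff_rev_final [Nontrivial A] (p : Word (k + 1)) :
    coords x (k + 1) \ {active x (k + 1) p (Fin.rev p.final)} = pull k '' coords x k := by
  rw [active_rev_final, coords_succ, Set.insert_sdiff_self_of_notMem]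
  rintro ⟨f, -, hf⟩
  exact pull_ne_last f hf

lemma isPrime_map_pull {I : Ideal (ChartRing A k)} (hI : I.IsPrime) : (I.map (pull k)).IsPrime := by
  have h : I.map (pull k) = (I.map Polynomial.C).comap (lastEquiv A k) :=
    Ideal.ext fun _ => mem_map_pull_iff
  rw [h]
  exact Ideal.IsPrime.comap _

lemma isPrime_span_last_sup_map_pull {I : Ideal (ChartRing A k)} (hI : I.IsPrime) :
    (Ideal.span {X (Fin.last k)} ⊔ I.map (pull k)).IsPrime := by
  have h : Ideal.span {X (Fin.last k)} ⊔ I.map (pull k) =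
      I.comap (Polynomial.constantCoeff.comp (lastEquiv A k : ChartRing A (k + 1) →+* _)) :=
    Ideal.ext fun _ => mem_span_last_sup_map_pull_iff
  rw [h]
  exact Ideal.IsPrime.comap _

lemma isPrime_map_C_of_isEmpty {σ : Type*} [IsEmpty σ] {I : Ideal A} [I.IsPrime] :
    (I.map (C : A →+* MvPolynomial σ A)).IsPrime :=
  Ideal.map_isPrime_of_equiv (MvPolynomial.isEmptyRingEquiv A σ).symm

variable {𝕜 : Type u} [Field 𝕜] [IsAlgClosed 𝕜] [Algebra 𝕜 A]

lemma isPrime_span_coords (hx : IsEtaleCoords 𝕜 x) {o : A →ₐ[𝕜] 𝕜}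
    (ho : ∀ b : A →ₐ[𝕜] 𝕜, (∀ i, b (x i) = 0) ↔ b = o) (k : ℕ) :
    (Ideal.span (coords x k)).IsPrime := by
  induction k with
  | zero =>
    rw [coords_zero, ← Ideal.map_span, ← hx.ker_eq_span_range ho]
    have := RingHom.ker_isPrime o
    exact isPrime_map_C_of_isEmpty
  | succ k ih =>
    rw [coords_succ, Ideal.span_insert, ← Ideal.map_span]
    exact isPrime_span_last_sup_map_pull ih

lemma isPrime_span_coords_diff (hx : IsEtaleCoords 𝕜 x) {o : A →ₐ[𝕜] 𝕜}
    (ho : ∀ b : A →ₐ[𝕜] 𝕜, (∀ i, b (x i) = 0) ↔ b = o) (hirr : ∀ i, (Ideal.span {x i}).IsPrime)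
    (p : Word k) (i : Fin 2) : (Ideal.span (coords x k \ {active x k p i})).IsPrime := by
  have : Nontrivial A := o.toRingHom.domain_nontrivial
  induction k generalizing i with
  | zero =>
    rw [coords_diff_zero hx.injective, ← Set.image_singleton, ← Ideal.map_span]
    have := hirr (Fin.rev i)
    exact isPrime_map_C_of_isEmpty
  | succ k ih =>
    rcases eq_or_eq_rev i p.final with rfl | rfl
    · rw [coords_diff_final, Ideal.span_insert, ← Ideal.map_span]
      exact isPrime_span_last_sup_map_pull (ih _ _)
    · rw [coords_diff_rev_final, ← Ideal.map_span]
      exact isPrime_map_pull (isPrime_span_coords hx ho k)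

lemma active_notMem_span_coords_diff (hx : IsEtaleCoords 𝕜 x) {o : A →ₐ[𝕜] 𝕜}
    (ho : ∀ b : A →ₐ[𝕜] 𝕜, (∀ i, b (x i) = 0) ↔ b = o) (p : Word k) (i : Fin 2) :
    active x k p i ∉ Ideal.span (coords x k \ {active x k p i}) := by
  have : Nontrivial A := o.toRingHom.domain_nontrivial
  induction k generalizing i with
  | zero =>
    rw [coords_diff_zero hx.injective, ← Set.image_singleton, ← Ideal.map_span, active,
      C_mem_map_C_iff]
    exact hx.notMem_span_singleton ((ho o).2 rfl) (rev_ne i).symm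
  | succ k ih =>
    rcases eq_or_eq_rev i p.final with rfl | rfl
    · rw [coords_diff_final, Ideal.span_insert, ← Ideal.map_span, active_final,
        mem_span_last_sup_map_pull_iff, lastEquiv_pull, Polynomial.coeff_C_zero]
      exact ih _ _
    · rw [coords_diff_rev_final, ← Ideal.map_span, active_rev_final, mem_map_pull_iff,
        lastEquiv_last, Ideal.mem_map_C_iff]
      intro h
      exact (isPrime_span_coords hx ho k).one_notMem (by simpa using h 1)

end Coordinates

section Axes

variable {𝕜 : Type u} [Field 𝕜] {A : Type v} [CommRing A] [Algebra 𝕜 A] {k : ℕ} {x : Fin 2 → A}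
  {R : Type w} [CommRing R] [Algebra 𝕜 R]

/-- The axis of the active coordinate with index `i` in the chart `C(p)`: the points at which all
other coordinate functions vanish. -/
def axis (x : Fin 2 → A) (p : Word k) (i : Fin 2) : Set (ChartPt 𝕜 A k R) :=
  {q | ∀ c ∈ coords x k \ {active x k p i}, q c = 0}

/-- The point `q` is the origin of its chart. -/
def IsOrigin (x : Fin 2 → A) (q : ChartPt 𝕜 A k R) : Prop :=
  ∀ c ∈ coords x k, q c = 0

lemma IsOrigin.mem_axis {q : ChartPt 𝕜 A k R} (h : IsOrigin x q) (p : Word k) (i : Fin 2) :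
    q ∈ axis x p i := fun c hc => h c hc.1

lemma isOrigin_iff_mem_axis {p : Word k} {i : Fin 2} {q : ChartPt 𝕜 A k R} :
    IsOrigin x q ↔ q ∈ axis x p i ∧ q (active x k p i) = 0 := by
  refine ⟨fun h => ⟨h.mem_axis p i, h _ (active_mem_coords p i)⟩, fun h c hc => ?_⟩
  by_cases hci : c = active x k p i
  · rw [hci, h.2]
  · exact h.1 c ⟨hc, hci⟩

lemma mem_axis_zero (hinj : Function.Injective x) {p : Word 0} {i : Fin 2}
    {q : ChartPt 𝕜 A 0 R} : q ∈ axis x p i ↔ q (C (x (Fin.rev i))) = 0 := by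
  rw [axis, Set.mem_ofPred_eq, coords_diff_zero hinj]
  exact forall_eq

section Succ

variable [Nontrivial A] {p : Word (k + 1)} {q : ChartPt 𝕜 A (k + 1) R}

lemma mem_axis_final :
    q ∈ axis x p p.final ↔ q.proj ∈ axis x p.trunc p.final ∧ q (X (Fin.last k)) = 0 := by
  rw [axis, Set.mem_ofPred_eq, coords_diff_final, Set.forall_mem_insert, Set.forall_mem_image,
    and_comm]
  rfl

lemma mem_axis_rev_final : q ∈ axis x p (Fin.rev p.final) ↔ IsOrigin x q.proj := by
  rw [axis, Set.mem_ofPred_eq, coords_diff_rev_final, Set.forall_mem_image]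
  rfl

end Succ

lemma active_rev_eq_zero [Nontrivial A] (hinj : Function.Injective x) {p : Word k}
    {i : Fin 2} {q : ChartPt 𝕜 A k R} (h : q ∈ axis x p i) :
    q (active x k p (Fin.rev i)) = 0 :=
  h _ ⟨active_mem_coords p _, (active_injective hinj p).ne (rev_ne i)⟩

lemma isOrigin_iff_mem_axis_and_mem_axis_rev [Nontrivial A] (hinj : Function.Injective x)
    {p : Word k} {i : Fin 2} {q : ChartPt 𝕜 A k R} :
    IsOrigin x q ↔ q ∈ axis x p i ∧ q ∈ axis x p (Fin.rev i) := by
  refine ⟨fun h => ⟨h.mem_axis _ _, h.mem_axis _ _⟩, fun h => ?_⟩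
  exact isOrigin_iff_mem_axis.2 ⟨h.1, by simpa using active_rev_eq_zero hinj h.2⟩

lemma nodeBinomial_eq_zero_iff_of_mem_axis_final [CharZero 𝕜] [Nontrivial A]
    (hinj : Function.Injective x) {p : Word (k + 1)} {q : ChartPt 𝕜 A (k + 1) 𝕜}
    (h : q.proj ∈ axis x p.trunc p.final) :
    q (nodeBinomial x (k + 1) p) = 0 ↔ q ∈ axis x p p.final ∨ q ∈ axis x p (Fin.rev p.final) := by
  rw [mem_axis_final, mem_axis_rev_final, isOrigin_iff_mem_axis (i := p.final),
    and_iff_right h, and_iff_right h, nodeBinomial_succ]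
  simp [← ChartPt.proj_apply, active_rev_eq_zero hinj h, (weight_pos p.trunc p.final).ne']

lemma nodeBinomial_eq_zero_iff_of_mem_axis_rev_final [CharZero 𝕜] [Nontrivial A]
    (hinj : Function.Injective x) {p : Word (k + 1)} {q : ChartPt 𝕜 A (k + 1) 𝕜}
    (h : q.proj ∈ axis x p.trunc (Fin.rev p.final)) :
    q (nodeBinomial x (k + 1) p) = 0 ↔ q ∈ axis x p (Fin.rev p.final) := by
  have hfinal : q.proj (active x k p.trunc p.final) = 0 := by
    simpa using active_rev_eq_zero hinj h
  rw [mem_axis_rev_final, isOrigin_iff_mem_axis (i := Fin.rev p.final), and_iff_right h,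
    nodeBinomial_succ]
  simp [← ChartPt.proj_apply, hfinal, (weight_pos p.trunc _).ne']

lemma forall_nodeBinomials_iff_exists_mem_axis [CharZero 𝕜] [Nontrivial A]
    (hinj : Function.Injective x) {p : Word k} {q : ChartPt 𝕜 A k 𝕜} :
    (∀ f ∈ nodeBinomials x k p, q f = 0) ↔ ∃ i, q ∈ axis x p i := by
  induction k with
  | zero =>
    simp only [mem_axis_zero hinj, nodeBinomials, nodeBinomial, Set.mem_singleton_iff, forall_eq,
      map_mul, mul_eq_zero]
    rw [exists_iff_or_rev (0 : Fin 2), or_comm]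
    rfl
  | succ k ih =>
    rw [nodeBinomials, Set.forall_mem_insert, Set.forall_mem_image]
    simp only [← ChartPt.proj_apply]
    rw [ih, exists_iff_or_rev p.final, exists_iff_or_rev p.final]
    constructor
    · rintro ⟨h, hfinal | hrev⟩
      · exact (nodeBinomial_eq_zero_iff_of_mem_axis_final hinj hfinal).1 h
      · exact Or.inr ((nodeBinomial_eq_zero_iff_of_mem_axis_rev_final hinj hrev).1 h)
    · intro h
      have hproj : q.proj ∈ axis x p.trunc p.final :=
        h.elim (fun h => (mem_axis_final.1 h).1) fun h => (mem_axis_rev_final.1 h).mem_axis _ _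
      exact ⟨(nodeBinomial_eq_zero_iff_of_mem_axis_final hinj hproj).2 h, Or.inl hproj⟩

lemma isFocal_of_mem_axis [Nontrivial A] (hinj : Function.Injective x) {p : Word k}
    {i : Fin 2} {τ : ChartPt 𝕜 A k (DualNumber R)} (h : τ ∈ axis x p i) : IsFocal x k p τ := by
  induction k generalizing i with
  | zero => exact isFocal_zero _ _ _
  | succ k ih =>
    rw [isFocal_succ]
    rcases eq_or_eq_rev i p.final with rfl | rfl
    · rw [mem_axis_final] at h
      refine ⟨ih h.1, ?_⟩
      rw [ChartPt.diff_def, active_rev_eq_zero hinj h.1, ChartPt.foot_apply, h.2]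
      simp
    · rw [mem_axis_rev_final] at h
      refine ⟨ih (h.mem_axis _ 0), ?_⟩
      rw [ChartPt.diff_def, ChartPt.diff_def, h _ (active_mem_coords _ _),
        h _ (active_mem_coords _ _)]
      simp

lemma mem_axis_of_isFocal [Nontrivial A] (hinj : Function.Injective x) {p : Word k}
    {i : Fin 2} {τ : ChartPt 𝕜 A k (DualNumber R)} (h : IsFocal x k p τ)
    (hfoot : τ.foot ∈ axis x p i) (hdiff : τ.diff (active x k p (Fin.rev i)) = 0) :
    τ ∈ axis x p i := by
  induction k generalizing i with
  | zero =>
    rw [mem_axis_zero hinj] at hfoot ⊢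
    exact TrivSqZeroExt.ext hfoot hdiff
  | succ k ih =>
    rw [isFocal_succ] at h
    rcases eq_or_eq_rev i p.final with rfl | rfl
    · rw [mem_axis_final] at hfoot ⊢
      rw [active_rev_final] at hdiff
      exact ⟨ih h.1 hfoot.1 (by rw [h.2, hfoot.2, zero_mul]), TrivSqZeroExt.ext hfoot.2 hdiff⟩
    · rw [mem_axis_rev_final] at hfoot ⊢
      rw [Fin.rev_rev, active_final, ← ChartPt.diff_proj] at hdiff
      refine isOrigin_iff_mem_axis.2 ⟨ih h.1 (i := p.final) (IsOrigin.mem_axis hfoot _ _) ?_, ?_⟩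
      · rw [h.2, hdiff, mul_zero]
      · exact TrivSqZeroExt.ext (hfoot _ (active_mem_coords _ _)) hdiff

lemma mem_axis_of_mem_line [Nontrivial A] (hinj : Function.Injective x) {p : Word (k + 1)}
    {q : ChartPt 𝕜 A (k + 1) R} {τ : ChartPt 𝕜 A k (DualNumber R)} (hτ : τ ∈ line x p q)
    (hq : q ∈ axis x p p.final) : τ ∈ axis x p.trunc p.final := by
  rw [mem_axis_final] at hq
  exact mem_axis_of_isFocal hinj hτ.2.1 (hτ.1 ▸ hq.1) (by rw [hτ.2.2, hq.2, zero_mul])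

section Tangent

variable [IsAlgClosed 𝕜] (hx : IsEtaleCoords 𝕜 x) {o : A →ₐ[𝕜] 𝕜}
  (ho : ∀ b : A →ₐ[𝕜] 𝕜, (∀ i, b (x i) = 0) ↔ b = o) (hirr : ∀ i, (Ideal.span {x i}).IsPrime)
  {i : Fin 2} {Z : Set (Space 𝕜 x k)}

include hx ho hirr

lemma mem_span_coords_diff_iff {p : Word k} {f : ChartRing A k} :
    f ∈ Ideal.span (coords x k \ {active x k p i}) ↔
      ∀ q : ChartPt 𝕜 A k 𝕜, q ∈ axis x p i → q f = 0 := by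
  have := hx.finiteType
  have : Algebra.FiniteType 𝕜 (ChartRing A k) :=
    Algebra.FiniteType.trans (S := A) inferInstance inferInstance
  refine ⟨fun h q hq => (Ideal.span_le (I := RingHom.ker q)).2 hq h, fun h => ?_⟩
  refine mem_of_forall_point (𝕜 := 𝕜) (isPrime_span_coords_diff hx ho hirr p i).isRadical
    fun q hq => h q fun c hc => ?_
  exact hq c (Ideal.subset_span hc)

lemma idealOf_of_inChart_eq_axis {p : Word k} (hZ : inChart p Z = axis x p i) :
    idealOf p Z = Ideal.span (coords x k \ {active x k p i}) := by
  ext f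
  rw [mem_idealOf, hZ, mem_span_coords_diff_iff hx ho hirr]

lemma tangentSpace_of_inChart_eq_axis {p : Word k} (hZ : inChart p Z = axis x p i)
    {z : ChartPt 𝕜 A k 𝕜} (hz : z ∈ axis x p i) :
    tangentSpace p Z z =
      {τ | τ.foot = z ∧ IsFocal x k p τ ∧ τ.diff (active x k p (Fin.rev i)) = 0} := by
  have : Nontrivial A := o.toRingHom.domain_nontrivial
  have hinj : Function.Injective x := hx.injective
  ext τ
  rw [mem_tangentSpace, idealOf_of_inChart_eq_axis hx ho hirr hZ]
  constructor
  · rintro ⟨hfoot, h⟩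
    have hτ : τ ∈ axis x p i := fun c hc => h c (Ideal.subset_span hc)
    refine ⟨hfoot, isFocal_of_mem_axis hinj hτ, ?_⟩
    rw [ChartPt.diff_def, active_rev_eq_zero hinj hτ]
    rfl
  · rintro ⟨hfoot, hfocal, hdiff⟩
    have hτ : τ ∈ axis x p i := mem_axis_of_isFocal hinj hfocal (hfoot ▸ hz) hdiff
    exact ⟨hfoot, fun f hf => (Ideal.span_le (I := RingHom.ker τ)).2 hτ hf⟩

lemma tangentSpace_eq_line_iff {p : Word (k + 1)} (hZ : inChart p.trunc Z = axis x p.trunc i)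
    {q : ChartPt 𝕜 A (k + 1) 𝕜} (hq : q.proj ∈ axis x p.trunc i) :
    tangentSpace p.trunc Z q.proj = line x p q ↔ p.final = i ∧ q (X (Fin.last k)) = 0 := by
  rw [tangentSpace_of_inChart_eq_axis hx ho hirr hZ hq]
  constructor
  · intro h
    obtain ⟨τ, hτ, hdiff⟩ := exists_generator hx p q
    have hrev : τ.diff (active x k p.trunc (Fin.rev i)) = 0 := (h.symm ▸ hτ :).2.2
    rcases eq_or_eq_rev i p.final with rfl | rfl
    · exact ⟨rfl, by rw [← hrev, hτ.2.2, hdiff, mul_one]⟩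
    · rw [Fin.rev_rev, hdiff] at hrev
      exact absurd hrev one_ne_zero
  · rintro ⟨rfl, hlast⟩
    ext τ
    rw [mem_line, hlast, zero_mul]
    rfl

end Tangent

lemma samePoint_of_last_mul_last_eq_one (hx : IsEtaleCoords 𝕜 x) {p p' : Word (k + 1)}
    (htrunc : p.trunc = p'.trunc) (hfinal : p'.final = Fin.rev p.final)
    {q q' : ChartPt 𝕜 A (k + 1) R} (hproj : q.proj = q'.proj)
    (h : q (X (Fin.last k)) * q' (X (Fin.last k)) = 1) : SamePoint x (k + 1) R p q p' q' := by
  obtain ⟨τ, hτ, hdiff⟩ := exists_generator hx p q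
  have hdiff' : τ.diff (active x k p'.trunc p'.final) = q (X (Fin.last k)) := by
    rw [hfinal, ← htrunc, hτ.2.2, hdiff, mul_one]
  have hτ' : τ ∈ line x p' q' := by
    refine ⟨hτ.1.trans hproj, htrunc ▸ hτ.2.1, ?_⟩
    rw [hdiff', hfinal, Fin.rev_rev, ← htrunc, hdiff, mul_comm, h]
  rw [samePoint_succ, ← hproj, ← htrunc]
  refine ⟨.refl hx _ _, τ, hτ, τ, hτ', by simp [hdiff], ?_, .refl hx _ _⟩
  rw [htrunc, hdiff']
  exact IsUnit.of_mul_eq_one _ h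

-- The curve `(s, s⁻¹)` has the derivative `(1, -s⁻²)`.
lemma dualNumber_mul_eq_one {a b : DualNumber R} (hfst : a.fst * b.fst = 1) (ha : a.snd = 1)
    (hb : b.snd = -(b.fst * b.fst)) : a * b = 1 := by
  refine TrivSqZeroExt.ext (by simpa using hfst) ?_
  simp only [TrivSqZeroExt.snd_mul, ha, hb, smul_eq_mul, MulOpposite.smul_eq_mul_unop,
    MulOpposite.unop_op, TrivSqZeroExt.snd_one]
  linear_combination (-b.fst) * hfst

lemma samePoint_of_mem_axis_final [Nontrivial A] (hx : IsEtaleCoords 𝕜 x)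
    {p p' : Word (k + 1)} {q q' : ChartPt 𝕜 A (k + 1) R}
    (ih : ∀ (S : Type w) [CommRing S] [Algebra 𝕜 S] (z z' : ChartPt 𝕜 A k S),
      z ∈ axis x p.trunc p.final → z' ∈ axis x p'.trunc p'.final →
      z (active x k p.trunc p.final) * z' (active x k p'.trunc p'.final) = 1 →
      SamePoint x k S p.trunc z p'.trunc z')
    (hq : q ∈ axis x p p.final) (hq' : q' ∈ axis x p' p'.final)
    (h : q (active x (k + 1) p p.final) * q' (active x (k + 1) p' p'.final) = 1) :
    SamePoint x (k + 1) R p q p' q' := by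
  have hinj : Function.Injective x := hx.injective
  rw [active_final, active_final, ← ChartPt.proj_apply, ← ChartPt.proj_apply] at h
  obtain ⟨τ, hτ, hdiff⟩ := exists_generator hx p q
  obtain ⟨σ, hσ, hdiffσ⟩ := exists_generator hx p' q'
  set u := q'.proj (active x k p'.trunc p'.final)
  have hu : IsUnit u := IsUnit.of_mul_eq_one_right _ h
  set τ' := σ.tmap (AlgHom.id 𝕜 R) (-(u * u)) with hτ'_def
  have hτ' : τ' ∈ line x p' q' := smul_mem_line hσ _
  have hdiff' : τ'.diff (active x k p'.trunc p'.final) = -(u * u) := by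
    rw [hτ'_def, ChartPt.diff_tmap, hdiffσ, map_one, mul_one]
  have hinv : τ (active x k p.trunc p.final) * τ' (active x k p'.trunc p'.final) = 1 := by
    have hfst : (τ' (active x k p'.trunc p'.final)).fst = u := AlgHom.congr_fun hτ'.1 _
    refine dualNumber_mul_eq_one ?_ hdiff (hfst ▸ hdiff')
    rw [hfst, ← h, ← hτ.1]
    rfl
  rw [samePoint_succ]
  refine ⟨ih R _ _ (mem_axis_final.1 hq).1 (mem_axis_final.1 hq').1 h, τ, hτ, τ', hτ',
    by simp [hdiff], hdiff' ▸ (hu.mul hu).neg, ?_⟩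
  exact ih _ _ _ (mem_axis_of_mem_line hinj hτ hq) (mem_axis_of_mem_line hinj hτ' hq') hinv

/-- The axis with index `i` of the chart `C(p)` lies over the point `o` of `U`: at some level it was
created as a fibre, and it has been prolonged since. -/
def IsInterior : (k : ℕ) → Word k → Fin 2 → Prop
  | 0, _, _ => False
  | k + 1, p, i => i = p.final → IsInterior k p.trunc i

lemma isOrigin_aevalTower {o : A →ₐ[𝕜] 𝕜} (ho : ∀ i, o (x i) = 0) :
    IsOrigin x (MvPolynomial.aevalTower o 0 : ChartPt 𝕜 A k 𝕜) := by
  rintro _ (⟨i, rfl⟩ | ⟨j, rfl⟩)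
  · simpa using ho i
  · simp

lemma IsOrigin.eq [IsAlgClosed 𝕜] (hx : IsEtaleCoords 𝕜 x) {o : A →ₐ[𝕜] 𝕜}
    (ho : ∀ b : A →ₐ[𝕜] 𝕜, (∀ i, b (x i) = 0) ↔ b = o) {z z' : ChartPt 𝕜 A k R}
    (hz : IsOrigin x z) (hz' : IsOrigin x z') : z = z' := by
  have hbase {z : ChartPt 𝕜 A k R} (hz : IsOrigin x z) (a : A) :
      z (C a) = algebraMap 𝕜 R (o a) := by
    have hker : a - algebraMap 𝕜 A (o a) ∈ Ideal.span (Set.range x) := by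
      rw [← hx.ker_eq_span_range ho]
      simp [RingHom.mem_ker]
    have hle : Ideal.span (Set.range x) ≤ RingHom.ker z.base := by
      rw [Ideal.span_le]
      rintro _ ⟨i, rfl⟩
      exact hz _ (Or.inl ⟨i, rfl⟩)
    have h : z.base (a - algebraMap 𝕜 A (o a)) = 0 := hle hker
    rwa [map_sub, AlgHom.commutes, sub_eq_zero] at h
  refine ChartPt.ext_coords (fun a => by rw [hbase hz, hbase hz']) fun j => ?_
  rw [hz _ (Or.inr ⟨j, rfl⟩), hz' _ (Or.inr ⟨j, rfl⟩)]

lemma exists_mem_axis [Nontrivial A] {o : A →ₐ[𝕜] 𝕜} (ho : ∀ i, o (x i) = 0) {p : Word k}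
    {i : Fin 2} (hi : IsInterior k p i) (c : R) :
    ∃ q : ChartPt 𝕜 A k R, q ∈ axis x p i ∧ q (active x k p i) = c := by
  induction k generalizing i with
  | zero => exact hi.elim
  | succ k ih =>
    rcases eq_or_eq_rev i p.final with rfl | rfl
    · obtain ⟨z, hz, hc⟩ := ih (hi rfl)
      refine ⟨z.extend 0, mem_axis_final.2 ⟨by rwa [ChartPt.proj_extend], by simp⟩, ?_⟩
      rw [active_final, ChartPt.extend_pull, hc]
    · refine ⟨ChartPt.extend ((Algebra.ofId 𝕜 R).comp (MvPolynomial.aevalTower o 0)) c,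
        mem_axis_rev_final.2 fun f hf => ?_, ?_⟩
      · rw [ChartPt.proj_extend, AlgHom.comp_apply, isOrigin_aevalTower ho f hf, map_zero]
      · rw [active_rev_final, ChartPt.extend_last]

lemma eq_of_mem_axis [IsAlgClosed 𝕜] [Nontrivial A] (hx : IsEtaleCoords 𝕜 x)
    {o : A →ₐ[𝕜] 𝕜} (ho : ∀ b : A →ₐ[𝕜] 𝕜, (∀ i, b (x i) = 0) ↔ b = o) {p : Word k}
    {i : Fin 2} (hi : IsInterior k p i) {q q' : ChartPt 𝕜 A k R} (hq : q ∈ axis x p i)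
    (hq' : q' ∈ axis x p i) (h : q (active x k p i) = q' (active x k p i)) : q = q' := by
  induction k generalizing i with
  | zero => exact hi.elim
  | succ k ih =>
    rcases eq_or_eq_rev i p.final with rfl | rfl
    · rw [mem_axis_final] at hq hq'
      rw [active_final] at h
      exact ChartPt.ext_succ (ih (hi rfl) hq.1 hq'.1 h) (hq.2.trans hq'.2.symm)
    · rw [mem_axis_rev_final] at hq hq'
      rw [active_rev_final] at h
      exact ChartPt.ext_succ (hq.eq hx ho hq') h

end Axes

/-! ### The chain of twigs -/

section Words

variable {k : ℕ}

lemma Word.ext_succ {p p' : Word (k + 1)} (htrunc : p.trunc = p'.trunc)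
    (hfinal : p.final = p'.final) : p = p' :=
  funext fun j => Fin.lastCases hfinal (fun j => congrFun htrunc j) j

lemma Word.exists_trunc_final_eq (p : Word k) (i : Fin 2) :
    ∃ p' : Word (k + 1), p'.trunc = p ∧ p'.final = i :=
  ⟨Fin.snoc (α := fun _ => Fin 2) p i, by funext j; simp [Word.trunc], by simp [Word.final]⟩

/-- The word of length `k` with number `n` in the lexicographic order, counted from `0`: its letters
are the `k` binary digits of `n`. -/
def chainWord : (k : ℕ) → ℕ → Word k
  | 0, _ => ![]
  | k + 1, n => Fin.snoc (α := fun _ => Fin 2) (chainWord k (n / 2)) (Fin.ofNat 2 n)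

@[simp] lemma trunc_chainWord (n : ℕ) :
    (chainWord (k + 1) n).trunc = chainWord k (n / 2) := by
  funext j
  simp [Word.trunc, chainWord]

@[simp] lemma final_chainWord (n : ℕ) : (chainWord (k + 1) n).final = Fin.ofNat 2 n := by
  simp [Word.final, chainWord]

lemma eq_chainWord_succ_iff {p : Word (k + 1)} {n : ℕ} :
    p = chainWord (k + 1) n ↔ p.trunc = chainWord k (n / 2) ∧ (p.final : ℕ) = n % 2 := by
  rw [← Fin.val_ofNat, ← Fin.ext_iff]
  refine ⟨?_, fun h => Word.ext_succ (by simpa using h.1) (by simpa using h.2)⟩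
  rintro rfl
  simp

lemma chainWord_injOn : Set.InjOn (chainWord k) (Set.Iio (2 ^ k)) := by
  induction k with
  | zero => intro a ha b hb _; simp_all
  | succ k ih =>
    intro a ha b hb h
    obtain ⟨htrunc, hfinal⟩ := eq_chainWord_succ_iff.1 h
    rw [trunc_chainWord] at htrunc
    rw [final_chainWord, Fin.val_ofNat] at hfinal
    simp only [Set.mem_Iio] at ha hb
    have hdiv : a / 2 = b / 2 :=
      ih (Set.mem_Iio.2 (by omega)) (Set.mem_Iio.2 (by omega)) htrunc
    omega

lemma exists_eq_chainWord (p : Word k) : ∃ n < 2 ^ k, p = chainWord k n := by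
  induction k with
  | zero => exact ⟨0, by simp, Subsingleton.elim _ _⟩
  | succ k ih =>
    obtain ⟨n, hn, h⟩ := ih p.trunc
    have hfinal := p.final.isLt
    refine ⟨2 * n + p.final, by omega, eq_chainWord_succ_iff.2 ⟨?_, by omega⟩⟩
    rw [h]
    congr 1
    omega

lemma toLex_chainWord_lt {a b : ℕ} (hb : b < 2 ^ k) (h : a < b) :
    toLex (chainWord k a) < toLex (chainWord k b) := by
  induction k generalizing a b with
  | zero => simp at hb; omega
  | succ k ih =>
    rcases (Nat.div_le_div_right h.le : a / 2 ≤ b / 2).lt_or_eq with hdiv | hdiv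
    · obtain ⟨i, hi, hlt⟩ := ih (by omega) hdiv
      refine ⟨i.castSucc, fun j hj => ?_, by simpa [chainWord] using hlt⟩
      obtain ⟨j, rfl⟩ := Fin.exists_castSucc_eq.2 (hj.trans_le (Fin.le_last _)).ne
      simpa [chainWord] using hi j (by simpa using hj)
    · refine ⟨Fin.last k, fun j hj => ?_, ?_⟩
      · obtain ⟨j, rfl⟩ := Fin.exists_castSucc_eq.2 hj.ne
        simp [chainWord, hdiv]
      · have hlt : (Fin.ofNat 2 a : Fin 2) < Fin.ofNat 2 b := by
          rw [Fin.lt_def, Fin.val_ofNat, Fin.val_ofNat]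
          omega
        simpa [chainWord] using hlt

/-- The numbering of the words of length `k` in lexicographic order. -/
noncomputable def chainOrderIso (k : ℕ) : Fin (2 ^ k) ≃o Lex (Word k) :=
  StrictMono.orderIsoOfSurjective (fun i => toLex (chainWord k i))
    (fun _ b h => toLex_chainWord_lt b.isLt h) fun p => by
      obtain ⟨n, hn, h⟩ := exists_eq_chainWord (ofLex p)
      exact ⟨⟨n, hn⟩, congrArg toLex h.symm⟩

@[simp] lemma ofLex_chainOrderIso (i : Fin (2 ^ k)) :
    ofLex (chainOrderIso k i) = chainWord k i := rfl

/-- The chart of the word `p` contains the twig with number `j`, as the axis of the active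
coordinate with index `i`: the word with number `n` sees the twigs `n` and `n + 1`. -/
def Carries (k j : ℕ) (p : Word k) (i : Fin 2) : Prop :=
  ∃ n < 2 ^ k, p = chainWord k n ∧ n + i = j

lemma carries_chainWord {n : ℕ} (hn : n < 2 ^ k) (i : Fin 2) :
    Carries k (n + i) (chainWord k n) i :=
  ⟨n, hn, rfl, rfl⟩

lemma carries_chainWord_iff {n j : ℕ} (hn : n < 2 ^ k) {i : Fin 2} :
    Carries k j (chainWord k n) i ↔ n + i = j := by
  refine ⟨?_, fun h => ⟨n, hn, rfl, h⟩⟩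
  rintro ⟨n', hn', h, rfl⟩
  rw [chainWord_injOn hn hn' h]

lemma exists_carries {j : ℕ} (hj : j ≤ 2 ^ k) : ∃ (p : Word k) (i : Fin 2), Carries k j p i := by
  rcases hj.lt_or_eq with hj | rfl
  · exact ⟨_, 0, carries_chainWord hj 0⟩
  · have h := carries_chainWord (Nat.sub_one_lt_of_lt (Nat.two_pow_pos k)) 1
    rw [Fin.val_one, Nat.sub_add_cancel Nat.one_le_two_pow] at h
    exact ⟨_, 1, h⟩

lemma Carries.index_unique {j : ℕ} {p : Word k} {i i' : Fin 2} (h : Carries k j p i)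
    (h' : Carries k j p i') : i = i' := by
  obtain ⟨n, hn, rfl, hj⟩ := h
  rw [carries_chainWord_iff hn] at h'
  omega

lemma Carries.word_unique {j : ℕ} {p p' : Word k} {i : Fin 2} (h : Carries k j p i)
    (h' : Carries k j p' i) : p = p' := by
  obtain ⟨n, -, rfl, hj⟩ := h
  obtain ⟨n', -, rfl, hj'⟩ := h'
  rw [show n = n' by omega]

lemma Carries.index_of_succ {j : ℕ} {p : Word k} {i i' : Fin 2} (h : Carries k j p i)
    (h' : Carries k (j + 1) p i') : i = 0 := by
  obtain ⟨n, hn, rfl, hj⟩ := h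
  rw [carries_chainWord_iff hn] at h'
  omega

lemma carries_zero {p : Word 0} {j : ℕ} {i : Fin 2} : Carries 0 j p i ↔ (i : ℕ) = j := by
  rw [Subsingleton.elim p (chainWord 0 0), carries_chainWord_iff (by simp), zero_add]

lemma carries_even {j : ℕ} {p : Word (k + 1)} {i : Fin 2} :
    Carries (k + 1) (2 * j) p i ↔ Carries k j p.trunc i ∧ p.final = i := by
  have hi := i.isLt
  constructor
  · rintro ⟨n, hn, hp, h⟩
    obtain ⟨htrunc, hfinal⟩ := eq_chainWord_succ_iff.1 hp
    exact ⟨⟨n / 2, by omega, htrunc, by omega⟩, Fin.ext (by omega)⟩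
  · rintro ⟨⟨n, hn, htrunc, h⟩, rfl⟩
    refine ⟨2 * n + p.final, by omega, eq_chainWord_succ_iff.2 ⟨?_, by omega⟩, by omega⟩
    rw [htrunc]
    congr 1
    omega

lemma carries_odd {j : ℕ} {p : Word (k + 1)} {i : Fin 2} :
    Carries (k + 1) (2 * j + 1) p i ↔
      j < 2 ^ k ∧ p.trunc = chainWord k j ∧ p.final = Fin.rev i := by
  have hi := i.isLt
  have hrev : (Fin.rev i : ℕ) + i = 1 := by rw [Fin.val_rev]; omega
  constructor
  · rintro ⟨n, hn, hp, h⟩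
    obtain ⟨htrunc, hfinal⟩ := eq_chainWord_succ_iff.1 hp
    refine ⟨by omega, ?_, Fin.ext (by omega)⟩
    rw [htrunc]
    congr 1
    omega
  · rintro ⟨hj, htrunc, hfinal⟩
    refine ⟨2 * j + Fin.rev i, by omega, eq_chainWord_succ_iff.2 ⟨?_, by omega⟩, by omega⟩
    rw [htrunc]
    congr 1
    omega

lemma not_carries_zero_rev {j : ℕ} {p p' : Word 0} {i : Fin 2} (h : Carries 0 j p i) :
    ¬ Carries 0 j p' (Fin.rev i) := fun h' =>
  rev_ne i (Fin.ext ((carries_zero.1 h').trans (carries_zero.1 h).symm))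

lemma Carries.isInterior {j : ℕ} {p p' : Word k} {i : Fin 2} (h : Carries k j p i)
    (h' : Carries k j p' (Fin.rev i)) : IsInterior k p i := by
  induction k generalizing j i with
  | zero => exact (not_carries_zero_rev h h').elim
  | succ k ih =>
    intro hfinal
    obtain ⟨m, rfl | rfl⟩ := j.even_or_odd'
    · exact ih (carries_even.1 h).1 (carries_even.1 h').1
    · exact (rev_ne i ((carries_odd.1 h).2.2.symm.trans hfinal.symm)).elim

end Words

section Twigs

variable {𝕜 : Type u} [Field 𝕜] {A : Type v} [CommRing A] [Algebra 𝕜 A] {k : ℕ} {x : Fin 2 → A}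

lemma samePoint_of_mem_axis_rev_final [IsAlgClosed 𝕜] [Nontrivial A] (hx : IsEtaleCoords 𝕜 x)
    {o : A →ₐ[𝕜] 𝕜} (ho : ∀ b : A →ₐ[𝕜] 𝕜, (∀ i, b (x i) = 0) ↔ b = o)
    {R : Type w} [CommRing R] [Algebra 𝕜 R] {p p' : Word (k + 1)}
    (htrunc : p.trunc = p'.trunc) (hfinal : p'.final = Fin.rev p.final)
    {q q' : ChartPt 𝕜 A (k + 1) R} (hq : q ∈ axis x p (Fin.rev p.final))
    (hq' : q' ∈ axis x p' (Fin.rev p'.final))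
    (h : q (active x (k + 1) p (Fin.rev p.final)) *
      q' (active x (k + 1) p' (Fin.rev p'.final)) = 1) :
    SamePoint x (k + 1) R p q p' q' := by
  rw [active_rev_final, active_rev_final] at h
  exact samePoint_of_last_mul_last_eq_one hx htrunc hfinal
    ((mem_axis_rev_final.1 hq).eq hx ho (mem_axis_rev_final.1 hq')) h

-- Both charts contain the twig; it is a projective line, and the two active coordinates on it are
-- inverse to each other.
lemma samePoint_of_carries [IsAlgClosed 𝕜] (hx : IsEtaleCoords 𝕜 x) {o : A →ₐ[𝕜] 𝕜}
    (ho : ∀ b : A →ₐ[𝕜] 𝕜, (∀ i, b (x i) = 0) ↔ b = o) {R : Type w} [CommRing R] [Algebra 𝕜 R]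
    {j : ℕ} {p p' : Word k} {i : Fin 2} (hc : Carries k j p i)
    (hc' : Carries k j p' (Fin.rev i)) {q q' : ChartPt 𝕜 A k R} (hq : q ∈ axis x p i)
    (hq' : q' ∈ axis x p' (Fin.rev i))
    (h : q (active x k p i) * q' (active x k p' (Fin.rev i)) = 1) : SamePoint x k R p q p' q' := by
  have : Nontrivial A := o.toRingHom.domain_nontrivial
  induction k generalizing R j i with
  | zero => exact (not_carries_zero_rev hc hc').elim
  | succ k ih =>
    obtain ⟨m, rfl | rfl⟩ := j.even_or_odd'
    · rw [carries_even] at hc hc'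
      obtain ⟨hc, rfl⟩ := hc
      obtain ⟨hc', hfinal⟩ := hc'
      rw [← hfinal] at hq' h
      refine samePoint_of_mem_axis_final hx (fun S _ _ z z' hz hz' hzz' => ?_) hq hq' h
      rw [hfinal] at hz' hzz'
      exact ih hc hc' hz hz' hzz'
    · rw [carries_odd] at hc hc'
      obtain ⟨-, htrunc, hfinal⟩ := hc
      obtain ⟨-, htrunc', hfinal'⟩ := hc'
      obtain rfl : i = Fin.rev p.final := by rw [hfinal, Fin.rev_rev]
      rw [Fin.rev_rev] at hfinal'
      rw [show Fin.rev (Fin.rev p.final) = Fin.rev p'.final by rw [hfinal']] at hq' h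
      exact samePoint_of_mem_axis_rev_final hx ho (htrunc.trans htrunc'.symm) hfinal' hq hq' h

lemma SamePoint.last_mul_last_eq_one {R : Type w} [CommRing R] [Algebra 𝕜 R] {p p' : Word (k + 1)}
    {q q' : ChartPt 𝕜 A (k + 1) R} (h : SamePoint x (k + 1) R p q p' q')
    (htrunc : p.trunc = p'.trunc) (hfinal : p'.final = Fin.rev p.final) :
    q (X (Fin.last k)) * q' (X (Fin.last k)) = 1 := by
  rw [samePoint_succ, ← htrunc] at h
  obtain ⟨-, τ, hτ, τ', hτ', hu, -, hs⟩ := h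
  obtain rfl := hs.eq
  have hslope := hτ.2.2
  have hslope' := hτ'.2.2
  rw [hfinal, Fin.rev_rev, ← htrunc] at hslope'
  refine hu.mul_left_injective ?_
  linear_combination -q' (X (Fin.last k)) * hslope - hslope'

/-- The point `q` of the chart `C(p)` lies on the twig with number `j`. -/
def OnTwig (x : Fin 2 → A) (j : ℕ) (p : Word k) (q : ChartPt 𝕜 A k 𝕜) : Prop :=
  ∃ i, Carries k j p i ∧ q ∈ axis x p i

variable (𝕜) in
/-- The twig with number `j`, patched together from axes of the charts. -/
def twig (x : Fin 2 → A) (k j : ℕ) : Set (Space 𝕜 x k) :=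
  {P | ∃ p q, P = Space.mk x p q ∧ OnTwig x j p q}

variable (𝕜) in
/-- The axes which make up a twig agree on the overlaps of the charts of `S(k)`. -/
def TwigsCompatible (x : Fin 2 → A) (k : ℕ) : Prop :=
  ∀ ⦃j : ℕ⦄ ⦃p p' : Word k⦄ ⦃q q' : ChartPt 𝕜 A k 𝕜⦄,
    Space.mk x p q = Space.mk x p' q' → OnTwig x j p' q' → OnTwig x j p q

lemma Carries.onTwig_iff {j : ℕ} {p : Word k} {i : Fin 2} (hc : Carries k j p i)
    {q : ChartPt 𝕜 A k 𝕜} : OnTwig x j p q ↔ q ∈ axis x p i := by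
  refine ⟨?_, fun hq => ⟨i, hc, hq⟩⟩
  rintro ⟨i', hc', hq⟩
  rwa [hc.index_unique hc']

-- The origin lies on two twigs, and no other chart contains both of them.
lemma TwigsCompatible.word_eq (H : TwigsCompatible 𝕜 x k) {p p' : Word k}
    {z z' : ChartPt 𝕜 A k 𝕜} (hz' : IsOrigin x z') (h : Space.mk x p z = Space.mk x p' z') :
    p = p' := by
  obtain ⟨n, hn, rfl⟩ := exists_eq_chainWord p'
  obtain ⟨i, hc, -⟩ := H h ⟨0, carries_chainWord hn 0, hz'.mem_axis _ _⟩
  obtain ⟨i', hc', -⟩ := H h ⟨1, carries_chainWord hn 1, hz'.mem_axis _ _⟩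
  obtain rfl := hc.index_of_succ hc'
  exact hc.word_unique (carries_chainWord hn 0)

lemma onTwig_even_of_carries_trunc [Nontrivial A] (hx : IsEtaleCoords 𝕜 x) {j : ℕ}
    {p p' : Word (k + 1)} {i : Fin 2} (hc : Carries k j p.trunc i)
    (hc' : Carries (k + 1) (2 * j) p' i) {q q' : ChartPt 𝕜 A (k + 1) 𝕜}
    (hq' : q' ∈ axis x p' i)
    (h : Space.mk x p q = Space.mk x p' q') : OnTwig x (2 * j) p q := by
  obtain ⟨hc₀, rfl⟩ := carries_even.1 hc'
  have htrunc : p.trunc = p'.trunc := hc.word_unique hc₀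
  have hfinal : p.final = p'.final := by
    refine (eq_or_eq_rev p.final p'.final).resolve_right fun hrev => ?_
    have hlast := ((Space.mk_eq_mk hx).1 h).last_mul_last_eq_one htrunc (by rw [hrev, Fin.rev_rev])
    rw [(mem_axis_final.1 hq').2, mul_zero] at hlast
    exact zero_ne_one hlast
  obtain rfl := Word.ext_succ htrunc hfinal
  obtain rfl := Space.mk_injective hx p h
  exact ⟨_, hc', hq'⟩

section Nodes

variable [IsAlgClosed 𝕜] (hx : IsEtaleCoords 𝕜 x) {o : A →ₐ[𝕜] 𝕜}
  (ho : ∀ b : A →ₐ[𝕜] 𝕜, (∀ i, b (x i) = 0) ↔ b = o)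

include hx ho

lemma exists_mk_eq_mk_of_ne_zero {j : ℕ} {p p' : Word k} {i : Fin 2} (hc : Carries k j p i)
    (hc' : Carries k j p' (Fin.rev i)) {q' : ChartPt 𝕜 A k 𝕜} (hq' : q' ∈ axis x p' (Fin.rev i))
    (h : q' (active x k p' (Fin.rev i)) ≠ 0) :
    ∃ q : ChartPt 𝕜 A k 𝕜, q ∈ axis x p i ∧ Space.mk x p q = Space.mk x p' q' := by
  have : Nontrivial A := o.toRingHom.domain_nontrivial
  obtain ⟨q, hq, hinv⟩ :=
    exists_mem_axis ((ho o).2 rfl) (hc.isInterior hc') (q' (active x k p' (Fin.rev i)))⁻¹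
  refine ⟨q, hq, (Space.mk_eq_mk hx).2 (samePoint_of_carries hx ho hc hc' hq hq' ?_)⟩
  rw [hinv, inv_mul_cancel₀ h]

-- If the chart `C(p)` sees the twig as the other axis, then the point is not the origin there and
-- can be moved to a chart over that of `p.trunc`.
lemma TwigsCompatible.onTwig_even (H : TwigsCompatible 𝕜 x k) {j : ℕ} {p p' : Word (k + 1)}
    {q q' : ChartPt 𝕜 A (k + 1) 𝕜} (h : Space.mk x p q = Space.mk x p' q')
    (h' : OnTwig x (2 * j) p' q') : OnTwig x (2 * j) p q := by
  have : Nontrivial A := o.toRingHom.domain_nontrivial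
  obtain ⟨i', hc', hq'⟩ := h'
  obtain ⟨hc₀, rfl⟩ := carries_even.1 hc'
  have hproj : Space.mk x p.trunc q.proj = Space.mk x p'.trunc q'.proj := congrArg Space.proj h
  have hq₀ : q'.proj ∈ axis x p'.trunc p'.final := (mem_axis_final.1 hq').1
  obtain ⟨i, hc, -⟩ := H hproj ⟨_, hc₀, hq₀⟩
  rcases eq_or_eq_rev p'.final i with hi | hi
  · exact onTwig_even_of_carries_trunc hx (hi ▸ hc) hc' hq' h
  · have hne : q' (active x (k + 1) p' p'.final) ≠ 0 := by
      rw [active_final, ← ChartPt.proj_apply]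
      intro hzero
      have hp := H.word_eq (isOrigin_iff_mem_axis.2 ⟨hq₀, hzero⟩) hproj
      rw [hp] at hc
      exact rev_ne i (hi.symm.trans (hc₀.index_unique hc))
    obtain ⟨p₁, htrunc, hfinal⟩ := Word.exists_trunc_final_eq p.trunc i
    have hc₁ : Carries (k + 1) (2 * j) p₁ i := carries_even.2 ⟨htrunc ▸ hc, hfinal⟩
    rw [hi] at hc' hq' hne
    obtain ⟨q₁, hq₁, h₁⟩ := exists_mk_eq_mk_of_ne_zero hx ho hc₁ hc' hq' hne
    exact onTwig_even_of_carries_trunc hx hc hc₁ hq₁ (h.trans h₁.symm)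

lemma TwigsCompatible.mk_proj_eq_node_iff (H : TwigsCompatible 𝕜 x k) {j : ℕ} (hj : j < 2 ^ k)
    {p : Word (k + 1)} {q : ChartPt 𝕜 A (k + 1) 𝕜} :
    (Space.mk x p q).proj = node x o (chainWord k j) ↔ OnTwig x (2 * j + 1) p q := by
  have : Nontrivial A := o.toRingHom.domain_nontrivial
  have horigin : IsOrigin x (MvPolynomial.aevalTower o 0 : ChartPt 𝕜 A k 𝕜) :=
    isOrigin_aevalTower ((ho o).2 rfl)
  rw [Space.proj_mk, node]
  constructor
  · intro h
    have htrunc : p.trunc = chainWord k j := H.word_eq horigin h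
    rw [htrunc] at h
    refine ⟨Fin.rev p.final, carries_odd.2 ⟨hj, htrunc, (Fin.rev_rev _).symm⟩, ?_⟩
    rw [mem_axis_rev_final, Space.mk_injective hx _ h]
    exact horigin
  · rintro ⟨i, hc, hq⟩
    obtain ⟨-, htrunc, hfinal⟩ := carries_odd.1 hc
    rw [← Fin.rev_rev i, ← hfinal, mem_axis_rev_final] at hq
    rw [htrunc, hq.eq hx ho horigin]

lemma twigsCompatible (k : ℕ) : TwigsCompatible 𝕜 x k := by
  induction k with
  | zero =>
    intro j p p' q q' h h'
    rw [Subsingleton.elim p p'] at h ⊢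
    rwa [Space.mk_injective hx _ h]
  | succ k H =>
    intro j p p' q q' h h'
    obtain ⟨m, rfl | rfl⟩ := j.even_or_odd'
    · exact H.onTwig_even hx ho h h'
    · have hm : m < 2 ^ k := (carries_odd.1 h'.choose_spec.1).1
      rwa [← H.mk_proj_eq_node_iff hx ho hm, h, H.mk_proj_eq_node_iff hx ho hm]

lemma mk_mem_twig_iff {j : ℕ} {p : Word k} {q : ChartPt 𝕜 A k 𝕜} :
    Space.mk x p q ∈ twig 𝕜 x k j ↔ OnTwig x j p q := by
  refine ⟨?_, fun h => ⟨p, q, rfl, h⟩⟩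
  rintro ⟨p', q', h, h'⟩
  exact twigsCompatible hx ho k h h'

lemma inChart_twig {j : ℕ} {p : Word k} {i : Fin 2} (hc : Carries k j p i) :
    inChart p (twig 𝕜 x k j) = axis x p i := by
  ext q
  rw [mem_inChart, mk_mem_twig_iff hx ho, hc.onTwig_iff]

lemma isClosed_twig (j : ℕ) : IsClosed (twig 𝕜 x k j) := by
  refine isClosed_of_forall_inChart fun p => ?_
  by_cases h : ∃ i, Carries k j p i
  · obtain ⟨i, hc⟩ := h
    exact ⟨_, inChart_twig hx ho hc⟩
  · refine ⟨{1}, ?_⟩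
    ext q
    rw [mem_inChart, mk_mem_twig_iff hx ho]
    simp only [Set.mem_singleton_iff, forall_eq, map_one, Set.mem_ofPred_eq, one_ne_zero, iff_false]
    exact fun ⟨i, hc, _⟩ => h ⟨i, hc⟩

lemma zeroLocus_eq_twig (i : Fin 2) : zeroLocus x (x (Fin.rev i)) = twig 𝕜 x 0 i := by
  have : Nontrivial A := o.toRingHom.domain_nontrivial
  have hc (p : Word 0) : Carries 0 i p i := carries_zero.2 rfl
  ext P
  obtain ⟨p, q, rfl⟩ := P.exists_mk
  rw [mk_mem_twig_iff hx ho, (hc p).onTwig_iff, mem_axis_zero hx.injective]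
  constructor
  · rintro ⟨q', h, h'⟩
    rw [Subsingleton.elim p ![]] at h
    rwa [Space.mk_injective hx _ h]
  · exact fun h => ⟨q, by rw [Subsingleton.elim p ![]], h⟩

lemma setOf_proj_eq_node {j : ℕ} (hj : j < 2 ^ k) :
    {P : Space 𝕜 x (k + 1) | P.proj = node x o (chainWord k j)} =
      twig 𝕜 x (k + 1) (2 * j + 1) := by
  ext P
  obtain ⟨p, q, rfl⟩ := P.exists_mk
  rw [mk_mem_twig_iff hx ho, Set.mem_ofPred_eq,
    (twigsCompatible hx ho k).mk_proj_eq_node_iff hx ho hj]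

lemma prolong_twig (hirr : ∀ i, (Ideal.span {x i}).IsPrime) (j : ℕ) :
    prolong (twig 𝕜 x k j) = twig 𝕜 x (k + 1) (2 * j) := by
  have : Nontrivial A := o.toRingHom.domain_nontrivial
  rw [prolong, ← (isClosed_twig hx ho (2 * j)).closure_eq]
  congr 1
  ext P
  constructor
  · rintro ⟨p, q, rfl, hmem, htangent⟩
    obtain ⟨i, hc, hq⟩ := (mk_mem_twig_iff hx ho).1 hmem
    rw [tangentSpace_eq_line_iff hx ho hirr (inChart_twig hx ho hc) hq] at htangent
    obtain ⟨rfl, hlast⟩ := htangent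
    exact ⟨p, q, rfl, p.final, carries_even.2 ⟨hc, rfl⟩, mem_axis_final.2 ⟨hq, hlast⟩⟩
  · rintro ⟨p, q, rfl, i, hc, hq⟩
    obtain ⟨hc, rfl⟩ := carries_even.1 hc
    rw [mem_axis_final] at hq
    exact ⟨p, q, rfl, (mk_mem_twig_iff hx ho).2 ⟨_, hc, hq.1⟩,
      (tangentSpace_eq_line_iff hx ho hirr (inChart_twig hx ho hc) hq.1).2 ⟨rfl, hq.2⟩⟩

end Nodes

end Twigs

/-! ### The central member -/

lemma sdiff_singleton_eq_insert {α : Type u} {s : Set α} {a b : α} (hb : b ∈ s) (hba : b ≠ a) :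
    s \ {a} = insert b (s \ {a, b}) := by
  rw [← Set.insert_eq_of_mem (s := s \ {a}) (a := b) ⟨hb, hba⟩, ← Set.insert_sdiff_singleton,
    Set.sdiff_sdiff, Set.singleton_union]

lemma span_insert_inf_span_insert {R : Type u} [CommRing R] {s : Set R} {a b : R}
    (hprime : (Ideal.span (insert a s)).IsPrime) (hb : b ∉ Ideal.span (insert a s)) :
    Ideal.span (insert b s) ⊓ Ideal.span (insert a s) = Ideal.span (insert (a * b) s) := by
  have hle (c : R) : Ideal.span s ≤ Ideal.span (insert c s) :=
    Ideal.span_mono (Set.subset_insert c s)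
  refine le_antisymm ?_ (le_inf ?_ ?_)
  · rintro f ⟨hfb, hfa⟩
    obtain ⟨g, h, hh, rfl⟩ := Ideal.mem_span_insert.1 hfb
    have hgb : g * b ∈ Ideal.span (insert a s) := (Ideal.add_mem_iff_left _ (hle a hh)).1 hfa
    obtain ⟨g', h', hh', rfl⟩ := Ideal.mem_span_insert.1 ((hprime.mem_or_mem hgb).resolve_right hb)
    exact Ideal.mem_span_insert.2
      ⟨g', h' * b + h, add_mem (Ideal.mul_mem_right _ _ hh') hh, by ring⟩
  · rw [Ideal.span_insert (a * b), sup_le_iff, Ideal.span_singleton_le_iff_mem]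
    exact ⟨Ideal.mul_mem_left _ _ (Ideal.subset_span (Set.mem_insert _ _)), hle b⟩
  · rw [Ideal.span_insert (a * b), sup_le_iff, Ideal.span_singleton_le_iff_mem]
    exact ⟨Ideal.mul_mem_right _ _ (Ideal.subset_span (Set.mem_insert _ _)), hle a⟩

section Chain

variable {𝕜 : Type u} [Field 𝕜] {A : Type v} [CommRing A] [Algebra 𝕜 A] {k : ℕ} {x : Fin 2 → A}

section Membership

variable [IsAlgClosed 𝕜] (hx : IsEtaleCoords 𝕜 x) {o : A →ₐ[𝕜] 𝕜}
  (ho : ∀ b : A →ₐ[𝕜] 𝕜, (∀ i, b (x i) = 0) ↔ b = o)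

include hx ho

lemma twig_inter_twig_succ {n : ℕ} (hn : n < 2 ^ k) :
    twig 𝕜 x k n ∩ twig 𝕜 x k (n + 1) = {node x o (chainWord k n)} := by
  have : Nontrivial A := o.toRingHom.domain_nontrivial
  have horigin : IsOrigin x (MvPolynomial.aevalTower o 0 : ChartPt 𝕜 A k 𝕜) :=
    isOrigin_aevalTower ((ho o).2 rfl)
  refine Set.Subset.antisymm ?_ (Set.singleton_subset_iff.2 ⟨?_, ?_⟩)
  · rintro P ⟨h, h'⟩
    obtain ⟨p, q, rfl⟩ := P.exists_mk
    obtain ⟨i, hc, hq⟩ := (mk_mem_twig_iff hx ho).1 h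
    obtain ⟨i', hc', hq'⟩ := (mk_mem_twig_iff hx ho).1 h'
    obtain rfl := hc.index_of_succ hc'
    obtain rfl := hc.word_unique (carries_chainWord hn 0)
    obtain rfl : i' = 1 := hc'.index_unique (carries_chainWord hn 1)
    rw [((isOrigin_iff_mem_axis_and_mem_axis_rev hx.injective).2 ⟨hq, hq'⟩).eq hx ho horigin]
    rfl
  · exact (mk_mem_twig_iff hx ho).2 ⟨0, carries_chainWord hn 0, horigin.mem_axis _ _⟩
  · exact (mk_mem_twig_iff hx ho).2 ⟨1, carries_chainWord hn 1, horigin.mem_axis _ _⟩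

lemma disjoint_twig {a b : ℕ} (h : a + 1 < b) : Disjoint (twig 𝕜 x k a) (twig 𝕜 x k b) := by
  rw [Set.disjoint_left]
  intro P hPa hPb
  obtain ⟨p, q, rfl⟩ := P.exists_mk
  obtain ⟨i, ⟨n, hn, rfl, hi⟩, -⟩ := (mk_mem_twig_iff hx ho).1 hPa
  obtain ⟨i', hc', -⟩ := (mk_mem_twig_iff hx ho).1 hPb
  rw [carries_chainWord_iff hn] at hc'
  omega

lemma inChart_twig_nonempty_iff {n j : ℕ} (hn : n < 2 ^ k) :
    (inChart (chainWord k n) (twig 𝕜 x k j)).Nonempty ↔ j = n ∨ j = n + 1 := by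
  constructor
  · rintro ⟨q, hq⟩
    obtain ⟨i, hc, -⟩ := (mk_mem_twig_iff hx ho).1 hq
    rw [carries_chainWord_iff hn] at hc
    omega
  · have hnonempty (i : Fin 2) : (inChart (chainWord k n) (twig 𝕜 x k (n + i))).Nonempty := by
      rw [inChart_twig hx ho (carries_chainWord hn i)]
      exact ⟨_, (isOrigin_aevalTower ((ho o).2 rfl)).mem_axis _ _⟩
    rintro (rfl | rfl)
    · exact hnonempty 0
    · exact hnonempty 1

variable (hirr : ∀ i, (Ideal.span {x i}).IsPrime)

include hirr

lemma twig_zero (k : ℕ) : twig 𝕜 x k 0 = iterProlong (zeroLocus x (x 1)) k := by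
  induction k with
  | zero => exact (zeroLocus_eq_twig hx ho 0).symm
  | succ k ih => rw [iterProlong, ← ih, prolong_twig hx ho hirr]

lemma twig_two_pow (k : ℕ) : twig 𝕜 x k (2 ^ k) = iterProlong (zeroLocus x (x 0)) k := by
  induction k with
  | zero => exact (zeroLocus_eq_twig hx ho 1).symm
  | succ k ih => rw [iterProlong, ← ih, prolong_twig hx ho hirr, pow_succ']

lemma isProlongedVertical_twig {j : ℕ} (h0 : 0 < j) (hj : j < 2 ^ k) :
    IsProlongedVertical (twig 𝕜 x k j) := by
  induction k generalizing j with
  | zero => omega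
  | succ k ih =>
    obtain ⟨m, rfl | rfl⟩ := j.even_or_odd'
    · rw [← prolong_twig hx ho hirr]
      exact (ih (by omega) (by omega)).lift
    · rw [← setOf_proj_eq_node hx ho (by omega)]
      exact .vertical _

section CentralFiber

variable [CharZero 𝕜]

lemma forall_centralIdeal_iff_exists_mem_axis {p : Word k} {q : ChartPt 𝕜 A k 𝕜} :
    (∀ f ∈ centralIdeal 𝕜 x p, q f = 0) ↔ ∃ i, q ∈ axis x p i := by
  have : Nontrivial A := o.toRingHom.domain_nontrivial
  rw [← forall_nodeBinomials_iff_exists_mem_axis hx.injective,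
    centralIdeal_eq hx ((ho o).2 rfl) hirr p]
  exact Ideal.span_le (I := RingHom.ker q)

lemma iUnion_twig : ⋃ j : Fin (2 ^ k + 1), twig 𝕜 x k j = centralFiber 𝕜 x k := by
  ext P
  rw [Set.mem_iUnion]
  constructor
  · rintro ⟨j, p, q, rfl, i, -, hq⟩
    exact ⟨p, q, rfl, (forall_centralIdeal_iff_exists_mem_axis hx ho hirr).2 ⟨i, hq⟩⟩
  · rintro ⟨p, q, rfl, h⟩
    obtain ⟨i, hq⟩ := (forall_centralIdeal_iff_exists_mem_axis hx ho hirr).1 h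
    obtain ⟨n, hn, rfl⟩ := exists_eq_chainWord p
    exact ⟨⟨n + i, by omega⟩, _, q, rfl, i, carries_chainWord hn i, hq⟩

lemma inChart_centralFiber (p : Word k) :
    inChart p (centralFiber 𝕜 x k) = ⋃ i, (axis x p i : Set (ChartPt 𝕜 A k 𝕜)) := by
  obtain ⟨n, hn, rfl⟩ := exists_eq_chainWord p
  ext q
  rw [mem_inChart, ← iUnion_twig hx ho hirr, Set.mem_iUnion, Set.mem_iUnion]
  constructor
  · rintro ⟨j, hj⟩
    obtain ⟨i, -, hq⟩ := (mk_mem_twig_iff hx ho).1 hj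
    exact ⟨i, hq⟩
  · rintro ⟨i, hq⟩
    exact ⟨⟨n + i, by omega⟩, (mk_mem_twig_iff hx ho).2 ⟨i, carries_chainWord hn i, hq⟩⟩

lemma idealOf_centralFiber (p : Word k) :
    idealOf p (centralFiber 𝕜 x k) = Ideal.span (insert (active x k p 0 * active x k p 1)
      (coords x k \ {active x k p 0, active x k p 1})) := by
  have : Nontrivial A := o.toRingHom.domain_nontrivial
  obtain ⟨n, hn, rfl⟩ := exists_eq_chainWord p
  set a := active x k (chainWord k n)
  have hne : a 1 ≠ a 0 := (active_injective hx.injective _).ne one_ne_zero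
  have hideal (i : Fin 2) :
      idealOf (chainWord k n) (twig 𝕜 x k (n + i)) = Ideal.span (coords x k \ {a i}) :=
    idealOf_of_inChart_eq_axis hx ho hirr (inChart_twig hx ho (carries_chainWord hn i))
  have hsdiff₀ : coords x k \ {a 0} = insert (a 1) (coords x k \ {a 0, a 1}) :=
    sdiff_singleton_eq_insert (active_mem_coords _ 1) hne
  have hsdiff₁ : coords x k \ {a 1} = insert (a 0) (coords x k \ {a 0, a 1}) := by
    rw [Set.pair_comm]
    exact sdiff_singleton_eq_insert (active_mem_coords _ 0) hne.symm
  have hprime := isPrime_span_coords_diff hx ho hirr (chainWord k n) 1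
  have hmem := active_notMem_span_coords_diff hx ho (chainWord k n) 1
  rw [hsdiff₁] at hprime hmem
  rw [← span_insert_inf_span_insert hprime hmem, ← hsdiff₀, ← hsdiff₁, ← hideal, ← hideal]
  ext f
  simp only [Submodule.mem_inf, mem_idealOf, inChart_centralFiber hx ho hirr, Set.mem_iUnion,
    Fin.exists_fin_two, inChart_twig hx ho (carries_chainWord hn _), or_imp, forall_and]

end CentralFiber

lemma notMem_span_coords_diff_iff {p : Word k} {i : Fin 2} {f : ChartRing A k} :
    f ∉ Ideal.span (coords x k \ {active x k p i}) ↔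
      ∃ q : ChartPt 𝕜 A k 𝕜, q ∈ axis x p i ∧ q f ≠ 0 := by
  rw [mem_span_coords_diff_iff hx ho hirr]
  push Not
  rfl

lemma isPreirreducible_axis (p : Word k) (i : Fin 2) :
    IsPreirreducible (Space.mk x p '' axis x p i : Set (Space 𝕜 x k)) := by
  rintro U V hU hV ⟨_, ⟨q, hq, rfl⟩, hqU⟩ ⟨_, ⟨q', hq', rfl⟩, hqV⟩
  obtain ⟨f, hf, hfU⟩ := exists_basicOpen_subset_inChart hU hqU
  obtain ⟨g, hg, hgV⟩ := exists_basicOpen_subset_inChart hV hqV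
  have hfgmem : f * g ∉ Ideal.span (coords x k \ {active x k p i}) :=
    (isPrime_span_coords_diff hx ho hirr p i).mul_notMem
      ((notMem_span_coords_diff_iff hx ho hirr).2 ⟨q, hq, hf⟩)
      ((notMem_span_coords_diff_iff hx ho hirr).2 ⟨q', hq', hg⟩)
  obtain ⟨z, hz, hfg⟩ := (notMem_span_coords_diff_iff hx ho hirr).1 hfgmem
  rw [map_mul] at hfg
  exact ⟨_, ⟨z, hz, rfl⟩, hfU z (left_ne_zero_of_mul hfg), hgV z (right_ne_zero_of_mul hfg)⟩

lemma closure_axis {j : ℕ} {p : Word k} {i : Fin 2} (hc : Carries k j p i) :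
    closure (Space.mk x p '' axis x p i : Set (Space 𝕜 x k)) = twig 𝕜 x k j := by
  refine (closure_minimal ?_ (isClosed_twig hx ho j)).antisymm ?_
  · rintro _ ⟨q, hq, rfl⟩
    exact ⟨p, q, rfl, i, hc, hq⟩
  · rintro _ ⟨p', q', rfl, i', hc', hq'⟩
    rw [mem_closure_iff]
    intro W hW hqW
    rcases eq_or_eq_rev i' i with rfl | rfl
    · obtain rfl := hc.word_unique hc'
      exact ⟨_, hqW, _, hq', rfl⟩
    · obtain ⟨f, hf, hfW⟩ := exists_basicOpen_subset_inChart hW hqW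
      have hfamem := (isPrime_span_coords_diff hx ho hirr p' (Fin.rev i)).mul_notMem
        ((notMem_span_coords_diff_iff hx ho hirr).2 ⟨q', hq', hf⟩)
        (active_notMem_span_coords_diff hx ho p' (Fin.rev i))
      obtain ⟨z', hz', hfa⟩ := (notMem_span_coords_diff_iff hx ho hirr).1 hfamem
      rw [map_mul] at hfa
      obtain ⟨z, hz, hzz'⟩ :=
        exists_mk_eq_mk_of_ne_zero hx ho hc hc' hz' (right_ne_zero_of_mul hfa)
      exact ⟨_, hfW z' (left_ne_zero_of_mul hfa), z, hz, hzz'⟩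

lemma isIrreducible_twig {j : ℕ} (hj : j ≤ 2 ^ k) : IsIrreducible (twig 𝕜 x k j) := by
  obtain ⟨p, i, hc⟩ := exists_carries hj
  rw [← closure_axis hx ho hirr hc]
  refine ⟨?_, (isPreirreducible_axis hx ho hirr p i).closure⟩
  exact closure_nonempty_iff.2 ⟨_, _, (isOrigin_aevalTower ((ho o).2 rfl)).mem_axis p i, rfl⟩

lemma eq_of_twig_subset {a b : ℕ} (ha : a ≤ 2 ^ k) (h : twig 𝕜 x k a ⊆ twig 𝕜 x k b) :
    a = b := by
  have : Nontrivial A := o.toRingHom.domain_nontrivial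
  obtain ⟨p, i, hc⟩ := exists_carries ha
  obtain ⟨q, hq, hqa⟩ :=
    (notMem_span_coords_diff_iff hx ho hirr).1 (active_notMem_span_coords_diff hx ho p i)
  obtain ⟨i', hc', hq'⟩ := (mk_mem_twig_iff hx ho).1 (h ⟨p, q, rfl, i, hc, hq⟩)
  rcases eq_or_eq_rev i' i with rfl | rfl
  · obtain ⟨n, hn, rfl, rfl⟩ := hc
    exact (carries_chainWord_iff hn).1 hc'
  · have horigin := (isOrigin_iff_mem_axis_and_mem_axis_rev hx.injective).2 ⟨hq, hq'⟩
    exact (hqa (horigin _ (active_mem_coords p i))).elim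

variable [CharZero 𝕜]

lemma exists_subset_twig {Y : Set (Space 𝕜 x k)} (hY : IsIrreducible Y)
    (hsub : Y ⊆ centralFiber 𝕜 x k) : ∃ j : Fin (2 ^ k + 1), Y ⊆ twig 𝕜 x k j := by
  classical
  rw [← iUnion_twig hx ho hirr, ← Set.sUnion_range] at hsub
  obtain ⟨Z, hZ, hYZ⟩ := isIrreducible_iff_sUnion_isClosed.1 hY
    (Finset.univ.image fun j : Fin (2 ^ k + 1) => twig 𝕜 x k j)
    (by simpa using fun j : Fin _ => isClosed_twig hx ho j) (by simpa using hsub)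
  obtain ⟨j, -, rfl⟩ := Finset.mem_image.1 hZ
  exact ⟨j, hYZ⟩

lemma mem_range_twig_iff_maximal {Z : Set (Space 𝕜 x k)} :
    Z ∈ Set.range (fun j : Fin (2 ^ k + 1) => twig 𝕜 x k j) ↔
      Maximal (fun Y => IsIrreducible Y ∧ Y ⊆ centralFiber 𝕜 x k) Z := by
  have htwig (j : Fin (2 ^ k + 1)) :
      IsIrreducible (twig 𝕜 x k j) ∧ twig 𝕜 x k j ⊆ centralFiber 𝕜 x k :=
    ⟨isIrreducible_twig hx ho hirr j.is_le,
      iUnion_twig hx ho hirr ▸ Set.subset_iUnion (fun j : Fin (2 ^ k + 1) => twig 𝕜 x k j) j⟩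
  constructor
  · rintro ⟨j, rfl⟩
    refine ⟨htwig j, fun Y hY hjY => ?_⟩
    obtain ⟨j', hYj'⟩ := exists_subset_twig hx ho hirr hY.1 hY.2
    rwa [← eq_of_twig_subset hx ho hirr j.is_le (hjY.trans hYj')] at hYj'
  · intro hZ
    obtain ⟨j, hZj⟩ := exists_subset_twig hx ho hirr hZ.1.1 hZ.1.2
    exact ⟨j, (hZ.2 (htwig j) hZj).antisymm hZj⟩

end Membership

end Chain

/-! ### Interior twigs as projective lines -/

section ProjectiveLine

variable {𝕜 : Type u} [Field 𝕜]

lemma update_one_ne_zero {R : Type*} [MulZeroOneClass R] [Nontrivial R] (i : Fin 2) (c : R) :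
    Function.update (1 : Fin 2 → R) i c ≠ 0 := fun h => by
  simpa [rev_ne i] using congrFun h (Fin.rev i)

/-- The point of the projective line whose homogeneous coordinate with index `i` is `c` and whose
other homogeneous coordinate is `1`. For `i = 0, 1` this parametrizes the two standard charts. -/
def affinePt (i : Fin 2) (c : 𝕜) : Projectivization 𝕜 (Fin 2 → 𝕜) :=
  Projectivization.mk 𝕜 (Function.update 1 i c) (update_one_ne_zero i c)

lemma exists_rep_affinePt (i : Fin 2) (c : 𝕜) :
    ∃ a : 𝕜, a ≠ 0 ∧ (affinePt i c).rep = a • Function.update (1 : Fin 2 → 𝕜) i c := by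
  obtain ⟨a, ha⟩ := Projectivization.exists_smul_eq_mk_rep 𝕜 _ (update_one_ne_zero i c)
  exact ⟨a, a.ne_zero, ha.symm⟩

lemma eq_affinePt {i : Fin 2} {P : Projectivization 𝕜 (Fin 2 → 𝕜)}
    (h : P.rep (Fin.rev i) ≠ 0) : P = affinePt i (P.rep i / P.rep (Fin.rev i)) := by
  conv_lhs => rw [← P.mk_rep]
  refine (Projectivization.mk_eq_mk_iff' _ _ _ _ _).2 ⟨P.rep (Fin.rev i), funext ?_⟩
  rw [forall_iff_and_rev i]
  simp [rev_ne i, mul_div_cancel₀ _ h]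

lemma exists_eq_affinePt (P : Projectivization 𝕜 (Fin 2 → 𝕜)) : ∃ i c, P = affinePt i c := by
  obtain ⟨i, hi⟩ := Function.ne_iff.1 P.rep_nonzero
  rw [← Fin.rev_rev i] at hi
  exact ⟨_, _, eq_affinePt hi⟩

lemma affinePt_injective (i : Fin 2) : Function.Injective (affinePt (𝕜 := 𝕜) i) := fun c c' h => by
  obtain ⟨a, ha⟩ := (Projectivization.mk_eq_mk_iff' _ _ _ _ _).1 h
  have hi := congrFun ha i
  have hrev := congrFun ha (Fin.rev i)
  simp_all [rev_ne i]

lemma affinePt_eq_affinePt_rev_iff {i : Fin 2} {c c' : 𝕜} :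
    affinePt i c = affinePt (Fin.rev i) c' ↔ c * c' = 1 := by
  rw [affinePt, affinePt, Projectivization.mk_eq_mk_iff']
  simp only [funext_iff, forall_iff_and_rev i, Pi.smul_apply, smul_eq_mul, Pi.one_apply,
    Function.update_self, Function.update_of_ne (rev_ne i), Function.update_of_ne (rev_ne i).symm,
    mul_one, exists_eq_left]

-- A map on the projective line is a pair of maps on the affine line that agree under `c ↦ c⁻¹`.
lemma exists_comp_affinePt_eq {α : Type*} (ψ : Fin 2 → 𝕜 → α)
    (hψ : ∀ i c c', c * c' = 1 → ψ i c = ψ (Fin.rev i) c') :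
    ∃ φ : Projectivization 𝕜 (Fin 2 → 𝕜) → α, ∀ i c, φ (affinePt i c) = ψ i c := by
  choose ι γ hιγ using exists_eq_affinePt (𝕜 := 𝕜)
  have hcompat {i l : Fin 2} {c b : 𝕜} (h : affinePt i c = affinePt l b) : ψ i c = ψ l b := by
    rcases eq_or_eq_rev l i with rfl | rfl
    · rw [affinePt_injective _ h]
    · exact hψ i c b (affinePt_eq_affinePt_rev_iff.1 h)
  exact ⟨fun P => ψ (ι P) (γ P), fun i c => (hcompat (hιγ (affinePt i c))).symm⟩

/-- The function `f` on the affine line is regular near `c`: it is a quotient of two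
polynomials. -/
def IsRegularAtA1 (f : 𝕜 → 𝕜) (c : 𝕜) : Prop :=
  ∃ g h : Polynomial 𝕜, h.eval c ≠ 0 ∧ ∀ c', h.eval c' ≠ 0 → f c' = g.eval c' / h.eval c'

lemma eval_smul_of_isHomogeneous {R σ : Type*} [CommSemiring R] {d : ℕ} {g : MvPolynomial σ R}
    (hg : g.IsHomogeneous d) (a : R) (v : σ → R) :
    MvPolynomial.eval (a • v) g = a ^ d * MvPolynomial.eval v g := by
  rw [MvPolynomial.eval_eq, MvPolynomial.eval_eq, Finset.mul_sum]
  refine Finset.sum_congr rfl fun e he => ?_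
  have hdeg : ∑ i ∈ e.support, e i = d := by
    rw [← Finsupp.degree_apply, Finsupp.degree_eq_weight_one]
    exact hg (MvPolynomial.mem_support_iff.1 he)
  simp only [Pi.smul_apply, smul_eq_mul, mul_pow, Finset.prod_mul_distrib,
    Finset.prod_pow_eq_pow_sum, hdeg]
  ring

lemma eval_aeval_update_X {R : Type*} [CommSemiring R] (i : Fin 2) (c : R)
    (F : MvPolynomial (Fin 2) R) :
    (aeval (Function.update (1 : Fin 2 → Polynomial R) i Polynomial.X) F).eval c =
      MvPolynomial.eval (Function.update 1 i c) F := by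
  rw [← Polynomial.coe_aeval_eq_eval, ← MvPolynomial.coe_aeval_eq_eval]
  change ((Polynomial.aeval c).comp (aeval _)) F = aeval _ F
  congr 1
  ext l
  revert l
  rw [forall_iff_and_rev i]
  simp [rev_ne i]

lemma eval_rename_homogenize (i : Fin 2) {p : Polynomial 𝕜} {d : ℕ} (hd : p.natDegree ≤ d)
    {v : Fin 2 → 𝕜} (hv : v (Fin.rev i) ≠ 0) :
    MvPolynomial.eval v (MvPolynomial.rename ![i, Fin.rev i] (p.homogenize d)) =
      p.eval (v i / v (Fin.rev i)) * v (Fin.rev i) ^ d := by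
  rw [MvPolynomial.eval_rename, Polynomial.eval_homogenize hd _ (by simpa using hv)]
  rfl

lemma IsRegularAtP1.comp_affinePt {f : Projectivization 𝕜 (Fin 2 → 𝕜) → 𝕜} {i : Fin 2} {c : 𝕜}
    (hf : IsRegularAtP1 f (affinePt i c)) : IsRegularAtA1 (f ∘ affinePt i) c := by
  obtain ⟨d, g, h, hg, hh, hne, hquot⟩ := hf
  let dehom (F : MvPolynomial (Fin 2) 𝕜) : Polynomial 𝕜 :=
    aeval (Function.update 1 i Polynomial.X) F
  have heval (b : 𝕜) : ∃ a : 𝕜, a ≠ 0 ∧ ∀ F : MvPolynomial (Fin 2) 𝕜, F.IsHomogeneous d →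
      MvPolynomial.eval (affinePt i b).rep F = a * (dehom F).eval b := by
    obtain ⟨a, ha, hrep⟩ := exists_rep_affinePt i b
    refine ⟨a ^ d, pow_ne_zero d ha, fun F hF => ?_⟩
    rw [hrep, eval_smul_of_isHomogeneous hF, eval_aeval_update_X]
  refine ⟨dehom g, dehom h, ?_, fun b hb => ?_⟩
  · obtain ⟨a, -, ha⟩ := heval c
    rw [ha h hh] at hne
    exact right_ne_zero_of_mul hne
  · obtain ⟨a, ha₀, ha⟩ := heval b
    have hquot_b := hquot (affinePt i b) (by rw [ha h hh]; exact mul_ne_zero ha₀ hb)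
    rwa [ha g hg, ha h hh, mul_div_mul_left _ _ ha₀] at hquot_b

lemma isRegularAtP1_of_comp_affinePt {f : Projectivization 𝕜 (Fin 2 → 𝕜) → 𝕜} {i : Fin 2} {c : 𝕜}
    (hf : IsRegularAtA1 (f ∘ affinePt i) c) : IsRegularAtP1 f (affinePt i c) := by
  obtain ⟨g, h, hne, hquot⟩ := hf
  set d := max g.natDegree h.natDegree
  -- The factor `X (Fin.rev i)` makes the denominator vanish outside the chart.
  let hom (p : Polynomial 𝕜) : MvPolynomial (Fin 2) 𝕜 :=
    X (Fin.rev i) * MvPolynomial.rename ![i, Fin.rev i] (p.homogenize d)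
  have hhom (p : Polynomial 𝕜) : (hom p).IsHomogeneous (1 + d) :=
    (MvPolynomial.isHomogeneous_X 𝕜 _).mul (p.isHomogeneous_homogenize.rename_isHomogeneous)
  have heval {p : Polynomial 𝕜} (hp : p.natDegree ≤ d) {P : Projectivization 𝕜 (Fin 2 → 𝕜)}
      (hP : P.rep (Fin.rev i) ≠ 0) : MvPolynomial.eval P.rep (hom p) =
        P.rep (Fin.rev i) ^ (1 + d) * p.eval (P.rep i / P.rep (Fin.rev i)) := by
    rw [map_mul, MvPolynomial.eval_X, eval_rename_homogenize i hp hP]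
    ring
  refine ⟨1 + d, hom g, hom h, hhom g, hhom h, ?_, fun P hP => ?_⟩
  · obtain ⟨a, ha, hrep⟩ := exists_rep_affinePt i c
    have hself : (affinePt i c).rep i = a * c := by simp [hrep]
    have hrev : (affinePt i c).rep (Fin.rev i) = a := by simp [hrep, rev_ne i]
    rw [heval (le_max_right _ _) (hrev ▸ ha), hself, hrev, mul_div_cancel_left₀ _ ha]
    exact mul_ne_zero (pow_ne_zero _ ha) hne
  · have hPi : P.rep (Fin.rev i) ≠ 0 := fun h0 => hP (by simp [hom, h0])
    have hpow : P.rep (Fin.rev i) ^ (1 + d) ≠ 0 := pow_ne_zero _ hPi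
    rw [heval (le_max_right _ _) hPi] at hP
    rw [heval (le_max_right _ _) hPi, heval (le_max_left _ _) hPi, mul_div_mul_left _ _ hpow,
      ← hquot _ (right_ne_zero_of_mul hP), Function.comp_apply, ← eq_affinePt hPi]

lemma isRegularAtP1_affinePt_iff {f : Projectivization 𝕜 (Fin 2 → 𝕜) → 𝕜} {i : Fin 2} {c : 𝕜} :
    IsRegularAtP1 f (affinePt i c) ↔ IsRegularAtA1 (f ∘ affinePt i) c :=
  ⟨IsRegularAtP1.comp_affinePt, isRegularAtP1_of_comp_affinePt⟩

end ProjectiveLine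

section Copy

variable {𝕜 : Type u} [Field 𝕜] {A : Type v} [CommRing A] [Algebra 𝕜 A] {k : ℕ} {x : Fin 2 → A}

section Axis

variable [IsAlgClosed 𝕜] [Nontrivial A] (hx : IsEtaleCoords 𝕜 x) {o : A →ₐ[𝕜] 𝕜}
  (ho : ∀ b : A →ₐ[𝕜] 𝕜, (∀ i, b (x i) = 0) ↔ b = o) {p : Word k} {i : Fin 2}
  (hi : IsInterior k p i)

/-- The points of an interior axis of a chart, parametrized by the value of its active
coordinate. -/
noncomputable def axisEquiv : (axis x p i : Set (ChartPt 𝕜 A k 𝕜)) ≃ 𝕜 :=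
  Equiv.ofBijective (fun q => q.1 (active x k p i))
    ⟨fun q q' h => Subtype.ext (eq_of_mem_axis hx ho hi q.2 q'.2 h), fun c => by
      obtain ⟨q, hq, hc⟩ := exists_mem_axis ((ho o).2 rfl) hi c
      exact ⟨⟨q, hq⟩, hc⟩⟩

@[simp] lemma axisEquiv_symm_apply_active (c : 𝕜) :
    ((axisEquiv hx ho hi).symm c).1 (active x k p i) = c :=
  (axisEquiv hx ho hi).apply_symm_apply c

include hx ho hi in
lemma exists_apply_eq_eval_active : ∃ ξ : ChartPt 𝕜 A k (Polynomial 𝕜),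
    ∀ q ∈ (axis x p i : Set (ChartPt 𝕜 A k 𝕜)), ∀ F, q F = (ξ F).eval (q (active x k p i)) := by
  obtain ⟨ξ, hξ, hξX⟩ :=
    exists_mem_axis (R := Polynomial 𝕜) ((ho o).2 rfl) hi Polynomial.X
  refine ⟨ξ, fun q hq F => ?_⟩
  set c := q (active x k p i)
  have hmem : (Polynomial.aeval c).comp ξ ∈ axis x p i := fun a ha => by
    rw [AlgHom.comp_apply, hξ a ha, map_zero]
  have hq_eq : q = (Polynomial.aeval c).comp ξ :=
    eq_of_mem_axis hx ho hi hq hmem (by rw [AlgHom.comp_apply, hξX, Polynomial.aeval_X])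
  rw [DFunLike.congr_fun hq_eq F, AlgHom.comp_apply, Polynomial.coe_aeval_eq_eval]

lemma exists_quotient_on_axis_iff {f : ChartPt 𝕜 A k 𝕜 → 𝕜} {c : 𝕜} :
    (∃ g h : ChartRing A k, ((axisEquiv hx ho hi).symm c).1 h ≠ 0 ∧
      ∀ q ∈ axis x p i, q h ≠ 0 → f q = q g / q h) ↔
      IsRegularAtA1 (fun b => f ((axisEquiv hx ho hi).symm b)) c := by
  constructor
  · rintro ⟨g, h, hne, hquot⟩
    obtain ⟨ξ, hξ⟩ := exists_apply_eq_eval_active hx ho hi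
    have heval (b : 𝕜) (F : ChartRing A k) :
        ((axisEquiv hx ho hi).symm b).1 F = (ξ F).eval b := by
      rw [hξ _ (Subtype.prop _), axisEquiv_symm_apply_active]
    refine ⟨ξ g, ξ h, heval c h ▸ hne, fun b hb => ?_⟩
    rw [← heval] at hb
    rw [← heval, ← heval]
    exact hquot _ (Subtype.prop _) hb
  · rintro ⟨g, h, hne, hquot⟩
    have heval (q : ChartPt 𝕜 A k 𝕜) (F : Polynomial 𝕜) :
        q (Polynomial.aeval (active x k p i) F) = F.eval (q (active x k p i)) := by
      rw [← Polynomial.aeval_algHom_apply, Polynomial.coe_aeval_eq_eval]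
    refine ⟨Polynomial.aeval (active x k p i) g, Polynomial.aeval (active x k p i) h, ?_,
      fun q hq hqh => ?_⟩
    · rwa [heval, axisEquiv_symm_apply_active]
    · rw [heval] at hqh
      obtain ⟨b, hb⟩ := (axisEquiv hx ho hi).symm.surjective ⟨q, hq⟩
      obtain rfl : _ = q := congrArg Subtype.val hb
      rw [axisEquiv_symm_apply_active] at hqh
      rw [heval, heval, axisEquiv_symm_apply_active]
      exact hquot b hqh

end Axis

section Twig

variable [IsAlgClosed 𝕜] [Nontrivial A] (hx : IsEtaleCoords 𝕜 x) {o : A →ₐ[𝕜] 𝕜}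
  (ho : ∀ b : A →ₐ[𝕜] 𝕜, (∀ i, b (x i) = 0) ↔ b = o) {j : ℕ} {W : Fin 2 → Word k}
  (hW : ∀ i, Carries k j (W i) i)

/-- The points of the interior twig with number `j` in the chart `C(W i)`, one of the two charts
that it meets, parametrized by the value of the active coordinate with index `i`. -/
noncomputable def twigPt (i : Fin 2) (c : 𝕜) : Space 𝕜 x k :=
  Space.mk x (W i) ((axisEquiv hx ho ((hW i).isInterior (hW (Fin.rev i)))).symm c)

lemma twigPt_mem (i : Fin 2) (c : 𝕜) : twigPt hx ho hW i c ∈ twig 𝕜 x k j :=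
  (mk_mem_twig_iff hx ho).2 ⟨i, hW i, Subtype.prop _⟩

lemma exists_eq_of_mk_mem_twig {p : Word k} {q : ChartPt 𝕜 A k 𝕜}
    (h : Space.mk x p q ∈ twig 𝕜 x k j) : ∃ i c, p = W i ∧
      q = (axisEquiv hx ho ((hW i).isInterior (hW (Fin.rev i)))).symm c := by
  obtain ⟨i, hc, hq⟩ := (mk_mem_twig_iff hx ho).1 h
  obtain rfl := hc.word_unique (hW i)
  obtain ⟨c, h⟩ :=
    (axisEquiv hx ho ((hW i).isInterior (hW (Fin.rev i)))).symm.surjective ⟨q, hq⟩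
  exact ⟨i, c, rfl, (congrArg Subtype.val h).symm⟩

lemma twigPt_injective (i : Fin 2) : Function.Injective (twigPt hx ho hW i) := fun _ _ h =>
  (Equiv.injective _) (Subtype.ext (Space.mk_injective hx _ h))

lemma twigPt_eq_twigPt_rev {i : Fin 2} {c c' : 𝕜} (h : c * c' = 1) :
    twigPt hx ho hW i c = twigPt hx ho hW (Fin.rev i) c' := by
  refine (Space.mk_eq_mk hx).2 (samePoint_of_carries hx ho (hW i) (hW _) (Subtype.prop _)
    (Subtype.prop _) ?_)
  rw [axisEquiv_symm_apply_active, axisEquiv_symm_apply_active, h]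

-- The point with parameter `0` is the origin of its chart, which no other chart of the twig
-- contains.
lemma twigPt_ne_twigPt_rev_zero (i : Fin 2) (c : 𝕜) :
    twigPt hx ho hW i c ≠ twigPt hx ho hW (Fin.rev i) 0 := fun h => by
  have hword : W i = W (Fin.rev i) := (twigsCompatible hx ho k).word_eq
    (isOrigin_iff_mem_axis.2 ⟨Subtype.prop _, axisEquiv_symm_apply_active _ _ _ _⟩) h
  have hc := hW (Fin.rev i)
  rw [← hword] at hc
  exact rev_ne i (hc.index_unique (hW i))

lemma affinePt_eq_of_twigPt_eq {i l : Fin 2} {c b : 𝕜}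
    (h : twigPt hx ho hW i c = twigPt hx ho hW l b) : affinePt i c = affinePt l b := by
  rcases eq_or_eq_rev i l with rfl | hl
  · rw [twigPt_injective hx ho hW i h]
  · obtain rfl : l = Fin.rev i := by rw [hl, Fin.rev_rev]
    have hb : b ≠ 0 := by
      rintro rfl
      exact twigPt_ne_twigPt_rev_zero hx ho hW i c h
    rw [← twigPt_eq_twigPt_rev hx ho hW (inv_mul_cancel₀ hb)] at h
    rw [affinePt_eq_affinePt_rev_iff, twigPt_injective hx ho hW i h, inv_mul_cancel₀ hb]

lemma isRegularAt_twig_iff {f : Space 𝕜 x k → 𝕜} {P : Space 𝕜 x k} (hP : P ∈ twig 𝕜 x k j) :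
    IsRegularAt (twig 𝕜 x k j) f P ↔
      ∃ i c, P = twigPt hx ho hW i c ∧ IsRegularAtA1 (f ∘ twigPt hx ho hW i) c := by
  constructor
  · rintro ⟨p, q, g, h, rfl, hne, hquot⟩
    obtain ⟨i, c, rfl, rfl⟩ := exists_eq_of_mk_mem_twig hx ho hW hP
    rw [inChart_twig hx ho (hW i)] at hquot
    exact ⟨i, c, rfl, (exists_quotient_on_axis_iff hx ho _).1 ⟨g, h, hne, hquot⟩⟩
  · rintro ⟨i, c, rfl, hf⟩
    obtain ⟨g, h, hne, hquot⟩ :=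
      (exists_quotient_on_axis_iff (f := fun q => f (Space.mk x (W i) q)) hx ho _).2 hf
    rw [← inChart_twig hx ho (hW i)] at hquot
    exact ⟨W i, _, g, h, rfl, hne, hquot⟩

end Twig

lemma isCopyOfP1_twig [IsAlgClosed 𝕜] (hx : IsEtaleCoords 𝕜 x) {o : A →ₐ[𝕜] 𝕜}
    (ho : ∀ b : A →ₐ[𝕜] 𝕜, (∀ i, b (x i) = 0) ↔ b = o) {j : ℕ} (h0 : 0 < j) (hj : j < 2 ^ k) :
    IsCopyOfP1 (twig 𝕜 x k j) := by
  have : Nontrivial A := o.toRingHom.domain_nontrivial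
  have hW (i : Fin 2) : Carries k j (chainWord k (j - i)) i :=
    (carries_chainWord_iff (by omega)).2 (by omega)
  obtain ⟨φ, hφ⟩ := exists_comp_affinePt_eq (twigPt hx ho hW)
    fun _ _ _ => twigPt_eq_twigPt_rev hx ho hW
  have hmem (P : Projectivization 𝕜 (Fin 2 → 𝕜)) : φ P ∈ twig 𝕜 x k j := by
    obtain ⟨i, c, rfl⟩ := exists_eq_affinePt P
    exact hφ i c ▸ twigPt_mem hx ho hW i c
  have hinj : Function.Injective φ := fun P P' h => by
    obtain ⟨i, c, rfl⟩ := exists_eq_affinePt P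
    obtain ⟨i', c', rfl⟩ := exists_eq_affinePt P'
    rw [hφ, hφ] at h
    exact affinePt_eq_of_twigPt_eq hx ho hW h
  refine ⟨φ, hinj, (Set.range_subset_iff.2 hmem).antisymm fun Q hQ => ?_, fun f P => ?_⟩
  · obtain ⟨p, q, rfl⟩ := Q.exists_mk
    obtain ⟨i, c, rfl, rfl⟩ := exists_eq_of_mk_mem_twig hx ho hW hQ
    exact ⟨affinePt i c, hφ i c⟩
  · have hcomp (i : Fin 2) : f ∘ twigPt hx ho hW i = (f ∘ φ) ∘ affinePt i :=
      funext fun c => congrArg f (hφ i c).symm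
    simp only [isRegularAt_twig_iff hx ho hW (hmem P), ← hφ, hinj.eq_iff, hcomp,
      ← isRegularAtP1_affinePt_iff]
    constructor
    · rintro ⟨i, c, rfl, hf⟩
      exact hf
    · intro hf
      obtain ⟨i, c, rfl⟩ := exists_eq_affinePt P
      exact ⟨i, c, rfl, hf⟩

end Copy

end Monster

theorem theorem4p1 {𝕜 : Type*} [Field 𝕜] [IsAlgClosed 𝕜] [CharZero 𝕜]
    {A : Type*} [CommRing A] [Algebra 𝕜 A]
    -- `A` is the coordinate ring of `U`, with local (étale) coordinates `x 0 = x₁`, `x 1 = x₂`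
    (x : Fin 2 → A)
    (hx : (MvPolynomial.aeval x : MvPolynomial (Fin 2) 𝕜 →ₐ[𝕜] A).toRingHom.Etale)
    -- the point `o` is the only common zero of `x₁`, `x₂` in `U`
    (o : A →ₐ[𝕜] 𝕜) (ho : ∀ u : A →ₐ[𝕜] 𝕜, (∀ i, u (x i) = 0) ↔ u = o)
    -- the curves `x₁ = 0` and `x₂ = 0` in `U` are irreducible
    (hirr : ∀ i, (Ideal.span {x i}).IsPrime)
    (k : ℕ) :
    -- `𝒳(k)` is flat over `T`
    (∀ p : Monster.Word k, RingHom.Flat (R := Polynomial 𝕜)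
      (S := Polynomial (Monster.ChartRing A k) ⧸ Monster.familyIdeal 𝕜 x p)
      (Monster.familyMap 𝕜 x p)) ∧
    -- the ideal of `X(k)₀` in each chart
    (∀ p : Monster.Word k,
      Monster.centralIdeal 𝕜 x p = Ideal.span (Monster.nodeBinomials x k p)) ∧
    ∃ (twig : Fin (2 ^ k + 1) → Set (Monster.Space 𝕜 x k))
      (word : Fin (2 ^ k) ≃o Lex (Monster.Word k)),
      -- the twigs are the `2 ^ k + 1` distinct irreducible components of `X(k)₀`
      Function.Injective twig ∧
      (∀ Z : Set (Monster.Space 𝕜 x k), Z ∈ Set.range twig ↔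
        Maximal (fun Y => IsIrreducible Y ∧ Y ⊆ Monster.centralFiber 𝕜 x k) Z) ∧
      (∀ i, IsClosed (twig i)) ∧
      (⋃ i, twig i) = Monster.centralFiber 𝕜 x k ∧
      -- they form a chain, consecutive twigs meet at the nodes in lexicographic order
      (∀ i : Fin (2 ^ k),
        twig i.castSucc ∩ twig i.succ = {Monster.node x o (ofLex (word i))}) ∧
      (∀ i j : Fin (2 ^ k + 1), (i : ℕ) + 1 < (j : ℕ) → Disjoint (twig i) (twig j)) ∧
      -- the end twigs
      twig 0 = Monster.iterProlong (Monster.zeroLocus x (x 1)) k ∧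
      twig (Fin.last (2 ^ k)) = Monster.iterProlong (Monster.zeroLocus x (x 0)) k ∧
      -- the interior twigs
      (∀ i, i ≠ 0 → i ≠ Fin.last (2 ^ k) →
        Monster.IsProlongedVertical (twig i) ∧ Monster.IsCopyOfP1 (twig i)) ∧
      -- in each chart there are two twigs, the axes of the two active coordinates, and
      -- the reduced curve has an ordinary node at the origin
      (∀ i : Fin (2 ^ k),
        (∀ j, (Monster.inChart (ofLex (word i)) (twig j)).Nonempty ↔
          j = i.castSucc ∨ j = i.succ) ∧
        Monster.inChart (ofLex (word i)) (twig i.castSucc) =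
          {q | ∀ c ∈ Monster.coords x k \ {Monster.active x k (ofLex (word i)) 0}, q c = 0} ∧
        Monster.inChart (ofLex (word i)) (twig i.succ) =
          {q | ∀ c ∈ Monster.coords x k \ {Monster.active x k (ofLex (word i)) 1}, q c = 0} ∧
        Monster.idealOf (ofLex (word i)) (twig i.castSucc) =
          Ideal.span (Monster.coords x k \ {Monster.active x k (ofLex (word i)) 0}) ∧
        Monster.idealOf (ofLex (word i)) (twig i.succ) =
          Ideal.span (Monster.coords x k \ {Monster.active x k (ofLex (word i)) 1}) ∧
        Monster.idealOf (ofLex (word i)) (Monster.centralFiber 𝕜 x k) =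
          Ideal.span (insert
            (Monster.active x k (ofLex (word i)) 0 * Monster.active x k (ofLex (word i)) 1)
            (Monster.coords x k \ {Monster.active x k (ofLex (word i)) 0,
              Monster.active x k (ofLex (word i)) 1}))) := by
  have ho' := (ho o).2 rfl
  refine ⟨Monster.flat_familyMap hx ho' hirr, Monster.centralIdeal_eq hx ho' hirr,
    fun i => Monster.twig 𝕜 x k i, Monster.chainOrderIso k,
    fun i j h => Fin.ext (Monster.eq_of_twig_subset hx ho hirr i.is_le h.subset),
    fun Z => Monster.mem_range_twig_iff_maximal hx ho hirr,
    fun i => Monster.isClosed_twig hx ho i, Monster.iUnion_twig hx ho hirr,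
    fun i => by simpa using Monster.twig_inter_twig_succ hx ho i.isLt,
    fun i j h => Monster.disjoint_twig hx ho h, Monster.twig_zero hx ho hirr k,
    Monster.twig_two_pow hx ho hirr k, fun i h0 h1 => ?_, fun i => ?_⟩
  · have hpos : 0 < (i : ℕ) := Nat.pos_of_ne_zero fun h => h0 (Fin.ext h)
    have hlt : (i : ℕ) < 2 ^ k := lt_of_le_of_ne i.is_le fun h => h1 (Fin.ext h)
    exact ⟨Monster.isProlongedVertical_twig hx ho hirr hpos hlt,
      Monster.isCopyOfP1_twig hx ho hpos hlt⟩
  · rw [Monster.ofLex_chainOrderIso]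
    have haxis (l : Fin 2) := Monster.inChart_twig hx ho (Monster.carries_chainWord i.isLt l)
    exact ⟨fun j => by simp [Monster.inChart_twig_nonempty_iff hx ho i.isLt, Fin.ext_iff],
      haxis 0, haxis 1, Monster.idealOf_of_inChart_eq_axis hx ho hirr (haxis 0),
      Monster.idealOf_of_inChart_eq_axis hx ho hirr (haxis 1),
      Monster.idealOf_centralFiber hx ho hirr _⟩
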